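/- **Setting.** Let $(\Omega,\mathscr F,\mathbb P)$ be a probability space, $(J,\mathscr J,\nu)$ a $\sigma$-finite measure space, and $N$ a Poisson random measure on $(\mathbb R_+\times J,\mathscr B(\mathbb R_+)\otimes\mathscr J)$ with intensity measure $dt\times\nu$: that is, $N(B)$ is an $\{0,1,2,\dots,\infty\}$-valued random variable for every measurable $B$, $B\mapsto N(\omega,B)$ is a measure for every $\omega$, $N(B)$ is Poisson distributed with parameter $(dt\times\nu)(B)$ (and $N(B)=\infty$ a.s. if this is $\infty$), and $N(B_1),\dots,N(B_n)$ are independent for pairwise disjoint $B_1,\dots,B_n$. For $B$ with $(dt\times\nu)(B)<\infty$ put $\tilde N(B)=N(B)-(dt\times\nu)(B)$. Let $\mathscr F_t$ be the $\sigma$-algebra generated by the random variables $N((s,u]\times A)$, $0\le s<u\le t$, $A\in\mathscr J$. Let $H$ be a (real or complex) Hilbert space. A *simple, adapted $H$-valued process* is a process of the form $$\phi=\sum_{i=1}^{l}\sum_{j=1}^{m}\sum_{k=1}^{n}F_{ijk}\,\mathbf 1_{(t_i,t_{i+1}]}\mathbf 1_{A_j}x_{ijk},$$ where $0=t_1<\dots<t_{l+1}<\infty$,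 $F_{ijk}\in L^\infty(\Omega,\mathscr F_{t_i})$, the sets $A_1,\dots,A_m\in\mathscr J$ are disjoint with $\nu(A_j)<\infty$, and $x_{ijk}\in H$. For $t>0$ and $B\in\mathscr J$ its stochastic integral is $$\int_{(0,t]\times B}\phi\,d\tilde N=\sum_{i,j,k}F_{ijk}\,\tilde N\big((t_i\wedge t,t_{i+1}\wedge t]\times(A_j\cap B)\big)\,x_{ijk}.$$ For $1\le p,q<\infty$ let $$\|\phi\|_{\mathscr D^p_{q,H}}=\Big(\mathbb E\Big(\int_{\mathbb R_+\times J}\|\phi\|_H^q\,dt\times d\nu\Big)^{p/q}\Big)^{1/p}$$ be the norm of $\mathscr D^p_{q,H}=L^p(\Omega;L^q(\mathbb R_+\times J;H))$, let $\|\phi\|_{\mathscr D^p_{2,H}\cap\mathscr D^p_{p,H}}=\max\{\|\phi\|_{\mathscr D^p_{2,H}},\|\phi\|_{\mathscr D^p_{p,H}}\}$, and let $\|\phi\|_{\mathscr D^p_{2,H}+\mathscr D^p_{p,H}}$ be the infimum of $\|\phi_1\|_{\mathscr D^p_{2,H}}+\|\phi_2\|_{\mathscr D^p_{p,H}}$ over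 all decompositions $\phi=\phi_1+\phi_2$ (a.e.) with $\phi_1\in\mathscr D^p_{2,H}$, $\phi_2\in\mathscr D^p_{p,H}$. A process $\phi:\Omega\times\mathbb R_+\times J\to H$ is *$L^p$-stochastically integrable* if there are simple, adapted $\phi_n$ with $\phi_n\to\phi$ a.e. with respect to $\mathbb P\times dt\times\nu$ and such that $\int_{(0,t]\times B}\phi_n\,d\tilde N$ converges in $L^p(\Omega;H)$ for all $B\in\mathscr J$ and $t>0$. **Statement.** Let $1<p<\infty$, and let $\mathscr I_p=\mathscr D^p_{2,H}\cap\mathscr D^p_{p,H}$ if $2\le p<\infty$ and $\mathscr I_p=\mathscr D^p_{2,H}+\mathscr D^p_{p,H}$ if $1<p<2$. (a) There are constants $c_p,C_p\in(0,\infty)$ depending only on $p$ such that for every simple, adapted $H$-valued process $\phi$ and every $B\in\mathscr J$, $$c_p\,\|\phi\mathbf 1_B\|_{\mathscr I_p}\le\Big(\mathbb E\sup_{t>0}\Big\|\int_{(0,t]\times B}\phi\,d\tilde N\Big\|_H^p\Big)^{1/p}\le C_p\,\|\phi\mathbf 1_B\|_{\mathscr I_p}.$$ (b) A process $\phi:\Omega\times\mathbb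 R_+\times J\to H$ is $L^p$-stochastically integrable if and only if it is strongly measurable (up to a $\mathbb P\times dt\times\nu$-null set) and, for every $t>0$, the process $\phi\mathbf 1_{(0,t]\times J}$ belongs to the closure in $\mathscr I_p$ of the simple, adapted $H$-valued processes. -/

import Mathlib

open MeasureTheory ProbabilityTheory Filter Set
open scoped NNReal ENNReal Topology

universe uΩ uJ uH uK

namespace PoissonSI

noncomputable section

/-! ### Lebesgue measure on the half-line -/

/-- Lebesgue measure `dt` on `ℝ₊ = [0, ∞)`, realised on the type `ℝ≥0`. -/
def timeMeasure : Measure ℝ≥0 := Measure.comap NNReal.toReal volume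

theorem measurableEmbedding_toReal : MeasurableEmbedding NNReal.toReal :=
  MeasurableEmbedding.subtype_coe measurableSet_Ici

theorem timeMeasure_Ioc (a b : ℝ≥0) :
    timeMeasure (Ioc a b) = ENNReal.ofReal ((b : ℝ) - a) := by
  have h : NNReal.toReal '' Ioc a b = Ioc (a : ℝ) b := by
    ext x
    constructor
    · rintro ⟨y, ⟨h1, h2⟩, rfl⟩
      exact ⟨by exact_mod_cast h1, by exact_mod_cast h2⟩
    · rintro ⟨h1, h2⟩
      exact ⟨⟨x, a.2.trans h1.le⟩, ⟨by exact_mod_cast h1, by exact_mod_cast h2⟩, rfl⟩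
  rw [timeMeasure, measurableEmbedding_toReal.comap_apply, h, Real.volume_Ioc]

instance : SigmaFinite timeMeasure := by
  refine ⟨⟨⟨fun n => Iic (n : ℝ≥0), fun _ => trivial, fun n => ?_, ?_⟩⟩⟩
  · have h : NNReal.toReal '' Iic (n : ℝ≥0) ⊆ Icc (0 : ℝ) n := by
      rintro _ ⟨y, hy, rfl⟩
      exact ⟨y.2, by exact_mod_cast hy⟩
    rw [timeMeasure, measurableEmbedding_toReal.comap_apply]
    exact (measure_mono h).trans_lt (by simp [Real.volume_Icc])
  · refine eq_univ_of_forall fun x => ?_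
    obtain ⟨n, hn⟩ := exists_nat_ge x
    exact mem_iUnion.2 ⟨n, hn⟩

/-! ### Poisson random measures -/

/-- `N` is a Poisson random measure on `(E, 𝓔)`, defined on the probability space `(Ω, P)`, with
`σ`-finite intensity measure `μ`. -/
structure IsPoissonRandomMeasure {Ω : Type*} [MeasurableSpace Ω] (P : Measure Ω)
    {E : Type*} [MeasurableSpace E] (N : Ω → Measure E) (μ : Measure E) : Prop where
  /-- Every `N(B)` is a random variable. -/
  measurable : ∀ B : Set E, MeasurableSet B → Measurable (fun ω => N ω B)
  /-- `N` takes values in `{0, 1, 2, …} ∪ {∞}`. -/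
  integerValued : ∀ (ω : Ω) (B : Set E), MeasurableSet B → ∃ n : ℕ∞, N ω B = (n : ℝ≥0∞)
  /-- `μ(B) = 𝔼 N(B)`. -/
  intensity : ∀ B : Set E, MeasurableSet B → ∫⁻ ω, N ω B ∂P = μ B
  sigmaFinite : SigmaFinite μ
  /-- `N(B)` is Poisson distributed with parameter `μ(B)` if this is finite. -/
  poisson : ∀ B : Set E, MeasurableSet B → μ B ≠ ∞ →
    P.map (fun ω => N ω B) =
      (poissonMeasure (μ B).toNNReal).map (fun n : ℕ => (n : ℝ≥0∞))
  /-- If `μ(B) = ∞` then `N(B) = ∞` almost surely. -/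
  poisson_top : ∀ B : Set E, MeasurableSet B → μ B = ∞ → ∀ᵐ ω ∂P, N ω B = ∞
  /-- `N(B₁), …, N(Bₙ)` are independent for pairwise disjoint `B₁, …, Bₙ`. -/
  indep : ∀ (n : ℕ) (B : Fin n → Set E), (∀ i, MeasurableSet (B i)) →
    Pairwise (fun i j => Disjoint (B i) (B j)) →
    iIndepFun (fun (i : Fin n) (ω : Ω) => N ω (B i)) P

/-- The compensated Poisson random measure `Ñ(B) = N(B) - μ(B)`; it is only used for `B` with
`μ(B) < ∞`, in which case `N(B) < ∞` almost surely. -/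
def compensated {Ω E : Type*} [MeasurableSpace E] (N : Ω → Measure E) (μ : Measure E)
    (B : Set E) (ω : Ω) : ℝ :=
  (N ω B).toReal - (μ B).toReal

/-- The `σ`-algebra `𝓕_t` generated by the random variables `N((s, u] × A)` with
`0 ≤ s < u ≤ t` and `A ∈ 𝓙`. For `t = 0` this is the trivial `σ`-algebra. -/
@[reducible] def natFiltration {Ω : Type*} {J : Type*} [MeasurableSpace J]
    (N : Ω → Measure (ℝ≥0 × J)) (t : ℝ≥0) : MeasurableSpace Ω :=
  ⨆ (s : ℝ≥0) (u : ℝ≥0) (A : Set J) (_ : s < u) (_ : u ≤ t) (_ : MeasurableSet A),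
    MeasurableSpace.comap (fun ω => N ω (Ioc s u ×ˢ A)) inferInstance

/-! ### Simple adapted processes and their stochastic integrals -/

/-- (A representation of) a simple, adapted `H`-valued process
`φ = ∑ᵢⱼₖ Fᵢⱼₖ 1_{(tᵢ, tᵢ₊₁]} 1_{Aⱼ} xᵢⱼₖ`. The condition `Fᵢⱼₖ ∈ L^∞(Ω, 𝓕_{tᵢ})` is expressed
by the fields `F_meas` (`Fᵢⱼₖ` agrees a.s. with an `𝓕_{tᵢ}`-measurable function) and `F_bdd`
(`Fᵢⱼₖ` is essentially bounded). -/
structure SimpleAdapted (𝕜 : Type*) [RCLike 𝕜] {Ω : Type*} [MeasurableSpace Ω] (P : Measure Ω)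
    {J : Type*} [MeasurableSpace J] (ν : Measure J) (N : Ω → Measure (ℝ≥0 × J))
    (H : Type*) [NormedAddCommGroup H] [NormedSpace 𝕜 H] where
  l : ℕ
  m : ℕ
  n : ℕ
  t : Fin (l + 1) → ℝ≥0
  t_zero : t 0 = 0
  t_strictMono : StrictMono t
  A : Fin m → Set J
  A_meas : ∀ j, MeasurableSet (A j)
  A_disj : Pairwise (fun j j' => Disjoint (A j) (A j'))
  A_fin : ∀ j, ν (A j) < ∞
  F : Fin l → Fin m → Fin n → Ω → 𝕜
  F_meas : ∀ i j k, AEStronglyMeasurable[natFiltration N (t i.castSucc)] (F i j k) P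
  F_bdd : ∀ i j k, eLpNorm (F i j k) ⊤ P < ∞
  x : Fin l → Fin m → Fin n → H

namespace SimpleAdapted

variable {𝕜 : Type*} [RCLike 𝕜] {Ω : Type*} [MeasurableSpace Ω] {P : Measure Ω}
  {J : Type*} [MeasurableSpace J] {ν : Measure J} {N : Ω → Measure (ℝ≥0 × J)}
  {H : Type*} [NormedAddCommGroup H] [NormedSpace 𝕜 H]

/-- The process `φ : Ω × ℝ₊ × J → H` itself. -/
def toFun (φ : SimpleAdapted 𝕜 P ν N H) (ω : Ω) (z : ℝ≥0 × J) : H :=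
  ∑ i, ∑ j, ∑ k,
    (Ioc (φ.t i.castSucc) (φ.t i.succ) ×ˢ φ.A j).indicator
      (fun _ => φ.F i j k ω • φ.x i j k) z

/-- The compensated Poisson stochastic integral
`I_{t,B}(φ) = ∑ᵢⱼₖ Fᵢⱼₖ Ñ((tᵢ ∧ t, tᵢ₊₁ ∧ t] × (Aⱼ ∩ B)) xᵢⱼₖ`. -/
def integral (φ : SimpleAdapted 𝕜 P ν N H) (t : ℝ≥0) (B : Set J) (ω : Ω) : H :=
  ∑ i, ∑ j, ∑ k,
    (φ.F i j k ω *
      ((compensated N (timeMeasure.prod ν)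
        (Ioc (min (φ.t i.castSucc) t) (min (φ.t i.succ) t) ×ˢ (φ.A j ∩ B)) ω : ℝ) : 𝕜)) •
      φ.x i j k

/-- The maximal norm `(𝔼 sup_{t > 0} ‖∫_{(0,t] × B} φ dÑ‖ ^ p) ^ (1/p)`. -/
def maximalNorm (p : ℝ) (φ : SimpleAdapted 𝕜 P ν N H) (B : Set J) : ℝ≥0∞ :=
  (∫⁻ ω, (⨆ (t : ℝ≥0) (_ : 0 < t), ‖φ.integral t B ω‖ₑ ^ p) ∂P) ^ (1 / p)

end SimpleAdapted

/-! ### The norms of the integrands -/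

section Norms

variable {Ω : Type*} [MeasurableSpace Ω] {E : Type*} [MeasurableSpace E]
  {H : Type*} [NormedAddCommGroup H]

/-- The norm `(𝔼 (∫_E ‖f‖ ^ q dμ) ^ (p/q)) ^ (1/p)` of `𝓓^p_q = L^p(Ω; L^q(E; H))`. -/
def mixedNorm (P : Measure Ω) (μ : Measure E) (p q : ℝ) (f : Ω → E → H) : ℝ≥0∞ :=
  (∫⁻ ω, (∫⁻ z, ‖f ω z‖ₑ ^ q ∂μ) ^ (p / q) ∂P) ^ (1 / p)

/-- The norm of `𝓓^p_2 ∩ 𝓓^p_p`. -/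
def interNorm (P : Measure Ω) (μ : Measure E) (p : ℝ) (f : Ω → E → H) : ℝ≥0∞ :=
  max (mixedNorm P μ p 2 f) (mixedNorm P μ p p f)

/-- The norm of `𝓓^p_2 + 𝓓^p_p`: the infimum of `‖f₁‖ + ‖f₂‖` over all decompositions
`f = f₁ + f₂` into strongly measurable `f₁`, `f₂` (decompositions in which one of the two norms
is infinite do not influence the infimum). -/
def sumNorm (P : Measure Ω) (μ : Measure E) (p : ℝ) (f : Ω → E → H) : ℝ≥0∞ :=
  ⨅ (f₁ : Ω → E → H) (f₂ : Ω → E → H)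
    (_ : AEStronglyMeasurable (fun y : Ω × E => f₁ y.1 y.2) (P.prod μ))
    (_ : AEStronglyMeasurable (fun y : Ω × E => f₂ y.1 y.2) (P.prod μ))
    (_ : ∀ᵐ y ∂(P.prod μ), f y.1 y.2 = f₁ y.1 y.2 + f₂ y.1 y.2),
    mixedNorm P μ p 2 f₁ + mixedNorm P μ p p f₂

end Norms

/-- The process `φ 1_S` for a set `S ⊆ ℝ₊ × J`. -/
def indicatorProcess {Ω E H : Type*} [Zero H] (φ : Ω → E → H) (S : Set E) (ω : Ω) (z : E) : H :=
  S.indicator (φ ω) z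

/-! ### `L^p`-stochastic integrability -/

section Integrability

variable (𝕜 : Type*) [RCLike 𝕜] {Ω : Type*} [MeasurableSpace Ω] (P : Measure Ω)
  {J : Type*} [MeasurableSpace J] (ν : Measure J) (N : Ω → Measure (ℝ≥0 × J))
  {H : Type*} [NormedAddCommGroup H] [NormedSpace 𝕜 H]

/-- `φ` is `L^p`-stochastically integrable with respect to `Ñ`: there are simple, adapted `φₙ`
with `φₙ → φ` almost everywhere such that `∫_{(0,t] × B} φₙ dÑ` converges in `L^p(Ω; H)` for all
`B ∈ 𝓙` and `t > 0`. -/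
def IsLpStochIntegrable (p : ℝ) (φ : Ω → ℝ≥0 × J → H) : Prop :=
  ∃ φn : ℕ → SimpleAdapted 𝕜 P ν N H,
    (∀ᵐ y ∂(P.prod (timeMeasure.prod ν)),
      Tendsto (fun n => (φn n).toFun y.1 y.2) atTop (𝓝 (φ y.1 y.2))) ∧
    ∀ (B : Set J), MeasurableSet B → ∀ t : ℝ≥0, 0 < t →
      ∃ Y : Ω → H, MemLp Y (ENNReal.ofReal p) P ∧
        Tendsto (fun n => eLpNorm (fun ω => (φn n).integral t B ω - Y ω) (ENNReal.ofReal p) P)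
          atTop (𝓝 0)

/-- For every `t > 0`, the process `φ 1_{(0,t] × J}` belongs to the closure of the simple adapted
processes with respect to the given norm on (strongly measurable) processes. -/
def LocallyInClosure (nrm : (Ω → ℝ≥0 × J → H) → ℝ≥0∞) (φ : Ω → ℝ≥0 × J → H) : Prop :=
  AEStronglyMeasurable (fun y : Ω × (ℝ≥0 × J) => φ y.1 y.2) (P.prod (timeMeasure.prod ν)) ∧
  ∀ t : ℝ≥0, 0 < t → ∀ ε : ℝ≥0∞, 0 < ε →
    ∃ ψ : SimpleAdapted 𝕜 P ν N H,
      nrm (fun ω z => indicatorProcess φ (Ioc 0 t ×ˢ univ) ω z - ψ.toFun ω z) < ε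

end Integrability

end

end PoissonSI

open PoissonSI

namespace PoissonSI

/-! ### Convexity inequalities in Hilbert spaces -/

section Inequalities

/-! A simple integrand lives on finitely many boxes. Cutting `ℝ₊ × J` into disjoint cells of
intensity at most `1 / 2` turns its integral into a discrete martingale `∑ D k • ξ k`, where `D k`
is a centred Poisson variable independent of the past and `ξ k` is predictable (`exists_steps`). The
intensities `c k` weight the sums so that `∑ c k * ‖ξ k‖ ^ q` is exactly `∫ ‖φ‖ ^ q`. No constant
depends on the number of cells.

The engine is the first-order expansion of `‖x + y‖ ^ p` in a Hilbert space with a controlled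
remainder. Averaging `y = z • ξ` over the law of `D k` kills the linear term. Variance `c` and a
`p`-th moment of order `c` bound the remainder from above; the atom at one jump, of mass at least `c
/ 2`, bounds it from below. The resulting one-step inequalities are telescoped along the martingale.

For `p ≥ 2` the upper remainder is `‖x‖ ^ (p - 2) * c * ‖ξ‖ ^ 2 + c * ‖ξ‖ ^ p`; Doob's inequality
and Young's inequality absorb the first term, up to the bracket, into the left side
(`exists_lintegral_stepSum_le_of_two_le`). The two norms in the maximum are bounded below
separately: the `p`-norm by uniform convexity (`IsPoissonSteps.lintegral_stepPow_le`), the square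
function by testing `‖M‖ ^ 2` against powers of the predictable bracket
(`IsPoissonSteps.lintegral_stepVar_le`).

For `p < 2` the remainder is governed by `gain p R x`, equal to `x ^ 2 * R ^ (p - 2)` below the
level `R` and to `x ^ p` above it, which is how the sum of an `L²` and an `L^p` norm behaves. For
the lower bound, `R` is the maximum of the martingale, and truncating the integrand at this random
level produces a decomposition; no adaptedness is needed, because the sum norm asks for none. For
the upper bound, `‖M‖ ^ p` is replaced by `(‖M‖ ^ 2 + Λ ^ 2) ^ (p / 2)` with a predictable `Λ` whose
`p`-th power follows the recursion `predMajorant`. This majorant is controlled at every fixed level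
`s` (`predMajorant_le`), and optimising `s` for each `ω` compares it with an arbitrary
decomposition.

The supremum over continuous time comes from Doob's inequality on grids and right continuity. Part
(b) is then completeness: each norm is countably subadditive and summable series converge almost
everywhere (`IsProcessNorm`), while the two-sided estimate makes Cauchy sequences of integrals and
of integrands the same. -/

theorem rpow_add_rpow_le_of_add_eq {q u v w z : ℝ} (hq0 : 0 ≤ q) (hq1 : q ≤ 1) (hu : 0 ≤ u)
    (huv : u ≤ v) (huw : u ≤ w) (h : v + w = u + z) : u ^ q + z ^ q ≤ v ^ q + w ^ q := by
  rcases eq_or_lt_of_le huv with rfl | huv'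
  · have : w = z := by linarith
    rw [this]
  have hz : u < z := by linarith
  -- `v` and `w` are convex combinations of `u` and `z` with interchanged weights, so the weights
  -- cancel when the two concavity inequalities are added.
  have hc := Real.concaveOn_rpow hq0 hq1
  have hd : (0 : ℝ) < z - u := by linarith
  have hθ0 : 0 ≤ (z - v) / (z - u) := div_nonneg (by linarith) hd.le
  have hθ1 : 0 ≤ (v - u) / (z - u) := div_nonneg (by linarith) hd.le
  have hs : (z - v) / (z - u) + (v - u) / (z - u) = 1 := by field_simp; ring
  have h1 := hc.2 (mem_Ici.2 hu) (mem_Ici.2 (hu.trans hz.le)) hθ0 hθ1 hs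
  have h2 := hc.2 (mem_Ici.2 hu) (mem_Ici.2 (hu.trans hz.le)) hθ1 hθ0 (by linarith)
  have e1 : ((z - v) / (z - u)) • u + ((v - u) / (z - u)) • z = v := by
    simp only [smul_eq_mul]; field_simp; ring
  have e2 : ((v - u) / (z - u)) • u + ((z - v) / (z - u)) • z = w := by
    have : w = u + z - v := by linarith
    simp only [smul_eq_mul]; rw [this]; field_simp; ring
  rw [e1] at h1
  rw [e2] at h2
  simp only [smul_eq_mul] at h1 h2
  have e3 : ((z - v) / (z - u)) = 1 - (v - u) / (z - u) := by linarith
  rw [e3] at h1 h2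
  nlinarith

/-- Right side minus quadratic term is increasing in `β`: in its derivative `(1 + x) ^ (p - 1) ≥ 1`,
while Bernoulli gives `(1 - x) ^ (p - 1) ≤ 1 - (p - 1) * x`. -/
theorem two_add_le_rpow_add_rpow {p β : ℝ} (hp1 : 1 < p) (hp2 : p < 2) (hβ0 : 0 ≤ β)
    (hβ1 : β ≤ 1) :
    2 + p * (p - 1) / 2 * β ^ 2 ≤ (1 + β) ^ p + (1 - β) ^ p := by
  set f : ℝ → ℝ := fun β => (1 + β) ^ p + (1 - β) ^ p - p * (p - 1) / 2 * β ^ 2 with hf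
  have hd : ∀ x, HasDerivAt f (p * (1 + x) ^ (p - 1) - p * (1 - x) ^ (p - 1)
      - p * (p - 1) * x) x := by
    intro x
    have h1 : HasDerivAt (fun y : ℝ => (1 + y) ^ p) (1 * p * (1 + x) ^ (p - 1)) x :=
      ((hasDerivAt_id x).const_add 1).rpow_const (Or.inr hp1.le)
    have h2 : HasDerivAt (fun y : ℝ => (1 - y) ^ p) ((-1) * p * (1 - x) ^ (p - 1)) x :=
      ((hasDerivAt_id x).const_sub 1).rpow_const (Or.inr hp1.le)
    have h3 : HasDerivAt (fun y : ℝ => p * (p - 1) / 2 * y ^ 2)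
        (p * (p - 1) / 2 * (2 * x)) x := by
      simpa using ((hasDerivAt_pow 2 x).const_mul (p * (p - 1) / 2))
    refine ((h1.add h2).sub h3).congr_deriv ?_
    ring
  have hm : MonotoneOn f (Icc 0 1) := by
    apply monotoneOn_of_deriv_nonneg (convex_Icc 0 1)
    · exact fun x _ => (hd x).continuousAt.continuousWithinAt
    · exact fun x _ => (hd x).differentiableAt.differentiableWithinAt
    · intro x hx
      rw [interior_Icc] at hx
      rw [(hd x).deriv]
      have h1 : (1 : ℝ) ≤ (1 + x) ^ (p - 1) := Real.one_le_rpow (by linarith [hx.1]) (by linarith)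
      have h2 : (1 + -x) ^ (p - 1) ≤ 1 + (p - 1) * (-x) :=
        rpow_one_add_le_one_add_mul_self (by linarith [hx.2]) (by linarith) (by linarith)
      rw [← sub_eq_add_neg] at h2
      nlinarith
  have := hm (left_mem_Icc.2 zero_le_one) ⟨hβ0, hβ1⟩ hβ0
  simp only [hf] at this
  norm_num at this
  linarith

/-- The gain function `x² max(R, x) ^ (p - 2)`, which for `p < 2` is comparable to the minimum of
`x² R ^ (p - 2)` and `x ^ p`. -/
noncomputable def gain (p R x : ℝ) : ℝ := x ^ 2 * max R x ^ (p - 2)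

theorem gain_nonneg {p R x : ℝ} (hx : 0 ≤ x) : 0 ≤ gain p R x :=
  mul_nonneg (sq_nonneg _) (Real.rpow_nonneg (hx.trans (le_max_right _ _)) _)

theorem gain_zero (p R : ℝ) : gain p R 0 = 0 := by simp [gain]

theorem sq_mul_rpow_sub_two {p x : ℝ} (hp : 0 < p) (hx : 0 ≤ x) : x ^ 2 * x ^ (p - 2) = x ^ p := by
  rcases hx.eq_or_lt with rfl | hx
  · simp [Real.zero_rpow hp.ne']
  · rw [← Real.rpow_natCast, ← Real.rpow_add hx]; congr 1; push_cast; ring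

theorem gain_of_le {p R x : ℝ} (hp : 0 < p) (hx : 0 ≤ x) (h : R ≤ x) : gain p R x = x ^ p := by
  rw [gain, max_eq_right h, sq_mul_rpow_sub_two hp hx]

theorem gain_of_ge {p R x : ℝ} (h : x ≤ R) : gain p R x = x ^ 2 * R ^ (p - 2) := by
  rw [gain, max_eq_left h]

theorem gain_anti {p R R' x : ℝ} (hp : p ≤ 2) (hx : 0 ≤ x) (h : R ≤ R') :
    gain p R' x ≤ gain p R x := by
  rcases hx.eq_or_lt with rfl | hx
  · simp [gain]
  · exact mul_le_mul_of_nonneg_left (Real.rpow_le_rpow_of_nonpos (hx.trans_le (le_max_right _ _))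
      (max_le_max_right _ h) (by linarith)) (sq_nonneg _)

theorem gain_le_rpow {p R x : ℝ} (hp0 : 0 < p) (hp : p ≤ 2) (hx : 0 ≤ x) : gain p R x ≤ x ^ p := by
  rcases le_total R x with h | h
  · rw [gain_of_le hp0 hx h]
  · exact (gain_anti hp hx h).trans_eq (gain_of_le hp0 hx le_rfl)

theorem gain_le_sq {p R x : ℝ} (hp : p ≤ 2) (hR : 0 < R) : gain p R x ≤ x ^ 2 * R ^ (p - 2) :=
  mul_le_mul_of_nonneg_left (Real.rpow_le_rpow_of_nonpos hR (le_max_left _ _) (by linarith))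
    (sq_nonneg _)

theorem gain_mono {p R x y : ℝ} (hp0 : 0 < p) (hR : 0 ≤ R) (hx : 0 ≤ x) (h : x ≤ y) :
    gain p R x ≤ gain p R y := by
  have key : ∀ {a b : ℝ}, 0 ≤ a → a ≤ b → b ≤ R → gain p R a ≤ gain p R b := by
    intro a b ha hab hb
    rw [gain_of_ge hb, gain_of_ge (hab.trans hb)]
    gcongr
  have key2 : ∀ {a b : ℝ}, 0 ≤ a → a ≤ b → R ≤ a → gain p R a ≤ gain p R b := by
    intro a b ha hab hb
    rw [gain_of_le hp0 ha hb, gain_of_le hp0 (ha.trans hab) (hb.trans hab)]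
    gcongr
  rcases le_total y R with h1 | h1
  · exact key hx h h1
  · rcases le_total R x with h2 | h2
    · exact key2 hx h h2
    · exact (key hx h2 le_rfl).trans (key2 hR h1 le_rfl)

theorem gain_two_mul {p R x : ℝ} (hp : p ≤ 2) (hx : 0 ≤ x) :
    gain p R (2 * x) ≤ 4 * gain p R x := by
  rcases hx.eq_or_lt with rfl | hx
  · simp [gain]
  · have : gain p R (2 * x) ≤ (2 * x) ^ 2 * max R x ^ (p - 2) :=
      mul_le_mul_of_nonneg_left (Real.rpow_le_rpow_of_nonpos (hx.trans_le (le_max_right _ _))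
        (max_le_max_left _ (by linarith)) (by linarith)) (sq_nonneg _)
    refine this.trans_eq ?_
    rw [gain]; ring

/-- `z` is at most twice the larger of `x` and `y`, and doubling costs a factor `4`. This is how
`gain` is compared with an arbitrary decomposition into an `L²` part and an `L^p` part. -/
theorem gain_add_le {p R x y z : ℝ} (hp0 : 0 < p) (hp : p ≤ 2) (hR : 0 < R) (hz : 0 ≤ z)
    (hx : 0 ≤ x) (hy : 0 ≤ y) (h : z ≤ x + y) :
    gain p R z ≤ 4 * (x ^ 2 * R ^ (p - 2)) + 4 * y ^ p := by
  have h1 : 0 ≤ x ^ 2 * R ^ (p - 2) := by positivity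
  have h2 : 0 ≤ y ^ p := by positivity
  rcases le_total x y with hxy | hxy
  · have : gain p R z ≤ gain p R (2 * y) := gain_mono hp0 hR.le hz (by linarith)
    have := gain_two_mul (R := R) hp hy
    have := gain_le_rpow (R := R) hp0 hp hy
    linarith
  · have : gain p R z ≤ gain p R (2 * x) := gain_mono hp0 hR.le hz (by linarith)
    have := gain_two_mul (R := R) hp hx
    have := gain_le_sq (x := x) hp hR
    linarith

theorem two_mul_rpow_add_gain_le {p α β : ℝ} (hp1 : 1 < p) (hp2 : p < 2) (hα : 0 ≤ α)
    (hβ : 0 ≤ β) :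
    2 * α ^ p + p * (p - 1) / 2 * gain p α β ≤ (α + β) ^ p + |α - β| ^ p := by
  have main : ∀ {a b : ℝ}, 0 < a → 0 ≤ b → b ≤ a →
      2 * a ^ p + p * (p - 1) / 2 * (b ^ 2 * a ^ (p - 2)) ≤ (a + b) ^ p + |a - b| ^ p := by
    intro a b ha hb hba
    have h := two_add_le_rpow_add_rpow hp1 hp2 (div_nonneg hb ha.le) ((div_le_one ha).2 hba)
    have e1 : (a + b) ^ p = a ^ p * (1 + b / a) ^ p := by
      rw [← Real.mul_rpow ha.le (by positivity)]; congr 1; field_simp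
    have h1 : 0 ≤ 1 - b / a := by have := (div_le_one ha).2 hba; linarith
    have e2 : |a - b| ^ p = a ^ p * (1 - b / a) ^ p := by
      rw [abs_of_nonneg (by linarith), ← Real.mul_rpow ha.le h1]; congr 1; field_simp
    have e3 : a ^ p = a ^ 2 * a ^ (p - 2) := (sq_mul_rpow_sub_two (by linarith) ha.le).symm
    rw [e1, e2, ← mul_add]
    refine le_trans (le_of_eq ?_) (mul_le_mul_of_nonneg_left h (Real.rpow_nonneg ha.le _))
    rw [e3]; field_simp
  have hc1 : p * (p - 1) / 2 ≤ 1 := by nlinarith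
  have hc0 : 0 ≤ p * (p - 1) / 2 := by nlinarith
  rcases le_total β α with h | h
  · rcases hα.eq_or_lt with rfl | hα'
    · have : β = 0 := le_antisymm h hβ
      subst this
      simp [gain, Real.zero_rpow (by linarith : p ≠ 0)]
    · rw [gain_of_ge h]; exact main hα' hβ h
  · rcases hβ.eq_or_lt with rfl | hβ'
    · have : α = 0 := le_antisymm h hα
      subst this
      simp [gain, Real.zero_rpow (by linarith : p ≠ 0)]
    · have h0 := main hβ' hα h
      rw [gain_of_le (by linarith) hβ h, add_comm α β, abs_sub_comm]
      -- With `k = p * (p - 1) / 2 ≤ 1`, exchanging `α` and `β` leaves `2 * α ^ p + k * β ^ p ≤ 2 *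
      -- β ^ p + k * α ^ 2 * β ^ (p - 2)`. It follows from `α ^ p ≤ α * β * β ^ (p - 2)` after
      -- factoring out `β ^ (p - 2)`.
      refine le_trans ?_ h0
      have e3 : β ^ p = β ^ 2 * β ^ (p - 2) := (sq_mul_rpow_sub_two (by linarith) hβ).symm
      have hab : α ^ p ≤ α * β * β ^ (p - 2) := by
        have : β ^ (p - 1) = β * β ^ (p - 2) := by
          rw [← Real.rpow_one_add' hβ (by linarith)]; congr 1; ring
        rcases hα.eq_or_lt with rfl | hα'
        · simp [Real.zero_rpow (by linarith : p ≠ 0)]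
        rw [mul_assoc, ← this]
        have : α ^ p = α * α ^ (p - 1) := by
          rw [← Real.rpow_one_add' hα (by linarith)]; congr 1; ring
        rw [this]
        gcongr
      have hk : 0 ≤ β ^ (p - 2) := Real.rpow_nonneg hβ _
      rw [e3]
      have hk2 : 2 * (α * β) + p * (p - 1) / 2 * β ^ 2 ≤
          2 * β ^ 2 + p * (p - 1) / 2 * α ^ 2 := by
        have : p * (p - 1) / 2 * (β ^ 2 - α ^ 2) ≤ 1 * (β ^ 2 - α ^ 2) :=
          mul_le_mul_of_nonneg_right hc1 (by nlinarith)
        nlinarith [sq_nonneg (α - β)]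
      nlinarith [mul_le_mul_of_nonneg_right hk2 hk]

variable {H : Type*} [NormedAddCommGroup H] [InnerProductSpace ℝ H]

local notation "⟪" x ", " y "⟫" => inner ℝ x y

/-- The numbers `‖a + b‖ ^ 2` and `‖a - b‖ ^ 2` have the same sum as `(‖a‖ + ‖b‖) ^ 2` and `(‖a‖ -
‖b‖) ^ 2` but are less spread out. By concavity of `t ^ (p / 2)` the collinear case is the worst
one, and there the scalar inequality applies. -/
theorem norm_add_rpow_add_norm_sub_rpow_ge {p : ℝ} (hp1 : 1 < p) (hp2 : p < 2) (a b : H) :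
    2 * ‖a‖ ^ p + p * (p - 1) / 2 * gain p ‖a‖ ‖b‖ ≤ ‖a + b‖ ^ p + ‖a - b‖ ^ p := by
  refine (two_mul_rpow_add_gain_le hp1 hp2 (norm_nonneg a) (norm_nonneg b)).trans ?_
  have e : ∀ {t : ℝ}, 0 ≤ t → t ^ p = (t ^ 2) ^ (p / 2) := by
    intro t ht
    rw [← Real.rpow_natCast, ← Real.rpow_mul ht]; congr 1; push_cast; ring
  have h1 := norm_add_sq_real a b
  have h2 := norm_sub_sq_real a b
  have h3 := abs_le.1 (abs_real_inner_le_norm a b)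
  rw [e (add_nonneg (norm_nonneg a) (norm_nonneg b)), e (abs_nonneg _), e (norm_nonneg (a + b)),
    e (norm_nonneg (a - b)), sq_abs, add_comm (((‖a‖ + ‖b‖) ^ 2) ^ (p / 2))]
  apply rpow_add_rpow_le_of_add_eq (by linarith) (by linarith) (sq_nonneg _)
  · rw [h1]; nlinarith
  · rw [h2]; nlinarith
  · rw [h1, h2]; ring

/-- The tangent inequality of a convex function: Cauchy–Schwarz reduces it to Bernoulli's inequality
for `‖x + y‖ / ‖x‖`. -/
theorem norm_add_rpow_ge {p : ℝ} (hp : 1 ≤ p) (x y : H) :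
    ‖x‖ ^ p + p * ‖x‖ ^ (p - 2) * ⟪x, y⟫ ≤ ‖x + y‖ ^ p := by
  rcases eq_or_ne x 0 with rfl | hx
  · simp [Real.zero_rpow (by linarith : p ≠ 0)]; positivity
  have hr : 0 < ‖x‖ := norm_pos_iff.2 hx
  have h1 : ⟪x, y⟫ ≤ ‖x‖ * ‖x + y‖ - ‖x‖ ^ 2 := by
    have := real_inner_le_norm x (x + y)
    rw [inner_add_right, real_inner_self_eq_norm_sq] at this
    linarith
  have h2 := one_add_mul_self_le_rpow_one_add (s := ‖x + y‖ / ‖x‖ - 1)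
    (by linarith [div_nonneg (norm_nonneg (x + y)) hr.le]) hp
  have e : 1 + (‖x + y‖ / ‖x‖ - 1) = ‖x + y‖ / ‖x‖ := by ring
  rw [e, Real.div_rpow (norm_nonneg _) hr.le, le_div_iff₀ (by positivity)] at h2
  refine le_trans ?_ h2
  have h3 : p * ‖x‖ ^ (p - 2) * ⟪x, y⟫ ≤ p * ‖x‖ ^ (p - 2) * (‖x‖ * ‖x + y‖ - ‖x‖ ^ 2) :=
    mul_le_mul_of_nonneg_left h1 (by positivity)
  refine (add_le_add_right h3 _).trans_eq ?_
  rw [← sq_mul_rpow_sub_two (by linarith : 0 < p) hr.le]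
  field_simp

/-- The two-point inequality around the midpoint `x + y / 2` supplies the gain, and the tangent
inequality at `x` bounds the midpoint from below. The factor `8` comes from halving `y` and from
replacing the midpoint by `x` inside the maximum. -/
theorem norm_add_rpow_ge_gain {p : ℝ} (hp1 : 1 < p) (hp2 : p < 2) (x y : H) :
    ‖x‖ ^ p + p * ‖x‖ ^ (p - 2) * ⟪x, y⟫ + p * (p - 1) / 16 * gain p ‖x‖ ‖y‖ ≤ ‖x + y‖ ^ p := by
  have h1 := norm_add_rpow_add_norm_sub_rpow_ge hp1 hp2 (x + (1 / 2 : ℝ) • y) ((1 / 2 : ℝ) • y)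
  have e1 : x + (1 / 2 : ℝ) • y + (1 / 2 : ℝ) • y = x + y := by
    rw [add_assoc, ← add_smul]; norm_num
  have e2 : x + (1 / 2 : ℝ) • y - (1 / 2 : ℝ) • y = x := by simp
  have h2 := norm_add_rpow_ge hp1.le x ((1 / 2 : ℝ) • y)
  rw [inner_smul_right] at h2
  rw [e1, e2] at h1
  have hy : ‖(1 / 2 : ℝ) • y‖ = ‖y‖ / 2 := by rw [norm_smul]; norm_num; ring
  have h3 : gain p ‖x‖ ‖y‖ ≤ 8 * gain p ‖x + (1 / 2 : ℝ) • y‖ ‖(1 / 2 : ℝ) • y‖ := by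
    rw [hy]
    rcases eq_or_ne y 0 with rfl | hy0
    · simp [gain]
    have hy0 : 0 < ‖y‖ := norm_pos_iff.2 hy0
    have hm : max ‖x + (1 / 2 : ℝ) • y‖ (‖y‖ / 2) ≤ 2 * max ‖x‖ ‖y‖ := by
      apply max_le
      · refine (norm_add_le _ _).trans ?_
        rw [hy]
        linarith [le_max_left ‖x‖ ‖y‖, le_max_right ‖x‖ ‖y‖]
      · linarith [le_max_right ‖x‖ ‖y‖]
    have hmp : 0 < max ‖x‖ ‖y‖ := hy0.trans_le (le_max_right _ _)
    have h4 : (2 * max ‖x‖ ‖y‖) ^ (p - 2) ≤ max ‖x + (1 / 2 : ℝ) • y‖ (‖y‖ / 2) ^ (p - 2) :=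
      Real.rpow_le_rpow_of_nonpos ((half_pos hy0).trans_le (le_max_right _ _)) hm (by linarith)
    rw [Real.mul_rpow (by norm_num) hmp.le] at h4
    have h5 : (2 : ℝ) ^ (-1 : ℝ) ≤ 2 ^ (p - 2) :=
      Real.rpow_le_rpow_of_exponent_le (by norm_num) (by linarith)
    rw [Real.rpow_neg_one] at h5
    have h6 : 2⁻¹ * max ‖x‖ ‖y‖ ^ (p - 2) ≤ max ‖x + (1 / 2 : ℝ) • y‖ (‖y‖ / 2) ^ (p - 2) :=
      (mul_le_mul_of_nonneg_right h5 (by positivity)).trans h4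
    unfold gain
    nlinarith [sq_nonneg ‖y‖, mul_le_mul_of_nonneg_left h6 (sq_nonneg ‖y‖)]
  have h7 : p * (p - 1) / 16 * gain p ‖x‖ ‖y‖ ≤
      p * (p - 1) / 16 * (8 * gain p ‖x + (1 / 2 : ℝ) • y‖ ‖(1 / 2 : ℝ) • y‖) :=
    mul_le_mul_of_nonneg_left h3 (by nlinarith)
  nlinarith

theorem two_mul_rpow_le_rpow_add {r u v : ℝ} (hr : 1 ≤ r) (hu : 0 ≤ u) (hv : 0 ≤ v) :
    2 * ((u + v) / 2) ^ r ≤ u ^ r + v ^ r := by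
  have h := (convexOn_rpow hr).2 (mem_Ici.2 hu) (mem_Ici.2 hv) (by norm_num : (0 : ℝ) ≤ 1 / 2)
    (by norm_num : (0 : ℝ) ≤ 1 / 2) (by norm_num)
  simp only [smul_eq_mul] at h
  have e : 1 / 2 * u + 1 / 2 * v = (u + v) / 2 := by ring
  rw [e] at h
  linarith

/-- Again a midpoint argument, with the two-point inequality replaced by one of Clarkson type: the
parallelogram law raised to the power `p / 2 ≥ 1`. -/
theorem norm_add_rpow_ge_rpow {p : ℝ} (hp : 2 ≤ p) (x y : H) :
    ‖x‖ ^ p + p * ‖x‖ ^ (p - 2) * ⟪x, y⟫ + 2 * (1 / 2) ^ p * ‖y‖ ^ p ≤ ‖x + y‖ ^ p := by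
  have e : ∀ {t : ℝ}, 0 ≤ t → t ^ p = (t ^ 2) ^ (p / 2) := by
    intro t ht
    rw [← Real.rpow_natCast, ← Real.rpow_mul ht]; congr 1; push_cast; ring
  have h1 : 2 * ‖x + (1 / 2 : ℝ) • y‖ ^ p + 2 * ‖(1 / 2 : ℝ) • y‖ ^ p ≤ ‖x + y‖ ^ p + ‖x‖ ^ p := by
    have hpar := parallelogram_law_with_norm ℝ (x + (1 / 2 : ℝ) • y) ((1 / 2 : ℝ) • y)
    have e1 : x + (1 / 2 : ℝ) • y + (1 / 2 : ℝ) • y = x + y := by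
      rw [add_assoc, ← add_smul]; norm_num
    have e2 : x + (1 / 2 : ℝ) • y - (1 / 2 : ℝ) • y = x := by simp
    rw [e1, e2] at hpar
    have h2 := two_mul_rpow_le_rpow_add (r := p / 2) (by linarith) (sq_nonneg ‖x + y‖)
      (sq_nonneg ‖x‖)
    have h3 := Real.add_rpow_le_rpow_add (sq_nonneg ‖x + (1 / 2 : ℝ) • y‖)
      (sq_nonneg ‖(1 / 2 : ℝ) • y‖) (p := p / 2) (by linarith)
    have e3 : (‖x + y‖ ^ 2 + ‖x‖ ^ 2) / 2 =
      ‖x + (1 / 2 : ℝ) • y‖ ^ 2 + ‖(1 / 2 : ℝ) • y‖ ^ 2 := by nlinarith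
    rw [e3] at h2
    rw [e (norm_nonneg _), e (norm_nonneg ((1 / 2 : ℝ) • y)), e (norm_nonneg (x + y)),
      e (norm_nonneg x)]
    linarith
  have h2 := norm_add_rpow_ge (by linarith : 1 ≤ p) x ((1 / 2 : ℝ) • y)
  rw [inner_smul_right] at h2
  have hy : ‖(1 / 2 : ℝ) • y‖ ^ p = (1 / 2) ^ p * ‖y‖ ^ p := by
    rw [norm_smul, Real.mul_rpow (norm_nonneg _) (norm_nonneg _)]; norm_num
  rw [hy] at h1
  nlinarith

/-- Write `T ^ 2 = ‖x‖ ^ 2 + Λ ^ 2`. For `‖y‖ ≤ T`, concavity of `t ^ (p / 2)` leaves the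
second-order term `‖y‖ ^ 2 * T ^ (p - 2)`, and `T ≥ Λ` compares it with the gain. For `‖y‖ > T`
every term is of order `‖y‖ ^ p`, which is then the gain. The parameter `Λ` keeps the remainder
independent of `x`. -/
theorem sqrt_norm_add_rpow_le_gain {p Λ : ℝ} (hp1 : 1 < p) (hp2 : p < 2) (hΛ : 0 ≤ Λ) (x y : H) :
    (‖x + y‖ ^ 2 + Λ ^ 2) ^ (p / 2) ≤ (‖x‖ ^ 2 + Λ ^ 2) ^ (p / 2)
      + p * (‖x‖ ^ 2 + Λ ^ 2) ^ (p / 2 - 1) * ⟪x, y⟫ + 6 * gain p Λ ‖y‖ := by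
  have e : ∀ {t : ℝ} (r : ℝ), 0 ≤ t → (t ^ 2) ^ (r / 2) = t ^ r := by
    intro t r ht
    rw [← Real.rpow_natCast, ← Real.rpow_mul ht]; congr 1; push_cast; ring
  set T := √(‖x‖ ^ 2 + Λ ^ 2) with hT
  have hT0 : 0 ≤ T := Real.sqrt_nonneg _
  have hTsq : ‖x‖ ^ 2 + Λ ^ 2 = T ^ 2 := (Real.sq_sqrt (by positivity)).symm
  have hTΛ : Λ ≤ T := Real.le_sqrt_of_sq_le (by nlinarith [sq_nonneg ‖x‖])
  have hTx : ‖x‖ ≤ T := Real.le_sqrt_of_sq_le (by nlinarith [sq_nonneg Λ])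
  have hL : ‖x + y‖ ^ 2 + Λ ^ 2 = T ^ 2 + (2 * ⟪x, y⟫ + ‖y‖ ^ 2) := by
    rw [norm_add_sq_real, ← hTsq]; ring
  have hin := abs_le.1 (abs_real_inner_le_norm x y)
  have e2 : (p / 2 - 1) = (p - 2) / 2 := by ring
  rw [hL, hTsq, e2, e _ hT0, e _ hT0]
  have hxy : ‖x‖ * ‖y‖ ≤ T * ‖y‖ := mul_le_mul_of_nonneg_right hTx (norm_nonneg _)
  rcases hT0.eq_or_lt with h0 | hTp
  · have hx0 : ‖x‖ = 0 := le_antisymm (h0 ▸ hTx) (norm_nonneg _)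
    have hx0 : x = 0 := norm_eq_zero.1 hx0
    have hΛ0 : Λ = 0 := le_antisymm (h0 ▸ hTΛ) hΛ
    rw [← h0, hΛ0, gain_of_le (by linarith) (norm_nonneg _) (norm_nonneg _), hx0]
    simp only [inner_zero_left, mul_zero, zero_add, add_zero, ne_eq, OfNat.ofNat_ne_zero,
      not_false_eq_true, zero_pow]
    rw [e _ (norm_nonneg _), Real.zero_rpow (by linarith)]
    have : 0 ≤ ‖y‖ ^ p := by positivity
    linarith
  rcases le_or_gt ‖y‖ T with hy | hy
  · have hs : -1 ≤ (2 * ⟪x, y⟫ + ‖y‖ ^ 2) / T ^ 2 := by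
      rw [le_div_iff₀ (by positivity)]
      have : 0 ≤ ‖x + y‖ ^ 2 + Λ ^ 2 := by positivity
      linarith
    have hb := rpow_one_add_le_one_add_mul_self hs (p := p / 2) (by linarith) (by linarith)
    have e3 : T ^ 2 + (2 * ⟪x, y⟫ + ‖y‖ ^ 2) =
        T ^ 2 * (1 + (2 * ⟪x, y⟫ + ‖y‖ ^ 2) / T ^ 2) := by field_simp
    rw [e3, Real.mul_rpow (by positivity) (by linarith), e _ hT0]
    have h5 : ‖y‖ ^ 2 * T ^ (p - 2) ≤ gain p Λ ‖y‖ := by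
      rw [← gain_of_ge hy]; exact gain_anti hp2.le (norm_nonneg _) hTΛ
    have h6 : 0 ≤ ‖y‖ ^ 2 * T ^ (p - 2) := by positivity
    calc _ ≤ T ^ p * (1 + p / 2 * ((2 * ⟪x, y⟫ + ‖y‖ ^ 2) / T ^ 2)) :=
          mul_le_mul_of_nonneg_left hb (by positivity)
      _ = T ^ p + p * T ^ (p - 2) * ⟪x, y⟫ + p / 2 * (‖y‖ ^ 2 * T ^ (p - 2)) := by
          rw [← sq_mul_rpow_sub_two (by linarith : 0 < p) hT0]; field_simp; ring
      _ ≤ _ := by nlinarith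
  · rw [gain_of_le (by linarith) (norm_nonneg _) (hTΛ.trans hy.le)]
    have h1 : (T ^ 2 + (2 * ⟪x, y⟫ + ‖y‖ ^ 2)) ^ (p / 2) ≤ 4 * ‖y‖ ^ p := by
      calc _ ≤ ((2 * ‖y‖) ^ 2) ^ (p / 2) := by
            apply Real.rpow_le_rpow (by rw [← hL]; positivity) _ (by linarith)
            nlinarith [norm_nonneg y]
        _ = 2 ^ p * ‖y‖ ^ p := by
            rw [e _ (by positivity), Real.mul_rpow (by norm_num) (norm_nonneg _)]
        _ ≤ 4 * ‖y‖ ^ p := by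
            have : (2 : ℝ) ^ p ≤ 2 ^ (2 : ℝ) :=
              Real.rpow_le_rpow_of_exponent_le (by norm_num) hp2.le
            norm_num at this
            gcongr
    have h2 : T ^ (p - 2) * (T * ‖y‖) ≤ ‖y‖ ^ p := by
      have h3 : T ^ (p - 1) = T ^ (p - 2) * T := by
        rw [← Real.rpow_add_one hTp.ne']; congr 1; ring
      have h4 : ‖y‖ ^ p = ‖y‖ ^ (p - 1) * ‖y‖ := by
        rw [← Real.rpow_add_one (hTp.trans hy).ne']; congr 1; ring
      rw [← mul_assoc, ← h3, h4]
      gcongr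
    have h3 : -(T * ‖y‖) ≤ ⟪x, y⟫ := by linarith
    have h4 := mul_le_mul_of_nonneg_left h3 (by positivity : 0 ≤ p * T ^ (p - 2))
    have h5 : 0 ≤ T ^ p := by positivity
    nlinarith [Real.rpow_nonneg (norm_nonneg y) p]

theorem abs_rpow_one_add_sub_one_le {r u : ℝ} (hr : 0 ≤ r) (hu : -1 ≤ u) (hu3 : u ≤ 3) :
    |(1 + u) ^ r - 1| ≤ (1 + r + r * 4 ^ r) * |u| := by
  have h4 : (0 : ℝ) ≤ r * 4 ^ r := by positivity
  rcases le_total 0 u with h | h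
  · have h1 : 1 ≤ (1 + u) ^ r := Real.one_le_rpow (by linarith) hr
    rw [abs_of_nonneg (by linarith), abs_of_nonneg h]
    rcases le_total r 1 with h5 | h5
    · have := rpow_one_add_le_one_add_mul_self hu hr h5
      nlinarith
    · have h6 := one_add_mul_self_le_rpow_one_add (s := 1 / (1 + u) - 1)
        (by linarith [one_div_pos.2 (by linarith : 0 < 1 + u)]) h5
      have e : 1 + (1 / (1 + u) - 1) = 1 / (1 + u) := by ring
      have hp : 0 < (1 + u) ^ r := by positivity
      rw [e, Real.div_rpow (by norm_num) (by linarith), Real.one_rpow, le_div_iff₀ hp] at h6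
      have e2 : 1 / (1 + u) - 1 = - (u / (1 + u)) := by field_simp; ring
      have h7 : (1 + u) ^ r ≤ 4 ^ r := Real.rpow_le_rpow (by linarith) (by linarith) hr
      have h8 : u / (1 + u) ≤ u := div_le_self h (by linarith)
      have h9 : 0 ≤ u / (1 + u) := by positivity
      rw [e2] at h6
      have h10 : r * (u / (1 + u)) * (1 + u) ^ r ≤ r * u * 4 ^ r := by gcongr
      nlinarith
  · have h1 : (1 + u) ^ r ≤ 1 := Real.rpow_le_one (by linarith) (by linarith) hr
    rw [abs_of_nonpos (by linarith), abs_of_nonpos h]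
    have h2 : 1 + (1 + r) * u ≤ (1 + u) ^ r := by
      rcases le_total r 1 with h5 | h5
      · have h6 : (1 + u) ^ (1 : ℝ) ≤ (1 + u) ^ r := by
          rcases (by linarith : 0 ≤ 1 + u).eq_or_lt with h7 | h7
          · rw [← h7, Real.zero_rpow one_ne_zero]; positivity
          · exact Real.rpow_le_rpow_of_exponent_ge h7 (by linarith) h5
        rw [Real.rpow_one] at h6
        nlinarith
      · have := one_add_mul_self_le_rpow_one_add hu h5
        linarith
    nlinarith

/-- Bernoulli's inequality at `1 / (1 + u)` gives `(1 + u) ^ q - 1 ≤ q * (1 + u) ^ (q - 1) * u`;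
replacing `(1 + u) ^ (q - 1)` by `1` costs a multiple of `u ^ 2`. -/
theorem rpow_one_add_le_quadratic {q u : ℝ} (hq : 1 ≤ q) (hu : -1 ≤ u) (hu3 : u ≤ 3) :
    (1 + u) ^ q ≤ 1 + q * u + q * (q + (q - 1) * 4 ^ (q - 1)) * u ^ 2 := by
  have h1 : (1 + u) ^ q ≤ 1 + q * (1 + u) ^ (q - 1) * u := by
    rcases (by linarith : 0 ≤ 1 + u).eq_or_lt with h7 | h7
    · have hu' : u = -1 := by linarith
      rw [← h7, Real.zero_rpow (by linarith : q ≠ 0), hu']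
      rcases hq.eq_or_lt with rfl | h
      · norm_num
      · rw [Real.zero_rpow (by linarith)]; norm_num
    · have h6 := one_add_mul_self_le_rpow_one_add (s := 1 / (1 + u) - 1)
        (by linarith [one_div_pos.2 h7]) hq
      have e : 1 + (1 / (1 + u) - 1) = 1 / (1 + u) := by ring
      have hp : 0 < (1 + u) ^ q := by positivity
      rw [e, Real.div_rpow (by norm_num) (by linarith), Real.one_rpow, le_div_iff₀ hp] at h6
      have e2 : (1 + u) ^ q = (1 + u) ^ (q - 1) * (1 + u) := by
        rw [← Real.rpow_add_one h7.ne']; congr 1; ring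
      have e3 : (1 + q * (1 / (1 + u) - 1)) * (1 + u) ^ q =
          (1 + u) ^ q - q * (1 + u) ^ (q - 1) * u := by
        rw [e2]; field_simp; ring
      rw [e3] at h6
      linarith
  have h2 := abs_rpow_one_add_sub_one_le (r := q - 1) (by linarith) hu hu3
  have h3 : u * ((1 + u) ^ (q - 1) - 1) ≤ (q + (q - 1) * 4 ^ (q - 1)) * u ^ 2 := by
    calc u * ((1 + u) ^ (q - 1) - 1) ≤ |u * ((1 + u) ^ (q - 1) - 1)| := le_abs_self _
      _ = |u| * |(1 + u) ^ (q - 1) - 1| := abs_mul _ _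
      _ ≤ |u| * ((1 + (q - 1) + (q - 1) * 4 ^ (q - 1)) * |u|) := by gcongr
      _ = (q + (q - 1) * 4 ^ (q - 1)) * |u| ^ 2 := by ring
      _ = _ := by rw [sq_abs]
  nlinarith

/-- If `‖y‖ ≤ ‖x‖`, the relative change of `‖x‖ ^ 2` lies in `[-1, 3]` and the quadratic bound with
exponent `p / 2` applies. Otherwise `‖y‖ ^ p` dominates everything. -/
theorem exists_norm_add_rpow_le {p : ℝ} (hp : 2 ≤ p) : ∃ C : ℝ, 0 < C ∧
    ∀ {H : Type uH} [NormedAddCommGroup H] [InnerProductSpace ℝ H] (x y : H),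
    ‖x + y‖ ^ p ≤ ‖x‖ ^ p + p * ‖x‖ ^ (p - 2) * inner ℝ x y
      + C * (‖x‖ ^ (p - 2) * ‖y‖ ^ 2 + ‖y‖ ^ p) := by
  set K := p / 2 * (p / 2 + (p / 2 - 1) * 4 ^ (p / 2 - 1)) with hK
  have hK0 : 0 ≤ K := by
    have : 0 ≤ p / 2 - 1 := by linarith
    positivity
  refine ⟨p / 2 + 9 * K + 2 ^ p + p, by positivity, fun {H} _ _ x y => ?_⟩
  have e : ∀ {t : ℝ}, 0 ≤ t → t ^ p = (t ^ 2) ^ (p / 2) := by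
    intro t ht
    rw [← Real.rpow_natCast, ← Real.rpow_mul ht]; congr 1; push_cast; ring
  have hin := abs_le.1 (abs_real_inner_le_norm x y)
  have h2p : (0 : ℝ) < 2 ^ p := by positivity
  have hxy0 : 0 ≤ ‖x‖ ^ (p - 2) * ‖y‖ ^ 2 := by positivity
  have hyp : 0 ≤ ‖y‖ ^ p := by positivity
  have hxp : 0 ≤ ‖x‖ ^ p := by positivity
  rcases lt_or_ge ‖x‖ ‖y‖ with h | h
  · have h1 : ‖x + y‖ ^ p ≤ 2 ^ p * ‖y‖ ^ p := by
      rw [← Real.mul_rpow (by norm_num) (norm_nonneg _)]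
      exact Real.rpow_le_rpow (norm_nonneg _) ((norm_add_le _ _).trans (by linarith)) (by linarith)
    have h2 : ‖x‖ ^ (p - 2) * (‖x‖ * ‖y‖) ≤ ‖y‖ ^ p := by
      have hy := (norm_nonneg x).trans h.le
      rw [← sq_mul_rpow_sub_two (by linarith : 0 < p) hy, mul_comm]
      have : ‖x‖ ^ (p - 2) ≤ ‖y‖ ^ (p - 2) := Real.rpow_le_rpow (norm_nonneg _) h.le (by linarith)
      have h3 : ‖x‖ * ‖y‖ ≤ ‖y‖ ^ 2 := by nlinarith
      exact mul_le_mul h3 this (by positivity) (by positivity)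
    have h4 := mul_le_mul_of_nonneg_left hin.1 (by positivity : 0 ≤ p * ‖x‖ ^ (p - 2))
    nlinarith [mul_nonneg hK0 hyp, mul_nonneg hK0 hxy0, mul_nonneg h2p.le hxy0,
      mul_nonneg (by linarith : 0 ≤ p) hxy0, mul_nonneg (by linarith : 0 ≤ p) hyp]
  · rcases eq_or_ne x 0 with rfl | hx
    · have : y = 0 := by simpa using h
      subst this
      simp [Real.zero_rpow (by linarith : p ≠ 0)]
    have hr : 0 < ‖x‖ := norm_pos_iff.2 hx
    set u := (2 * inner ℝ x y + ‖y‖ ^ 2) / ‖x‖ ^ 2 with hu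
    have hyx : ‖y‖ ^ 2 ≤ ‖x‖ * ‖y‖ := by nlinarith [norm_nonneg y]
    have hL : ‖x + y‖ ^ 2 = ‖x‖ ^ 2 * (1 + u) := by
      rw [norm_add_sq_real, hu]; field_simp; ring
    have hu1 : -1 ≤ u := by
      rw [hu, le_div_iff₀ (by positivity)]
      have := sq_nonneg ‖x + y‖
      rw [norm_add_sq_real] at this
      linarith
    have hx2 : ‖x‖ * ‖y‖ ≤ ‖x‖ ^ 2 := by nlinarith [norm_nonneg y]
    have hu3 : u ≤ 3 := by
      rw [hu, div_le_iff₀ (by positivity)]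
      linarith
    have husq : u ^ 2 ≤ 9 * (‖y‖ ^ 2 / ‖x‖ ^ 2) := by
      have : |2 * inner ℝ x y + ‖y‖ ^ 2| ≤ 3 * (‖x‖ * ‖y‖) := by
        rw [abs_le]; constructor
        · nlinarith [sq_nonneg ‖y‖]
        · linarith
      have h5 : (2 * inner ℝ x y + ‖y‖ ^ 2) ^ 2 ≤ (3 * (‖x‖ * ‖y‖)) ^ 2 := sq_le_sq' 
        (abs_le.1 this).1 (abs_le.1 this).2
      rw [hu, div_pow, div_le_iff₀ (by positivity)]
      refine h5.trans_eq ?_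
      field_simp
      ring
    have hq := rpow_one_add_le_quadratic (q := p / 2) (by linarith) hu1 hu3
    rw [← hK] at hq
    have hx1 : ‖x‖ ^ p = ‖x‖ ^ 2 * ‖x‖ ^ (p - 2) :=
      (sq_mul_rpow_sub_two (by linarith) hr.le).symm
    rw [e (norm_nonneg (x + y)), hL, Real.mul_rpow (by positivity) (by linarith), ← e hr.le]
    calc ‖x‖ ^ p * (1 + u) ^ (p / 2)
        ≤ ‖x‖ ^ p * (1 + p / 2 * u + K * (9 * (‖y‖ ^ 2 / ‖x‖ ^ 2))) := by
          refine mul_le_mul_of_nonneg_left (hq.trans ?_) hxp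
          gcongr
      _ = ‖x‖ ^ p + p * ‖x‖ ^ (p - 2) * inner ℝ x y
          + (p / 2 + 9 * K) * (‖x‖ ^ (p - 2) * ‖y‖ ^ 2) := by
          rw [hx1, hu]; field_simp; ring
      _ ≤ _ := by
          nlinarith [mul_nonneg hK0 hyp, mul_nonneg h2p.le hxy0, mul_nonneg h2p.le hyp,
            mul_nonneg (by linarith : 0 ≤ p) hxy0, mul_nonneg (by linarith : 0 ≤ p) hyp]

end Inequalities

/-! ### The compensated Poisson law -/

section CompensatedPoisson

/-- The law of `K - c` where `K` is Poisson distributed with parameter `c`. -/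
noncomputable def compPoisson (c : ℝ≥0) : Measure ℝ :=
  (poissonMeasure c).map (fun n : ℕ => (n : ℝ) - c)

instance (c : ℝ≥0) : IsProbabilityMeasure (compPoisson c) :=
  Measure.isProbabilityMeasure_map .of_discrete

/-- The Poisson weights. -/
noncomputable def poissonWeight (c : ℝ≥0) (n : ℕ) : ℝ := Real.exp (-c) * c ^ n / n.factorial

theorem poissonWeight_nonneg (c : ℝ≥0) (n : ℕ) : 0 ≤ poissonWeight c n := by
  unfold poissonWeight; positivity

/-- Multiplication by `n` acts on the weights as an index shift, so the mean and the second
factorial moment reduce to the total mass. -/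
theorem succ_mul_poissonWeight (c : ℝ≥0) (n : ℕ) :
    ((n + 1 : ℕ) : ℝ) * poissonWeight c (n + 1) = c * poissonWeight c n := by
  unfold poissonWeight
  rw [Nat.factorial_succ]
  push_cast
  field_simp
  ring

theorem hasSum_mul_poissonWeight (c : ℝ≥0) : HasSum (fun n : ℕ => (n : ℝ) * poissonWeight c n) c := by
  rw [← hasSum_nat_add_iff' 1]
  simp only [succ_mul_poissonWeight]
  simpa [poissonWeight] using (hasSum_one_poissonMeasure c).mul_left (c : ℝ)

theorem hasSum_mul_sub_mul_poissonWeight (c : ℝ≥0) :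
    HasSum (fun n : ℕ => ((n : ℝ) - 1) * (n * poissonWeight c n)) (c * c) := by
  rw [← hasSum_nat_add_iff' 1]
  simp only [succ_mul_poissonWeight]
  have e : (fun n : ℕ => (((n + 1 : ℕ) : ℝ) - 1) * (c * poissonWeight c n)) =
      fun n : ℕ => c * (n * poissonWeight c n) := by
    funext n; push_cast; ring
  rw [e]
  simpa using (hasSum_mul_poissonWeight c).mul_left (c : ℝ)

theorem hasSum_sub_mul_poissonWeight (c : ℝ≥0) :
    HasSum (fun n : ℕ => poissonWeight c n * ((n : ℝ) - c)) 0 := by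
  have := (hasSum_mul_poissonWeight c).sub ((hasSum_one_poissonMeasure c).mul_left (c : ℝ))
  rw [mul_one, sub_self] at this
  have e : (fun n : ℕ => poissonWeight c n * ((n : ℝ) - c)) = fun n : ℕ =>
      n * poissonWeight c n - c * (Real.exp (-c) * c ^ n / n.factorial) := by
    funext n; simp only [poissonWeight]; ring
  rwa [e]

theorem hasSum_sq_mul_poissonWeight (c : ℝ≥0) :
    HasSum (fun n : ℕ => poissonWeight c n * ((n : ℝ) - c) ^ 2) c := by
  have := ((hasSum_mul_sub_mul_poissonWeight c).add
    ((hasSum_mul_poissonWeight c).mul_left (1 - 2 * (c : ℝ)))).add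
    ((hasSum_one_poissonMeasure c).mul_left ((c : ℝ) ^ 2))
  convert this using 1
  · ext n; simp only [poissonWeight]; ring
  · ring

theorem lintegral_compPoisson (c : ℝ≥0) {f : ℝ → ℝ≥0∞} (hf : Measurable f) :
    ∫⁻ z, f z ∂compPoisson c = ∑' n : ℕ, ENNReal.ofReal (poissonWeight c n) * f (n - c) := by
  rw [compPoisson, lintegral_map hf .of_discrete, lintegral_countable']
  refine tsum_congr fun n => ?_
  rw [poissonMeasure_singleton, mul_comm, poissonWeight]

theorem lintegral_sq_compPoisson (c : ℝ≥0) :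
    ∫⁻ z, ENNReal.ofReal (z ^ 2) ∂compPoisson c = c := by
  rw [lintegral_compPoisson c (by fun_prop)]
  simp_rw [← ENNReal.ofReal_mul (poissonWeight_nonneg c _)]
  rw [← ENNReal.ofReal_tsum_of_nonneg, (hasSum_sq_mul_poissonWeight c).tsum_eq]
  · simp
  · exact fun n => mul_nonneg (poissonWeight_nonneg c n) (sq_nonneg _)
  · exact (hasSum_sq_mul_poissonWeight c).summable

theorem integrable_id_compPoisson (c : ℝ≥0) : Integrable (fun z : ℝ => z) (compPoisson c) := by
  have h : MemLp (fun z : ℝ => z) 2 (compPoisson c) := by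
    refine ⟨by fun_prop, ?_⟩
    rw [eLpNorm_lt_top_iff_lintegral_rpow_enorm_lt_top (by norm_num) (by norm_num)]
    have e : ∀ z : ℝ, ‖z‖ₑ ^ (2 : ℝ≥0∞).toReal = ENNReal.ofReal (z ^ 2) := by
      intro z
      rw [← ofReal_norm, ENNReal.ofReal_rpow_of_nonneg (norm_nonneg _) (by norm_num)]
      norm_num
    simp_rw [e, lintegral_sq_compPoisson]
    simp
  exact h.integrable (by norm_num)

theorem integral_id_compPoisson (c : ℝ≥0) : ∫ z, z ∂compPoisson c = 0 := by
  have hi := integrable_id_compPoisson c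
  rw [compPoisson, integral_map .of_discrete (by fun_prop)]
  rw [compPoisson, integrable_map_measure (by fun_prop) .of_discrete] at hi
  exact (hasSum_integral_poissonMeasure hi).unique (hasSum_sub_mul_poissonWeight c)

/-- The point is linearity in `c`, so that the bounds add up over cells. For `n ≥ 1` the weight is
at most `c / n!`; for `n = 0` the contribution is at most `c ^ p ≤ c`. -/
theorem exists_lintegral_rpow_compPoisson_le (p : ℝ) (hp : 1 ≤ p) : ∃ C : ℝ, 0 < C ∧
    ∀ c : ℝ≥0, c ≤ 1 → ∫⁻ z, ENNReal.ofReal (|z| ^ p) ∂compPoisson c ≤ ENNReal.ofReal (C * c) := by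
  have hs : Summable (fun n : ℕ => (n : ℝ) ^ p / n.factorial) := by
    obtain ⟨k, hk⟩ := exists_nat_ge p
    have h2 : Summable (fun n : ℕ => (n : ℝ) ^ k / n.factorial) := by
      refine Summable.of_nonneg_of_le (fun n => by positivity) (fun n => ?_)
        ((Real.summable_pow_div_factorial (Real.exp 1)).mul_left (k.factorial : ℝ))
      have := Real.pow_div_factorial_le_exp (n : ℝ) n.cast_nonneg k
      rw [div_le_iff₀ (by positivity), mul_comm] at this
      rw [← mul_div_assoc, ← Real.exp_nat_mul, mul_one]
      gcongr
    refine Summable.of_nonneg_of_le (fun n => by positivity) (fun n => ?_) h2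
    rcases Nat.eq_zero_or_pos n with rfl | hn
    · simp [Real.zero_rpow (by linarith : p ≠ 0)]
    · gcongr
      rw [← Real.rpow_natCast]
      exact Real.rpow_le_rpow_of_exponent_le (by exact_mod_cast hn) hk
  refine ⟨1 + ∑' n : ℕ, (n : ℝ) ^ p / n.factorial, by positivity, fun c hc => ?_⟩
  have hc' : (c : ℝ) ≤ 1 := by exact_mod_cast hc
  rw [lintegral_compPoisson c (by fun_prop)]
  have hb : ∀ n : ℕ, ENNReal.ofReal (poissonWeight c n) * ENNReal.ofReal (|(n : ℝ) - c| ^ p) ≤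
      ENNReal.ofReal (c * ((if n = 0 then 1 else 0) + (n : ℝ) ^ p / n.factorial)) := by
    intro n
    rw [← ENNReal.ofReal_mul (poissonWeight_nonneg c _)]
    apply ENNReal.ofReal_le_ofReal
    have he : Real.exp (-c) ≤ 1 := Real.exp_le_one_iff.2 (by simp)
    rcases Nat.eq_zero_or_pos n with rfl | hn
    · have h1 : (c : ℝ) ^ p ≤ c := by
        rcases eq_or_ne c 0 with rfl | h0
        · simp [Real.zero_rpow (by linarith : p ≠ 0)]
        · have := Real.rpow_le_rpow_of_exponent_ge (by positivity : (0 : ℝ) < c) hc' hp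
          simpa using this
      have h2 : 0 ≤ (c : ℝ) ^ p := by positivity
      simp [poissonWeight, Real.zero_rpow (by linarith : p ≠ 0)]
      calc _ ≤ 1 * (c : ℝ) ^ p := by gcongr
        _ ≤ c := by linarith
    · have hn1 : (1 : ℝ) ≤ n := by exact_mod_cast hn
      have h1 : |(n : ℝ) - c| ≤ n := by
        rw [abs_of_nonneg (by linarith)]; linarith [c.2]
      have h2 : (c : ℝ) ^ n ≤ c := by
        have := pow_le_pow_of_le_one c.2 hc' hn
        simpa using this
      rw [if_neg hn.ne', zero_add]
      calc poissonWeight c n * |(n : ℝ) - c| ^ p ≤ (1 * c / n.factorial) * (n : ℝ) ^ p := by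
            unfold poissonWeight; gcongr
        _ = _ := by ring
  refine (ENNReal.tsum_le_tsum hb).trans ?_
  have hs' : Summable (fun n : ℕ => (if n = 0 then (1 : ℝ) else 0)) :=
    (hasSum_ite_eq 0 (1 : ℝ)).summable
  rw [← ENNReal.ofReal_tsum_of_nonneg, tsum_mul_left, (hs'.tsum_add hs), tsum_ite_eq, mul_comm]
  · intro n; split_ifs <;> positivity
  · exact (hs'.add hs).mul_left _

/-- Only the event of exactly one jump is kept. Its probability `c * exp (-c)` is at least `c / 2`,
and the compensated value is then `1 - c`. -/
theorem mul_le_lintegral_compPoisson {c : ℝ≥0} (hc : (c : ℝ) ≤ 1 / 2) {f : ℝ → ℝ≥0∞}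
    (hf : Measurable f) : ENNReal.ofReal (c / 2) * f (1 - c) ≤ ∫⁻ z, f z ∂compPoisson c := by
  rw [lintegral_compPoisson c hf]
  refine le_trans ?_ (ENNReal.le_tsum 1)
  push_cast
  gcongr
  have := Real.add_one_le_exp (-(c : ℝ))
  simp only [poissonWeight, pow_one, Nat.factorial_one, Nat.cast_one, div_one]
  nlinarith [c.2]

/-- The linear term has mean zero. When the remainder `e` is not integrable the bound is trivial, so
no integrability has to be assumed of it. -/
theorem lintegral_le_of_le_affine {π : Measure ℝ} [IsProbabilityMeasure π]
    (hi : Integrable (fun z : ℝ => z) π) (h0 : ∫ z, z ∂π = 0) {f e : ℝ → ℝ} {a b : ℝ}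
    (hf0 : ∀ z, 0 ≤ f z) (he : Measurable e) (he0 : ∀ z, 0 ≤ e z) (ha : 0 ≤ a)
    (h : ∀ z, f z ≤ a + b * z + e z) :
    ∫⁻ z, ENNReal.ofReal (f z) ∂π ≤ ENNReal.ofReal a + ∫⁻ z, ENNReal.ofReal (e z) ∂π := by
  by_cases ht : ∫⁻ z, ENNReal.ofReal (e z) ∂π = ∞
  · rw [ht]; simp
  have hei : Integrable e π := by
    refine ⟨he.aestronglyMeasurable, ?_⟩
    rw [hasFiniteIntegral_iff_ofReal (ae_of_all _ he0)]
    exact lt_top_iff_ne_top.2 ht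
  have hg : Integrable (fun z => a + b * z + e z) π := ((integrable_const a).add
    (hi.const_mul b)).add hei
  refine (lintegral_mono (fun z => ENNReal.ofReal_le_ofReal (h z))).trans ?_
  rw [← ofReal_integral_eq_lintegral_ofReal hg (ae_of_all _ fun z => (hf0 z).trans (h z)),
    ← ofReal_integral_eq_lintegral_ofReal hei (ae_of_all _ he0),
    ← ENNReal.ofReal_add ha (integral_nonneg he0)]
  have h1 : ∫ z, (a + b * z + e z) ∂π = ∫ z, (a + b * z) ∂π + ∫ z, e z ∂π :=
    integral_add ((integrable_const a).add (hi.const_mul b)) hei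
  rw [h1, integral_add (integrable_const a) (hi.const_mul b), integral_const_mul, h0]
  simp

theorem le_lintegral_of_affine_le {π : Measure ℝ} [IsProbabilityMeasure π]
    (hi : Integrable (fun z : ℝ => z) π) (h0 : ∫ z, z ∂π = 0) {f e : ℝ → ℝ} {a b : ℝ}
    (hf : Measurable f) (hf0 : ∀ z, 0 ≤ f z) (he : Measurable e) (he0 : ∀ z, 0 ≤ e z)
    (ha : 0 ≤ a) (h : ∀ z, a + b * z + e z ≤ f z) :
    ENNReal.ofReal a + ∫⁻ z, ENNReal.ofReal (e z) ∂π ≤ ∫⁻ z, ENNReal.ofReal (f z) ∂π := by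
  by_cases ht : ∫⁻ z, ENNReal.ofReal (f z) ∂π = ∞
  · rw [ht]; simp
  have hfi : Integrable f π := by
    refine ⟨hf.aestronglyMeasurable, ?_⟩
    rw [hasFiniteIntegral_iff_ofReal (ae_of_all _ hf0)]
    exact lt_top_iff_ne_top.2 ht
  have hei : Integrable e π := by
    refine ((hfi.sub (integrable_const a)).sub (hi.const_mul b)).mono' he.aestronglyMeasurable
      (ae_of_all _ fun z => ?_)
    rw [Real.norm_of_nonneg (he0 z)]
    simp only [Pi.sub_apply]
    linarith [h z]
  have hg : Integrable (fun z => a + b * z + e z) π := ((integrable_const a).add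
    (hi.const_mul b)).add hei
  rw [← ofReal_integral_eq_lintegral_ofReal hfi (ae_of_all _ hf0),
    ← ofReal_integral_eq_lintegral_ofReal hei (ae_of_all _ he0),
    ← ENNReal.ofReal_add ha (integral_nonneg he0)]
  apply ENNReal.ofReal_le_ofReal
  refine le_trans (le_of_eq ?_) (integral_mono hg hfi h)
  have h1 : ∫ z, (a + b * z + e z) ∂π = ∫ z, (a + b * z) ∂π + ∫ z, e z ∂π :=
    integral_add ((integrable_const a).add (hi.const_mul b)) hei
  rw [h1, integral_add (integrable_const a) (hi.const_mul b), integral_const_mul, h0]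
  simp

end CompensatedPoisson

/-! ### One-step inequalities -/

section OneStep

variable {H : Type*} [NormedAddCommGroup H] [InnerProductSpace ℝ H]

/-- One step of the submartingale property of `‖M‖ ^ p`; Doob's inequality uses it with exponent
`1`. -/
theorem rpow_norm_le_lintegral {p : ℝ} (hp : 1 ≤ p) (c : ℝ≥0) (x ξ : H) :
    ENNReal.ofReal (‖x‖ ^ p) ≤ ∫⁻ z, ENNReal.ofReal (‖x + z • ξ‖ ^ p) ∂compPoisson c := by
  have := le_lintegral_of_affine_le (integrable_id_compPoisson c) (integral_id_compPoisson c)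
    (f := fun z => ‖x + z • ξ‖ ^ p) (e := fun _ => 0) (a := ‖x‖ ^ p)
    (b := p * ‖x‖ ^ (p - 2) * inner ℝ x ξ)
    (Continuous.measurable (by fun_prop (disch := linarith)))
    (fun z => by positivity) measurable_const (fun _ => le_rfl) (by positivity) (fun z => ?_)
  · simpa using this
  · have := norm_add_rpow_ge hp x (z • ξ)
    rw [inner_smul_right] at this
    linarith

theorem sq_norm_add_le_lintegral (c : ℝ≥0) (x ξ : H) :
    ENNReal.ofReal (‖x‖ ^ 2) + ENNReal.ofReal (c * ‖ξ‖ ^ 2) ≤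
      ∫⁻ z, ENNReal.ofReal (‖x + z • ξ‖ ^ 2) ∂compPoisson c := by
  have := le_lintegral_of_affine_le (integrable_id_compPoisson c) (integral_id_compPoisson c)
    (f := fun z => ‖x + z • ξ‖ ^ 2) (e := fun z => z ^ 2 * ‖ξ‖ ^ 2) (a := ‖x‖ ^ 2)
    (b := 2 * inner ℝ x ξ) (Continuous.measurable (by fun_prop))
    (fun z => by positivity) (by fun_prop) (fun _ => by positivity) (by positivity) (fun z => ?_)
  · refine le_trans (le_of_eq ?_) this
    simp_rw [ENNReal.ofReal_mul (sq_nonneg _)]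
    rw [lintegral_mul_const _ (by fun_prop), lintegral_sq_compPoisson, ENNReal.ofReal_mul c.coe_nonneg]
    simp
  · rw [norm_add_sq_real, inner_smul_right, norm_smul, mul_pow, Real.norm_eq_abs, sq_abs]
    linarith

/-- Since `c ≤ 1 / 2`, a single compensated jump `1 - c` is at least `1 / 2`; this produces the
second factor `(1 / 2) ^ p`. -/
theorem rpow_norm_add_le_lintegral {p : ℝ} (hp : 2 ≤ p) {c : ℝ≥0} (hc : (c : ℝ) ≤ 1 / 2)
    (x ξ : H) :
    ENNReal.ofReal (‖x‖ ^ p) + ENNReal.ofReal ((1 / 2) ^ p * (1 / 2) ^ p) *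
      ENNReal.ofReal (c * ‖ξ‖ ^ p) ≤
      ∫⁻ z, ENNReal.ofReal (‖x + z • ξ‖ ^ p) ∂compPoisson c := by
  have hm : Measurable (fun z : ℝ => 2 * (1 / 2) ^ p * ‖z • ξ‖ ^ p) :=
    Continuous.measurable (by fun_prop (disch := linarith))
  have := le_lintegral_of_affine_le (integrable_id_compPoisson c) (integral_id_compPoisson c)
    (f := fun z => ‖x + z • ξ‖ ^ p) (e := fun z => 2 * (1 / 2) ^ p * ‖z • ξ‖ ^ p) (a := ‖x‖ ^ p)
    (b := p * ‖x‖ ^ (p - 2) * inner ℝ x ξ)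
    (Continuous.measurable (by fun_prop (disch := linarith)))
    (fun z => by positivity) hm (fun _ => by positivity) (by positivity) (fun z => ?_)
  · refine le_trans (add_le_add_right ?_ _) this
    refine le_trans ?_ (mul_le_lintegral_compPoisson hc hm.ennreal_ofReal)
    rw [← ENNReal.ofReal_mul (by positivity), ← ENNReal.ofReal_mul (by positivity)]
    apply ENNReal.ofReal_le_ofReal
    rw [norm_smul, Real.norm_of_nonneg (by linarith),
      Real.mul_rpow (by linarith) (norm_nonneg _)]
    have h1 : (1 / 2 : ℝ) ^ p ≤ (1 - c) ^ p :=
      Real.rpow_le_rpow (by norm_num) (by linarith) (by linarith)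
    have h2 : 0 ≤ (1 / 2 : ℝ) ^ p * (c * ‖ξ‖ ^ p) := by positivity
    nlinarith [mul_le_mul_of_nonneg_left h1 h2]
  · have := norm_add_rpow_ge_rpow hp x (z • ξ)
    rw [inner_smul_right] at this
    linarith

theorem measurable_gain {p R : ℝ} {α : Type*} [MeasurableSpace α] {f : α → ℝ} (hf : Measurable f) :
    Measurable (fun a => gain p R (f a)) := by
  unfold gain; fun_prop

theorem rpow_norm_add_gain_le_lintegral {p : ℝ} (hp1 : 1 < p) (hp2 : p < 2) {c : ℝ≥0}
    (hc : (c : ℝ) ≤ 1 / 2) (x ξ : H) :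
    ENNReal.ofReal (‖x‖ ^ p) + ENNReal.ofReal (p * (p - 1) / 128) *
      ENNReal.ofReal (c * gain p ‖x‖ ‖ξ‖) ≤
      ∫⁻ z, ENNReal.ofReal (‖x + z • ξ‖ ^ p) ∂compPoisson c := by
  have hk : 0 ≤ p * (p - 1) := by nlinarith
  have hm : Measurable (fun z : ℝ => p * (p - 1) / 16 * gain p ‖x‖ ‖z • ξ‖) :=
    (measurable_gain (Continuous.measurable (by fun_prop))).const_mul _
  have := le_lintegral_of_affine_le (integrable_id_compPoisson c) (integral_id_compPoisson c)
    (f := fun z => ‖x + z • ξ‖ ^ p) (e := fun z => p * (p - 1) / 16 * gain p ‖x‖ ‖z • ξ‖)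
    (a := ‖x‖ ^ p) (b := p * ‖x‖ ^ (p - 2) * inner ℝ x ξ)
    (Continuous.measurable (by fun_prop (disch := linarith)))
    (fun z => by positivity) hm
    (fun _ => mul_nonneg (by linarith) (gain_nonneg (norm_nonneg _))) (by positivity)
    (fun z => ?_)
  · refine le_trans (add_le_add_right ?_ _) this
    refine le_trans ?_ (mul_le_lintegral_compPoisson hc hm.ennreal_ofReal)
    rw [← ENNReal.ofReal_mul (by linarith), ← ENNReal.ofReal_mul (by positivity)]
    apply ENNReal.ofReal_le_ofReal
    rw [norm_smul, Real.norm_of_nonneg (by linarith)]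
    have h1 : gain p ‖x‖ ‖ξ‖ ≤ 4 * gain p ‖x‖ ((1 - c) * ‖ξ‖) := by
      refine le_trans (gain_mono (by linarith) (norm_nonneg _) (norm_nonneg _) ?_)
        (gain_two_mul hp2.le (mul_nonneg (by linarith) (norm_nonneg _)))
      nlinarith [norm_nonneg ξ]
    have h2 : 0 ≤ p * (p - 1) * c := mul_nonneg hk c.2
    nlinarith [mul_le_mul_of_nonneg_left h1 h2]
  · have := norm_add_rpow_ge_gain hp1 hp2 x (z • ξ)
    rw [inner_smul_right] at this
    linarith

theorem exists_lintegral_rpow_norm_add_le {p : ℝ} (hp : 2 ≤ p) : ∃ C : ℝ≥0, 0 < C ∧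
    ∀ {H : Type uH} [NormedAddCommGroup H] [InnerProductSpace ℝ H] (c : ℝ≥0) (_ : (c : ℝ) ≤ 1 / 2)
      (x ξ : H), ∫⁻ z, ENNReal.ofReal (‖x + z • ξ‖ ^ p) ∂compPoisson c ≤
        ENNReal.ofReal (‖x‖ ^ p) +
          C * ENNReal.ofReal (‖x‖ ^ (p - 2) * (c * ‖ξ‖ ^ 2) + c * ‖ξ‖ ^ p) := by
  obtain ⟨C₁, hC₁, h₁⟩ := exists_norm_add_rpow_le.{uH} hp
  obtain ⟨C₂, hC₂, h₂⟩ := exists_lintegral_rpow_compPoisson_le p (by linarith)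
  refine ⟨(C₁ * (1 + C₂)).toNNReal, Real.toNNReal_pos.2 (by positivity),
    fun {H} _ _ c hc x ξ => ?_⟩
  have hm : Measurable (fun z : ℝ => |z| ^ p) := by fun_prop
  have := lintegral_le_of_le_affine (integrable_id_compPoisson c) (integral_id_compPoisson c)
    (f := fun z => ‖x + z • ξ‖ ^ p)
    (e := fun z => C₁ * ‖x‖ ^ (p - 2) * ‖ξ‖ ^ 2 * z ^ 2 + C₁ * ‖ξ‖ ^ p * |z| ^ p) (a := ‖x‖ ^ p)
    (b := p * ‖x‖ ^ (p - 2) * inner ℝ x ξ)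
    (fun z => by positivity) (by fun_prop) (fun _ => by positivity) (by positivity) (fun z => ?_)
  · refine this.trans (add_le_add_right ?_ _)
    simp_rw [fun z : ℝ => ENNReal.ofReal_add
      (by positivity : 0 ≤ C₁ * ‖x‖ ^ (p - 2) * ‖ξ‖ ^ 2 * z ^ 2)
      (by positivity : 0 ≤ C₁ * ‖ξ‖ ^ p * |z| ^ p)]
    rw [lintegral_add_left (by fun_prop)]
    simp_rw [fun z : ℝ => ENNReal.ofReal_mul (q := z ^ 2)
      (by positivity : 0 ≤ C₁ * ‖x‖ ^ (p - 2) * ‖ξ‖ ^ 2), fun z : ℝ =>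
      ENNReal.ofReal_mul (q := |z| ^ p) (by positivity : 0 ≤ C₁ * ‖ξ‖ ^ p)]
    rw [lintegral_const_mul _ (by fun_prop), lintegral_const_mul _ (by fun_prop),
      lintegral_sq_compPoisson]
    have hc1 : c ≤ 1 := by
      rw [← NNReal.coe_le_coe]; exact hc.trans (by norm_num)
    refine (add_le_add_right (mul_le_mul_right (h₂ c hc1) _) _).trans ?_
    change _ ≤ ENNReal.ofReal (C₁ * (1 + C₂)) * _
    rw [← ENNReal.ofReal_coe_nnreal (p := c), ← ENNReal.ofReal_mul (by positivity),
      ← ENNReal.ofReal_mul (by positivity), ← ENNReal.ofReal_mul (by positivity),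
      ← ENNReal.ofReal_add (by positivity) (by positivity)]
    apply ENNReal.ofReal_le_ofReal
    have t1 : 0 ≤ C₁ * (‖x‖ ^ (p - 2) * (c * ‖ξ‖ ^ 2)) * C₂ := by positivity
    have t2 : 0 ≤ C₁ * (c * ‖ξ‖ ^ p) := by positivity
    nlinarith
  · have := h₁ x (z • ξ)
    rw [inner_smul_right, norm_smul, Real.mul_rpow (norm_nonneg _) (norm_nonneg _), mul_pow,
      Real.norm_eq_abs, sq_abs] at this
    refine this.trans (le_of_eq ?_)
    ring

theorem exists_lintegral_sqrt_norm_add_le {p : ℝ} (hp1 : 1 < p) (hp2 : p < 2) : ∃ C : ℝ≥0,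
    ∀ {H : Type uH} [NormedAddCommGroup H] [InnerProductSpace ℝ H] (c : ℝ≥0) (_ : (c : ℝ) ≤ 1 / 2)
      (Λ : ℝ) (_ : 0 ≤ Λ) (x ξ : H),
      ∫⁻ z, ENNReal.ofReal ((‖x + z • ξ‖ ^ 2 + Λ ^ 2) ^ (p / 2)) ∂compPoisson c ≤
        ENNReal.ofReal ((‖x‖ ^ 2 + Λ ^ 2) ^ (p / 2)) + C * ENNReal.ofReal (c * gain p Λ ‖ξ‖) := by
  obtain ⟨C₂, hC₂, h₂⟩ := exists_lintegral_rpow_compPoisson_le p (by linarith)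
  refine ⟨(6 * (1 + C₂)).toNNReal, fun {H} _ _ c hc Λ hΛ x ξ => ?_⟩
  have hm : Measurable (fun z : ℝ => |z| ^ p) := by fun_prop
  have hg : 0 ≤ gain p Λ ‖ξ‖ := gain_nonneg (norm_nonneg _)
  -- According to whether `‖ξ‖` is above or below `Λ`, the gain of `z • ξ` is at most `|z| ^ p` or
  -- `z ^ 2` times the gain of `ξ`. Both moments are of order `c`.
  have hgz : ∀ z : ℝ, gain p Λ ‖z • ξ‖ ≤ gain p Λ ‖ξ‖ * z ^ 2 + gain p Λ ‖ξ‖ * |z| ^ p := by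
    intro z
    have hz : 0 ≤ |z| ^ p := by positivity
    have e1 : ‖z • ξ‖ = |z| * ‖ξ‖ := by rw [norm_smul, Real.norm_eq_abs]
    rcases le_or_gt Λ ‖ξ‖ with h | h
    · have h1 := gain_le_rpow (p := p) (R := Λ) (by linarith) hp2.le (norm_nonneg (z • ξ))
      rw [gain_of_le (by linarith) (norm_nonneg _) h]
      rw [e1, Real.mul_rpow (abs_nonneg _) (norm_nonneg _)] at h1
      rw [e1]
      have : 0 ≤ ‖ξ‖ ^ p * z ^ 2 := by positivity
      linarith
    · have hΛp : 0 < Λ := (norm_nonneg _).trans_lt h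
      have h1 := gain_le_sq (p := p) (x := ‖z • ξ‖) hp2.le hΛp
      rw [gain_of_ge h.le]
      have e2 : ‖z • ξ‖ ^ 2 * Λ ^ (p - 2) = ‖ξ‖ ^ 2 * Λ ^ (p - 2) * z ^ 2 := by
        rw [e1, mul_pow, sq_abs]; ring
      rw [e2] at h1
      have : 0 ≤ ‖ξ‖ ^ 2 * Λ ^ (p - 2) * |z| ^ p := by positivity
      linarith
  have := lintegral_le_of_le_affine (integrable_id_compPoisson c) (integral_id_compPoisson c)
    (f := fun z => (‖x + z • ξ‖ ^ 2 + Λ ^ 2) ^ (p / 2))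
    (e := fun z => 6 * gain p Λ ‖ξ‖ * z ^ 2 + 6 * gain p Λ ‖ξ‖ * |z| ^ p)
    (a := (‖x‖ ^ 2 + Λ ^ 2) ^ (p / 2))
    (b := p * (‖x‖ ^ 2 + Λ ^ 2) ^ (p / 2 - 1) * inner ℝ x ξ)
    (fun z => by positivity) (by fun_prop) (fun _ => by positivity) (by positivity) (fun z => ?_)
  · refine this.trans (add_le_add_right ?_ _)
    simp_rw [fun z : ℝ => ENNReal.ofReal_add
      (by positivity : 0 ≤ 6 * gain p Λ ‖ξ‖ * z ^ 2)
      (by positivity : 0 ≤ 6 * gain p Λ ‖ξ‖ * |z| ^ p)]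
    rw [lintegral_add_left (by fun_prop)]
    simp_rw [fun z : ℝ => ENNReal.ofReal_mul (q := z ^ 2)
      (by positivity : 0 ≤ 6 * gain p Λ ‖ξ‖), fun z : ℝ =>
      ENNReal.ofReal_mul (q := |z| ^ p) (by positivity : 0 ≤ 6 * gain p Λ ‖ξ‖)]
    rw [lintegral_const_mul _ (by fun_prop), lintegral_const_mul _ (by fun_prop),
      lintegral_sq_compPoisson]
    have hc1 : c ≤ 1 := by
      rw [← NNReal.coe_le_coe]; exact hc.trans (by norm_num)
    refine (add_le_add_right (mul_le_mul_right (h₂ c hc1) _) _).trans ?_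
    change _ ≤ ENNReal.ofReal (6 * (1 + C₂)) * _
    rw [← ENNReal.ofReal_coe_nnreal (p := c), ← ENNReal.ofReal_mul (by positivity),
      ← ENNReal.ofReal_mul (by positivity), ← ENNReal.ofReal_mul (by positivity),
      ← ENNReal.ofReal_add (by positivity) (by positivity)]
    apply ENNReal.ofReal_le_ofReal
    exact le_of_eq (by ring)
  · have := sqrt_norm_add_rpow_le_gain hp1 hp2 hΛ x (z • ξ)
    rw [inner_smul_right] at this
    nlinarith [hgz z]

theorem lintegral_comp_of_indepFun {Ω Ω' : Type*} {_ : MeasurableSpace Ω} {_ : MeasurableSpace Ω'}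
    {P : Measure Ω} [IsProbabilityMeasure P] {X : Ω → Ω'} {D : Ω → ℝ} (hX : Measurable X)
    (hD : Measurable D) (hind : IndepFun X D P) {g : Ω' × ℝ → ℝ≥0∞} (hg : Measurable g) :
    ∫⁻ ω, g (X ω, D ω) ∂P = ∫⁻ ω, ∫⁻ z, g (X ω, z) ∂(P.map D) ∂P := by
  have := (indepFun_iff_map_prod_eq_prod_map_map hX.aemeasurable hD.aemeasurable).1 hind
  have h1 := Measure.isProbabilityMeasure_map (μ := P) hD.aemeasurable
  rw [← lintegral_map hg (hX.prodMk hD), this, lintegral_prod _ hg.aemeasurable,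
    lintegral_map hg.lintegral_prod_right' hX]

/-- The identity, viewed as a random variable with values in `Ω` equipped with the σ-algebra `𝒢`,
generates `𝒢`. Hence freezing the past is Fubini for the pair formed by it and `D`. -/
theorem lintegral_comp_of_indep {Ω : Type*} {𝒢 m0 : MeasurableSpace Ω} {P : Measure Ω}
    [IsProbabilityMeasure P] (h𝒢 : 𝒢 ≤ m0) {D : Ω → ℝ}
    (hD : Measurable D) (hind : Indep 𝒢 (MeasurableSpace.comap D inferInstance) P)
    {g : Ω × ℝ → ℝ≥0∞} (hg : Measurable[@Prod.instMeasurableSpace _ _ 𝒢 _] g) :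
    ∫⁻ ω, g (ω, D ω) ∂P = ∫⁻ ω, ∫⁻ z, g (ω, z) ∂(P.map D) ∂P := by
  refine @lintegral_comp_of_indepFun Ω Ω m0 𝒢 P _ id D (measurable_id'' h𝒢) hD ?_ g hg
  refine (@IndepFun_iff_Indep Ω Ω ℝ m0 𝒢 _ id D P).2 ?_
  rwa [MeasurableSpace.comap_id]

end OneStep

/-! ### Predictable sums of compensated Poisson variables -/

section Steps

set_option linter.unusedSectionVars false

theorem ofReal_norm_rpow {E : Type*} [NormedAddCommGroup E] (x : E) {p : ℝ} (hp : 0 ≤ p) :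
    ENNReal.ofReal (‖x‖ ^ p) = ‖x‖ₑ ^ p := by
  rw [← ofReal_norm, ENNReal.ofReal_rpow_of_nonneg (norm_nonneg _) hp]

/-- Young's inequality with a parameter, without sharp constants: the first term suffices when `v ≤
ε * u`, the second otherwise. -/
theorem rpow_sub_one_mul_le {r ε u v : ℝ} (hr : 1 ≤ r) (hε : 0 < ε) (hu : 0 ≤ u) (hv : 0 ≤ v) :
    u ^ (r - 1) * v ≤ ε * u ^ r + ε ^ (1 - r) * v ^ r := by
  have e : ∀ {t : ℝ}, 0 ≤ t → t ^ (r - 1) * t = t ^ r := by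
    intro t ht
    rw [← Real.rpow_add_one' ht (by linarith)]; congr 1; ring
  have h1 : 0 ≤ ε * u ^ r := by positivity
  have h2 : 0 ≤ ε ^ (1 - r) * v ^ r := by positivity
  rcases le_total v (ε * u) with h | h
  · have : u ^ (r - 1) * v ≤ u ^ (r - 1) * (ε * u) := by gcongr
    have h3 := e hu
    nlinarith
  · have h3 : u ≤ v / ε := by rw [le_div_iff₀ hε]; linarith
    have h4 : u ^ (r - 1) ≤ (v / ε) ^ (r - 1) := Real.rpow_le_rpow hu h3 (by linarith)
    rw [Real.div_rpow hv hε.le, div_eq_mul_inv, ← Real.rpow_neg hε.le, neg_sub] at h4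
    have h5 := mul_le_mul_of_nonneg_right h4 hv
    have h6 := e hv
    have : v ^ (r - 1) * ε ^ (1 - r) * v = ε ^ (1 - r) * v ^ r := by rw [← h6]; ring
    linarith

/-- The absorption step used in the Doob and square-function bounds. Finiteness of `a` is essential
and must be established beforehand each time. -/
theorem le_two_mul_of_le_half_mul_add {a b : ℝ≥0∞} (ha : a ≠ ∞) (h : a ≤ 2⁻¹ * a + b) :
    a ≤ 2 * b := by
  rcases eq_or_ne b ∞ with rfl | hb
  · simp
  lift a to ℝ≥0 using ha
  lift b to ℝ≥0 using hb
  have e : (2⁻¹ : ℝ≥0∞) = ((2⁻¹ : ℝ≥0) : ℝ≥0∞) := by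
    rw [ENNReal.coe_inv (by norm_num)]; norm_num
  rw [e] at h
  norm_cast at h ⊢
  rw [← NNReal.coe_le_coe] at h ⊢
  push_cast at h ⊢
  linarith

/-- The running maximum of a sequence. -/
noncomputable def runMax (f : ℕ → ℝ) : ℕ → ℝ
  | 0 => f 0
  | n + 1 => max (runMax f n) (f (n + 1))

theorem le_runMax (f : ℕ → ℝ) (n : ℕ) : f n ≤ runMax f n := by
  cases n with
  | zero => exact le_rfl
  | succ n => exact le_max_right _ _

theorem runMax_mono (f : ℕ → ℝ) : Monotone (runMax f) :=
  monotone_nat_of_le_succ fun _ => le_max_left _ _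

theorem le_runMax_of_le (f : ℕ → ℝ) {k n : ℕ} (h : k ≤ n) : f k ≤ runMax f n :=
  (le_runMax f k).trans (runMax_mono f h)

theorem exists_runMax_eq (f : ℕ → ℝ) (n : ℕ) : ∃ k ≤ n, runMax f n = f k := by
  induction n with
  | zero => exact ⟨0, le_rfl, rfl⟩
  | succ n ih =>
    obtain ⟨k, hk, h⟩ := ih
    rcases le_total (runMax f n) (f (n + 1)) with h' | h'
    · exact ⟨n + 1, le_rfl, max_eq_right h'⟩
    · exact ⟨k, by omega, (max_eq_left h').trans h⟩

theorem measurable_runMax {α : Type*} {_ : MeasurableSpace α} {f : ℕ → α → ℝ} {n : ℕ}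
    (hf : ∀ k ≤ n, Measurable (f k)) : Measurable (fun a => runMax (fun k => f k a) n) := by
  induction n with
  | zero => exact hf 0 le_rfl
  | succ n ih => exact (ih fun k hk => hf k (by omega)).max (hf _ le_rfl)

variable {Ω : Type*} [MeasurableSpace Ω] {H : Type*} [NormedAddCommGroup H]
  [InnerProductSpace ℝ H]

/-- Increments `D k`, centered Poisson with parameters `c k ≤ 1 / 2` and independent of the past
`𝒢 k`, together with bounded predictable integrands `ξ k`. -/
structure IsPoissonSteps (P : Measure Ω) (𝒢 : ℕ → MeasurableSpace Ω) (c : ℕ → ℝ≥0)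
    (D : ℕ → Ω → ℝ) (ξ : ℕ → Ω → H) : Prop where
  le : ∀ k, 𝒢 k ≤ ‹MeasurableSpace Ω›
  mono : Monotone 𝒢
  c_le : ∀ k, (c k : ℝ) ≤ 1 / 2
  meas_D : ∀ k, Measurable[𝒢 (k + 1)] (D k)
  indep : ∀ k, Indep (𝒢 k) (MeasurableSpace.comap (D k) inferInstance) P
  law : ∀ k, P.map (D k) = compPoisson (c k)
  meas_ξ : ∀ k, StronglyMeasurable[𝒢 k] (ξ k)
  bdd : ∃ K, ∀ k ω, ‖ξ k ω‖ ≤ K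

/-- The partial sums `∑_{k < n} D k • ξ k`. -/
def stepSum (D : ℕ → Ω → ℝ) (ξ : ℕ → Ω → H) (n : ℕ) (ω : Ω) : H :=
  ∑ k ∈ Finset.range n, D k ω • ξ k ω

theorem stepSum_succ (D : ℕ → Ω → ℝ) (ξ : ℕ → Ω → H) (n : ℕ) (ω : Ω) :
    stepSum D ξ (n + 1) ω = stepSum D ξ n ω + D n ω • ξ n ω :=
  Finset.sum_range_succ _ _

namespace IsPoissonSteps

variable {P : Measure Ω} [IsProbabilityMeasure P] {𝒢 : ℕ → MeasurableSpace Ω} {c : ℕ → ℝ≥0}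
  {D : ℕ → Ω → ℝ} {ξ : ℕ → Ω → H}

theorem stronglyMeasurable_stepSum (h : IsPoissonSteps P 𝒢 c D ξ) (n : ℕ) :
    StronglyMeasurable[𝒢 n] (stepSum D ξ n) := by
  refine Finset.stronglyMeasurable_fun_sum _ fun k hk => ?_
  have hk := Finset.mem_range.1 hk
  exact (((h.meas_D k).mono (h.mono hk) le_rfl).stronglyMeasurable).smul
    ((h.meas_ξ k).mono (h.mono hk.le))

theorem measurable_norm_stepSum (h : IsPoissonSteps P 𝒢 c D ξ) {k n : ℕ} (hk : k ≤ n) :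
    Measurable[𝒢 n] (fun ω => ‖stepSum D ξ k ω‖) :=
  ((h.stronglyMeasurable_stepSum k).mono (h.mono hk)).norm.measurable

theorem measurable_norm (h : IsPoissonSteps P 𝒢 c D ξ) {k n : ℕ} (hk : k ≤ n) :
    Measurable[𝒢 n] (fun ω => ‖ξ k ω‖) :=
  ((h.meas_ξ k).mono (h.mono hk)).norm.measurable

theorem measurable_norm_stepSum' (h : IsPoissonSteps P 𝒢 c D ξ) (n : ℕ) :
    Measurable (fun ω => ‖stepSum D ξ n ω‖) :=
  (h.measurable_norm_stepSum le_rfl).mono (h.le n) le_rfl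

theorem measurable_norm' (h : IsPoissonSteps P 𝒢 c D ξ) (n : ℕ) :
    Measurable (fun ω => ‖ξ n ω‖) :=
  (h.measurable_norm le_rfl).mono (h.le n) le_rfl

theorem _root_.PoissonSI.measurable_step {α : Type*} {_ : MeasurableSpace α} {w : α → ℝ}
    {x ξ : α → H} (hw : Measurable w) (hx : StronglyMeasurable x) (hξ : StronglyMeasurable ξ) :
    Measurable (fun q : α × ℝ => (w q.1, ‖x q.1 + q.2 • ξ q.1‖)) := by
  refine (hw.comp measurable_fst).prodMk ?_
  exact ((hx.comp_measurable measurable_fst).add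
    (measurable_snd.stronglyMeasurable.smul (hξ.comp_measurable measurable_fst))).norm.measurable

/-- Conditioning on the past: a `𝒢 k`-measurable weight and the current partial sum are frozen, and
only the new increment is averaged. -/
theorem lintegral_step (h : IsPoissonSteps P 𝒢 c D ξ) (k : ℕ) {G : ℝ × ℝ → ℝ≥0∞}
    (hG : Measurable G) {w : Ω → ℝ} (hw : Measurable[𝒢 k] w) :
    ∫⁻ ω, G (w ω, ‖stepSum D ξ (k + 1) ω‖) ∂P =
      ∫⁻ ω, ∫⁻ z, G (w ω, ‖stepSum D ξ k ω + z • ξ k ω‖) ∂compPoisson (c k) ∂P := by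
  have hm := hG.comp (measurable_step hw (h.stronglyMeasurable_stepSum k) (h.meas_ξ k))
  have := lintegral_comp_of_indep (h.le k) ((h.meas_D k).mono (h.le _) le_rfl) (h.indep k) hm
  rw [h.law k] at this
  simp only [Function.comp] at this
  rw [← this]
  simp_rw [stepSum_succ]

theorem memLp_stepSum (h : IsPoissonSteps P 𝒢 c D ξ) {p : ℝ} (hp : 1 ≤ p) (n : ℕ) :
    MemLp (stepSum D ξ n) (ENNReal.ofReal p) P := by
  obtain ⟨K, hK⟩ := h.bdd
  refine memLp_finsetSum (f := fun k ω => D k ω • ξ k ω) _ fun k _ => ?_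
  have hD : Measurable (D k) := (h.meas_D k).mono (h.le _) le_rfl
  have hp0 : ENNReal.ofReal p ≠ 0 := by simp; linarith
  have h1 : MemLp (D k) (ENNReal.ofReal p) P := by
    refine ⟨hD.aestronglyMeasurable, ?_⟩
    rw [eLpNorm_lt_top_iff_lintegral_rpow_enorm_lt_top hp0 ENNReal.ofReal_ne_top,
      ENNReal.toReal_ofReal (by linarith)]
    have : ∫⁻ ω, ‖D k ω‖ₑ ^ p ∂P = ∫⁻ z, ENNReal.ofReal (|z| ^ p) ∂compPoisson (c k) := by
      rw [← h.law k, lintegral_map (by fun_prop) hD]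
      simp_rw [← ofReal_norm_rpow _ (by linarith : 0 ≤ p), Real.norm_eq_abs]
    rw [this]
    obtain ⟨C, -, hC⟩ := exists_lintegral_rpow_compPoisson_le p hp
    refine (hC (c k) ?_).trans_lt ENNReal.ofReal_lt_top
    rw [← NNReal.coe_le_coe]
    exact (h.c_le k).trans (by norm_num)
  refine MemLp.of_le_mul (c := K) h1 ?_ (ae_of_all _ fun ω => ?_)
  · exact hD.aestronglyMeasurable.smul ((h.meas_ξ k).mono (h.le k)).aestronglyMeasurable
  · rw [norm_smul, mul_comm]
    gcongr
    exact hK k ω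

theorem lintegral_rpow_norm_stepSum_ne_top (h : IsPoissonSteps P 𝒢 c D ξ) {p : ℝ} (hp : 1 ≤ p)
    (n : ℕ) : ∫⁻ ω, ENNReal.ofReal (‖stepSum D ξ n ω‖ ^ p) ∂P ≠ ∞ := by
  have hp0 : ENNReal.ofReal p ≠ 0 := by simp; linarith
  have := (h.memLp_stepSum hp n).2
  rw [eLpNorm_lt_top_iff_lintegral_rpow_enorm_lt_top hp0 ENNReal.ofReal_ne_top,
    ENNReal.toReal_ofReal (by linarith)] at this
  simp_rw [ofReal_norm_rpow _ (by linarith : 0 ≤ p)]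
  exact this.ne

/-- The running maximum of the norms of the partial sums. -/
noncomputable def _root_.PoissonSI.stepMax (D : ℕ → Ω → ℝ) (ξ : ℕ → Ω → H) (n : ℕ) (ω : Ω) : ℝ :=
  runMax (fun k => ‖stepSum D ξ k ω‖) n

theorem _root_.PoissonSI.stepMax_nonneg (D : ℕ → Ω → ℝ) (ξ : ℕ → Ω → H) (n : ℕ) (ω : Ω) :
    0 ≤ stepMax D ξ n ω :=
  (norm_nonneg _).trans (le_runMax (fun k => ‖stepSum D ξ k ω‖) n)

theorem _root_.PoissonSI.norm_stepSum_le_stepMax (D : ℕ → Ω → ℝ) (ξ : ℕ → Ω → H) {k n : ℕ}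
    (h : k ≤ n) (ω : Ω) : ‖stepSum D ξ k ω‖ ≤ stepMax D ξ n ω :=
  le_runMax_of_le (fun k => ‖stepSum D ξ k ω‖) h

theorem measurable_stepMax (h : IsPoissonSteps P 𝒢 c D ξ) (n : ℕ) :
    Measurable[𝒢 n] (stepMax D ξ n) :=
  measurable_runMax fun _ hk => h.measurable_norm_stepSum hk

theorem measurable_stepMax' (h : IsPoissonSteps P 𝒢 c D ξ) (n : ℕ) :
    Measurable (stepMax D ξ n) :=
  (h.measurable_stepMax n).mono (h.le n) le_rfl

theorem lintegral_stepMax_ne_top (h : IsPoissonSteps P 𝒢 c D ξ) {p : ℝ} (hp : 1 ≤ p)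
    (n : ℕ) : ∫⁻ ω, ENNReal.ofReal (stepMax D ξ n ω ^ p) ∂P ≠ ∞ := by
  have h1 : ∫⁻ ω, ENNReal.ofReal (stepMax D ξ n ω ^ p) ∂P ≤
      ∫⁻ ω, ∑ k ∈ Finset.range (n + 1), ENNReal.ofReal (‖stepSum D ξ k ω‖ ^ p) ∂P := by
    refine lintegral_mono fun ω => ?_
    obtain ⟨k, hk, e⟩ := exists_runMax_eq (fun k => ‖stepSum D ξ k ω‖) n
    simp only [stepMax, e]
    exact Finset.single_le_sum (f := fun k => ENNReal.ofReal (‖stepSum D ξ k ω‖ ^ p))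
      (fun _ _ => zero_le) (Finset.mem_range.2 (by omega))
  refine ne_top_of_le_ne_top ?_ h1
  rw [lintegral_finsetSum' _ fun k _ =>
    ((h.measurable_norm_stepSum' k).pow_const p).ennreal_ofReal.aemeasurable]
  exact (ENNReal.sum_lt_top.2 fun k _ => (h.lintegral_rpow_norm_stepSum_ne_top hp k).lt_top).ne

/-- Doob's maximal inequality. -/
theorem lintegral_stepMax_le {p : ℝ} (hp : 1 < p) (h : IsPoissonSteps P 𝒢 c D ξ) (n : ℕ) :
    ∫⁻ ω, ENNReal.ofReal (stepMax D ξ n ω ^ p) ∂P ≤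
      ENNReal.ofReal (2 * (p / (p - 1)) * ((p - 1) / (2 * p)) ^ (1 - p)) *
        ∫⁻ ω, ENNReal.ofReal (‖stepSum D ξ n ω‖ ^ p) ∂P := by
  set S := stepMax D ξ with hS
  set M := stepSum D ξ with hM
  have hS0 : ∀ k ω, 0 ≤ S k ω := stepMax_nonneg D ξ
  have hSm : ∀ k, Measurable (S k) := h.measurable_stepMax'
  have hMm : ∀ k, Measurable (fun ω => ‖M k ω‖) := h.measurable_norm_stepSum'
  -- The integrated form of Doob's inequality, proved by induction in `k` without stopping times.
  have key : ∀ k, ENNReal.ofReal (p - 1) * ∫⁻ ω, ENNReal.ofReal (S k ω ^ p) ∂P ≤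
      ENNReal.ofReal p * ∫⁻ ω, ENNReal.ofReal (S k ω ^ (p - 1) * ‖M k ω‖) ∂P := by
    intro k
    induction k with
    | zero =>
      have e1 : ∀ ω, M 0 ω = 0 := fun ω => by simp [hM, stepSum]
      have e2 : ∀ ω, S 0 ω = 0 := fun ω => by simp [hS, stepMax, runMax, stepSum]
      simp [e2, Real.zero_rpow (by linarith : p ≠ 0)]
    | succ k ih =>
      set β := ∫⁻ ω, ENNReal.ofReal (S k ω ^ (p - 1) * ‖M k ω‖) ∂P
      have hβ : ENNReal.ofReal p * β ≠ ∞ := by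
        refine ENNReal.mul_ne_top ENNReal.ofReal_ne_top
          (ne_top_of_le_ne_top (h.lintegral_stepMax_ne_top hp.le k) (lintegral_mono fun ω => ?_))
        apply ENNReal.ofReal_le_ofReal
        have e : S k ω ^ p = S k ω ^ (p - 1) * S k ω := by
          rw [← Real.rpow_add_one' (hS0 k ω) (by linarith)]; congr 1; ring
        change _ ≤ S k ω ^ p
        rw [e]
        exact mul_le_mul_of_nonneg_left (norm_stepSum_le_stepMax D ξ le_rfl ω)
          (Real.rpow_nonneg (hS0 k ω) _)
      have h1 : β ≤ ∫⁻ ω, ENNReal.ofReal (S k ω ^ (p - 1) * ‖M (k + 1) ω‖) ∂P := by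
        have := h.lintegral_step k (G := fun q => ENNReal.ofReal (q.1 ^ (p - 1) * q.2))
          (by fun_prop) (h.measurable_stepMax k)
        refine le_trans (lintegral_mono fun ω => ?_) this.ge
        change _ ≤ ∫⁻ z, ENNReal.ofReal (S k ω ^ (p - 1) * ‖M k ω + z • ξ k ω‖) ∂compPoisson (c k)
        simp_rw [ENNReal.ofReal_mul (Real.rpow_nonneg (hS0 k ω) _)]
        rw [lintegral_const_mul' _ _ ENNReal.ofReal_ne_top]
        gcongr
        simpa using rpow_norm_le_lintegral le_rfl (c k) (M k ω) (ξ k ω)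
      -- A pathwise inequality: nothing changes unless a new maximum is attained, and then it is
      -- Bernoulli's inequality for the ratio of the new to the old maximum.
      have h2 : ∀ ω, (p - 1) * S (k + 1) ω ^ p + p * (S k ω ^ (p - 1) * ‖M (k + 1) ω‖) ≤
          (p - 1) * S k ω ^ p + p * (S (k + 1) ω ^ (p - 1) * ‖M (k + 1) ω‖) := by
        intro ω
        have e : ∀ {t : ℝ}, 0 ≤ t → t ^ (p - 1) * t = t ^ p := by
          intro t ht
          rw [← Real.rpow_add_one' ht (by linarith)]; congr 1; ring
        have hsucc : S (k + 1) ω = max (S k ω) ‖M (k + 1) ω‖ := rfl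
        rcases le_total ‖M (k + 1) ω‖ (S k ω) with h' | h'
        · rw [hsucc, max_eq_left h']
        · rw [hsucc, max_eq_right h', e (norm_nonneg _)]
          set x := ‖M (k + 1) ω‖
          have hx0 : 0 ≤ x := norm_nonneg _
          rcases (hS0 k ω).eq_or_lt with h0 | h0
          · rw [← h0, Real.zero_rpow (by linarith : p ≠ 0), Real.zero_rpow (by linarith)]
            have : 0 ≤ x ^ p := by positivity
            linarith
          · have hb := one_add_mul_self_le_rpow_one_add (s := x / S k ω - 1)
              (by linarith [div_nonneg hx0 h0.le]) hp.le
            have e2 : 1 + (x / S k ω - 1) = x / S k ω := by ring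
            have hpos : 0 < S k ω ^ p := by positivity
            rw [e2, Real.div_rpow hx0 h0.le, le_div_iff₀ hpos] at hb
            have e3 : (1 + p * (x / S k ω - 1)) * S k ω ^ p =
                p * (S k ω ^ (p - 1) * x) - (p - 1) * S k ω ^ p := by
              rw [← e h0.le]; field_simp; ring
            linarith
      have h3 := lintegral_mono (μ := P) fun ω => ENNReal.ofReal_le_ofReal (h2 ω)
      have nn : ∀ {a b : ℝ}, 0 ≤ a → 0 ≤ b → ∀ ω j l,
          0 ≤ a * S j ω ^ p ∧ 0 ≤ b * (S j ω ^ (p - 1) * ‖M l ω‖) := fun ha hb ω j l =>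
        ⟨mul_nonneg ha (Real.rpow_nonneg (hS0 j ω) _),
          mul_nonneg hb (mul_nonneg (Real.rpow_nonneg (hS0 j ω) _) (norm_nonneg _))⟩
      have hp1 : 0 ≤ p - 1 := by linarith
      have hp0 : 0 ≤ p := by linarith
      have expand : ∀ j l : ℕ, ∫⁻ ω, ENNReal.ofReal ((p - 1) * S j ω ^ p +
          p * (S l ω ^ (p - 1) * ‖M (k + 1) ω‖)) ∂P =
          ENNReal.ofReal (p - 1) * ∫⁻ ω, ENNReal.ofReal (S j ω ^ p) ∂P +
          ENNReal.ofReal p * ∫⁻ ω, ENNReal.ofReal (S l ω ^ (p - 1) * ‖M (k + 1) ω‖) ∂P := by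
        intro j l
        have hSj := hSm j
        have hSl := hSm l
        have hMk := hMm (k + 1)
        simp_rw [fun ω => ENNReal.ofReal_add (nn hp1 hp0 ω j l).1 (nn hp1 hp0 ω l (k + 1)).2,
          ENNReal.ofReal_mul hp1, ENNReal.ofReal_mul hp0]
        rw [lintegral_add_left (by fun_prop), lintegral_const_mul' _ _ ENNReal.ofReal_ne_top,
          lintegral_const_mul' _ _ ENNReal.ofReal_ne_top]
      rw [expand, expand] at h3
      have h4 := (add_le_add_right (mul_le_mul_right h1 (ENNReal.ofReal p)) _).trans
        (h3.trans (add_le_add_left ih _))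
      rw [add_comm] at h4
      exact (ENNReal.add_le_add_iff_left hβ).1 h4
  have h0 : 0 < p - 1 := by linarith
  -- With this value the maximal term on the right carries the coefficient `p / (p - 1) * ε = 1 / 2`
  -- and can be absorbed.
  set ε := (p - 1) / (2 * p) with hε
  have hεp : 0 < ε := by positivity
  have hX := h.lintegral_stepMax_ne_top hp.le n
  have hY : ∫⁻ ω, ENNReal.ofReal (S n ω ^ (p - 1) * ‖M n ω‖) ∂P ≤
      ENNReal.ofReal ε * ∫⁻ ω, ENNReal.ofReal (S n ω ^ p) ∂P +
      ENNReal.ofReal (ε ^ (1 - p)) * ∫⁻ ω, ENNReal.ofReal (‖M n ω‖ ^ p) ∂P := by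
    have hSn := hSm n
    rw [← lintegral_const_mul' _ _ ENNReal.ofReal_ne_top,
      ← lintegral_const_mul' _ _ ENNReal.ofReal_ne_top, ← lintegral_add_left (by fun_prop)]
    refine lintegral_mono fun ω => ?_
    rw [← ENNReal.ofReal_mul hεp.le, ← ENNReal.ofReal_mul (by positivity),
      ← ENNReal.ofReal_add (mul_nonneg hεp.le (Real.rpow_nonneg (hS0 n ω) _)) (by positivity)]
    exact ENNReal.ofReal_le_ofReal (rpow_sub_one_mul_le hp.le hεp (hS0 n ω) (norm_nonneg _))
  have hk := mul_le_mul_right ((key n).trans (mul_le_mul_right hY _)) (ENNReal.ofReal (1 / (p - 1)))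
  have e1 : ENNReal.ofReal (1 / (p - 1)) * ENNReal.ofReal (p - 1) = 1 := by
    rw [← ENNReal.ofReal_mul (by positivity), one_div_mul_cancel h0.ne', ENNReal.ofReal_one]
  have e2 : ENNReal.ofReal (1 / (p - 1)) * (ENNReal.ofReal p * ENNReal.ofReal ε) = 2⁻¹ := by
    rw [← ENNReal.ofReal_mul (by linarith), ← ENNReal.ofReal_mul (by positivity)]
    have : 1 / (p - 1) * (p * ε) = 2⁻¹ := by rw [hε]; field_simp
    rw [this, ENNReal.ofReal_inv_of_pos (by norm_num)]; norm_num
  rw [← mul_assoc, e1, one_mul, mul_add, mul_add, ← mul_assoc (ENNReal.ofReal p), ← mul_assoc,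
    e2] at hk
  refine (le_two_mul_of_le_half_mul_add hX hk).trans (le_of_eq ?_)
  rw [← mul_assoc (ENNReal.ofReal p), ← mul_assoc (ENNReal.ofReal (1 / (p - 1))), ← mul_assoc]
  congr 1
  rw [← ENNReal.ofReal_mul (by linarith), ← ENNReal.ofReal_mul (by positivity),
    show (2 : ℝ≥0∞) = ENNReal.ofReal 2 by norm_num, ← ENNReal.ofReal_mul (by norm_num)]
  congr 1
  field_simp

end IsPoissonSteps

end Steps

/-! ### Moment bounds for predictable Poisson sums. -/

section StepInequalities

variable {Ω : Type uΩ} [MeasurableSpace Ω] {H : Type uH} [NormedAddCommGroup H]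
  [InnerProductSpace ℝ H] {P : Measure Ω} [IsProbabilityMeasure P] {𝒢 : ℕ → MeasurableSpace Ω}
  {c : ℕ → ℝ≥0} {D : ℕ → Ω → ℝ} {ξ : ℕ → Ω → H}

/-- The predictable bracket `∑_{k < n} c k ‖ξ k‖²`. -/
noncomputable def stepVar (c : ℕ → ℝ≥0) (ξ : ℕ → Ω → H) (n : ℕ) (ω : Ω) : ℝ :=
  ∑ k ∈ Finset.range n, c k * ‖ξ k ω‖ ^ 2

/-- The predictable power sum `∑_{k < n} c k ‖ξ k‖ ^ p`. -/
noncomputable def stepPow (p : ℝ) (c : ℕ → ℝ≥0) (ξ : ℕ → Ω → H) (n : ℕ) (ω : Ω) : ℝ :=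
  ∑ k ∈ Finset.range n, c k * ‖ξ k ω‖ ^ p

set_option linter.unusedSectionVars false

theorem stepVar_nonneg (n : ℕ) (ω : Ω) : 0 ≤ stepVar c ξ n ω :=
  Finset.sum_nonneg fun _ _ => by positivity

theorem stepPow_nonneg (p : ℝ) (n : ℕ) (ω : Ω) : 0 ≤ stepPow p c ξ n ω :=
  Finset.sum_nonneg fun _ _ => by positivity

theorem stepVar_succ (n : ℕ) (ω : Ω) :
    stepVar c ξ (n + 1) ω = stepVar c ξ n ω + c n * ‖ξ n ω‖ ^ 2 :=
  Finset.sum_range_succ _ _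

theorem IsPoissonSteps.measurable_stepVar (h : IsPoissonSteps P 𝒢 c D ξ) {k n : ℕ}
    (hk : k ≤ n + 1) : Measurable[𝒢 n] (stepVar c ξ k) := by
  refine Finset.measurable_fun_sum _ fun l hl => ?_
  have hl := Finset.mem_range.1 hl
  exact ((h.measurable_norm (by omega : l ≤ n)).pow_const 2).const_mul _

theorem IsPoissonSteps.measurable_stepVar' (h : IsPoissonSteps P 𝒢 c D ξ) (n : ℕ) :
    Measurable (stepVar c ξ n) :=
  (h.measurable_stepVar (Nat.le_succ n)).mono (h.le n) le_rfl

theorem IsPoissonSteps.measurable_stepPow (h : IsPoissonSteps P 𝒢 c D ξ) (p : ℝ) (n : ℕ) :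
    Measurable (stepPow p c ξ n) :=
  Finset.measurable_fun_sum _ fun l _ => ((h.measurable_norm' l).pow_const p).const_mul _

/-- Telescoping the one-step bound leaves `∑ ‖M k‖ ^ (p - 2) * c k * ‖ξ k‖ ^ 2`. Replacing `‖M k‖`
by the maximum turns this into a power of the maximum times the bracket; Young's inequality
separates them and Doob's inequality returns to `‖M n‖`. -/
theorem exists_lintegral_stepSum_le_of_two_le {p : ℝ} (hp : 2 ≤ p) : ∃ C : ℝ≥0,
    ∀ {Ω : Type uΩ} [MeasurableSpace Ω] {H : Type uH} [NormedAddCommGroup H]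
      [InnerProductSpace ℝ H] {P : Measure Ω} [IsProbabilityMeasure P] {𝒢 : ℕ → MeasurableSpace Ω}
      {c : ℕ → ℝ≥0} {D : ℕ → Ω → ℝ} {ξ : ℕ → Ω → H}, IsPoissonSteps P 𝒢 c D ξ → ∀ n : ℕ,
      ∫⁻ ω, ENNReal.ofReal (‖stepSum D ξ n ω‖ ^ p) ∂P ≤
        C * (∫⁻ ω, ENNReal.ofReal (stepVar c ξ n ω ^ (p / 2)) ∂P +
          ∫⁻ ω, ENNReal.ofReal (stepPow p c ξ n ω) ∂P) := by
  obtain ⟨C, hC, hstep⟩ := exists_lintegral_rpow_norm_add_le.{uH} hp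
  set Cd : ℝ := 2 * (p / (p - 1)) * ((p - 1) / (2 * p)) ^ (1 - p) with hCd
  have hCd0 : 0 < Cd := by
    have : 0 < p - 1 := by linarith
    positivity
  -- Chosen so that the one-step constant, Young's parameter and Doob's constant multiply to `1 /
  -- 2`.
  set ε : ℝ := 1 / (2 * (C * Cd)) with hε
  have hC' : (0 : ℝ) < C := hC
  have hε0 : 0 < ε := by positivity
  refine ⟨2 * C * (ε ^ (1 - p / 2) + 1).toNNReal, ?_⟩
  intro Ω _ H _ _ P _ 𝒢 c D ξ h n
  set X := ∫⁻ ω, ENNReal.ofReal (‖stepSum D ξ n ω‖ ^ p) ∂P with hX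
  set IA := ∫⁻ ω, ENNReal.ofReal (stepVar c ξ n ω ^ (p / 2)) ∂P
  set IB := ∫⁻ ω, ENNReal.ofReal (stepPow p c ξ n ω) ∂P
  have hMm := h.measurable_norm_stepSum'
  have hξm := h.measurable_norm'
  have h1 : ∀ n, ∫⁻ ω, ENNReal.ofReal (‖stepSum D ξ n ω‖ ^ p) ∂P ≤
      C * ∫⁻ ω, ∑ k ∈ Finset.range n, ENNReal.ofReal
        (‖stepSum D ξ k ω‖ ^ (p - 2) * (c k * ‖ξ k ω‖ ^ 2) + c k * ‖ξ k ω‖ ^ p) ∂P := by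
    intro n
    induction n with
    | zero => simp [stepSum, Real.zero_rpow (by linarith : p ≠ 0)]
    | succ n ih =>
      have e := h.lintegral_step n (G := fun q => ENNReal.ofReal (q.2 ^ p)) (by fun_prop)
        (w := fun _ => 0) measurable_const
      simp only at e
      rw [e]
      have hn1 := hMm n
      have hn2 := hξm n
      refine (lintegral_mono fun ω => hstep (c n) (h.c_le n) (stepSum D ξ n ω) (ξ n ω)).trans ?_
      rw [lintegral_add_left (by fun_prop), lintegral_const_mul' _ _ ENNReal.coe_ne_top]
      refine (add_le_add_left ih _).trans ?_
      rw [← mul_add]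
      gcongr
      rw [← lintegral_add_right _ (by fun_prop)]
      refine lintegral_mono fun ω => ?_
      simp only [Finset.sum_range_succ]
      exact le_rfl
  have h2 : ∀ ω, ∑ k ∈ Finset.range n, ENNReal.ofReal
        (‖stepSum D ξ k ω‖ ^ (p - 2) * (c k * ‖ξ k ω‖ ^ 2) + c k * ‖ξ k ω‖ ^ p) ≤
      ENNReal.ofReal ε * ENNReal.ofReal (stepMax D ξ n ω ^ p) +
      (ENNReal.ofReal (ε ^ (1 - p / 2)) * ENNReal.ofReal (stepVar c ξ n ω ^ (p / 2)) +
      ENNReal.ofReal (stepPow p c ξ n ω)) := by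
    intro ω
    have hS := stepMax_nonneg D ξ n ω
    have hA := stepVar_nonneg (c := c) (ξ := ξ) n ω
    have hB := stepPow_nonneg (c := c) (ξ := ξ) p n ω
    rw [← ENNReal.ofReal_sum_of_nonneg fun k _ => by positivity]
    rw [← ENNReal.ofReal_mul hε0.le, ← ENNReal.ofReal_mul (by positivity),
      ← ENNReal.ofReal_add (by positivity) hB, ← ENNReal.ofReal_add (by positivity) (by positivity)]
    apply ENNReal.ofReal_le_ofReal
    rw [Finset.sum_add_distrib, ← add_assoc]
    refine add_le_add ?_ le_rfl
    calc _ ≤ ∑ k ∈ Finset.range n, stepMax D ξ n ω ^ (p - 2) * (c k * ‖ξ k ω‖ ^ 2) := by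
          refine Finset.sum_le_sum fun k hk => ?_
          have hk := (Finset.mem_range.1 hk).le
          have := Real.rpow_le_rpow (norm_nonneg _) (norm_stepSum_le_stepMax D ξ hk ω)
            (by linarith : 0 ≤ p - 2)
          gcongr
      _ = (stepMax D ξ n ω ^ 2) ^ (p / 2 - 1) * stepVar c ξ n ω := by
          rw [← Finset.mul_sum, stepVar]
          congr 1
          rw [← Real.rpow_natCast, ← Real.rpow_mul hS]; congr 1; push_cast; ring
      _ ≤ ε * (stepMax D ξ n ω ^ 2) ^ (p / 2) + ε ^ (1 - p / 2) * stepVar c ξ n ω ^ (p / 2) :=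
          rpow_sub_one_mul_le (by linarith) hε0 (by positivity) hA
      _ = _ := by
          congr 2
          rw [← Real.rpow_natCast, ← Real.rpow_mul hS]; congr 1; push_cast; ring
  have h3 := (h1 n).trans (mul_le_mul_right (lintegral_mono (μ := P) h2) _)
  have hSm := h.measurable_stepMax' n
  have hAm := h.measurable_stepVar' n
  rw [lintegral_add_left (by fun_prop), lintegral_add_left (by fun_prop),
    lintegral_const_mul' _ _ ENNReal.ofReal_ne_top,
    lintegral_const_mul' _ _ ENNReal.ofReal_ne_top] at h3
  have h4 := h.lintegral_stepMax_le (by linarith : 1 < p) n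
  rw [← hCd] at h4
  have h5 : X ≤ 2⁻¹ * X + C * (ENNReal.ofReal (ε ^ (1 - p / 2)) * IA + IB) := by
    refine h3.trans ?_
    rw [mul_add]
    refine add_le_add_left ?_ _
    refine (mul_le_mul_right (mul_le_mul_right h4 _) _).trans (le_of_eq ?_)
    rw [← mul_assoc, ← mul_assoc]
    congr 1
    rw [← ENNReal.ofReal_coe_nnreal, ← ENNReal.ofReal_mul hC'.le,
      ← ENNReal.ofReal_mul (by positivity)]
    have : (C : ℝ) * ε * Cd = 2⁻¹ := by rw [hε]; field_simp
    rw [this, ENNReal.ofReal_inv_of_pos (by norm_num)]; norm_num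
  refine (le_two_mul_of_le_half_mul_add
    (h.lintegral_rpow_norm_stepSum_ne_top (by linarith) n) h5).trans ?_
  push_cast
  rw [mul_assoc, mul_assoc]
  gcongr
  have h6 : ENNReal.ofReal (ε ^ (1 - p / 2)) ≤ ((ε ^ (1 - p / 2) + 1).toNNReal : ℝ≥0∞) :=
    ENNReal.ofReal_le_ofReal (by linarith)
  have h7 : (1 : ℝ≥0∞) ≤ ((ε ^ (1 - p / 2) + 1).toNNReal : ℝ≥0∞) := by
    rw [← ENNReal.ofReal_one]
    exact ENNReal.ofReal_le_ofReal (by linarith [Real.rpow_nonneg hε0.le (1 - p / 2)])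
  rw [mul_add]
  gcongr
  calc IB = 1 * IB := (one_mul _).symm
    _ ≤ _ := by gcongr

/-- With `A` the bracket and `r = p / 2`, convexity gives `A (k + 1) ^ r - A k ^ r ≤ r * A (k + 1) ^
(r - 1) * (A (k + 1) - A k)`. Since `A (k + 1)` is already known at time `k`, it is a legitimate
weight for the increment of `‖M‖ ^ 2`. The sum is at most `r` times the mean of `A n ^ (r - 1) * ‖M
n‖ ^ 2`, and Young's inequality finishes. -/
theorem IsPoissonSteps.lintegral_stepVar_le {p : ℝ} (hp : 2 ≤ p) (h : IsPoissonSteps P 𝒢 c D ξ)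
    (n : ℕ) : ∫⁻ ω, ENNReal.ofReal (stepVar c ξ n ω ^ (p / 2)) ∂P ≤
      ENNReal.ofReal (p * p ^ (p / 2 - 1)) *
        ∫⁻ ω, ENNReal.ofReal (‖stepSum D ξ n ω‖ ^ p) ∂P := by
  set r := p / 2 with hr
  have hr1 : 1 ≤ r := by linarith
  set A := stepVar c ξ with hAdef
  set M := stepSum D ξ with hM
  have hA0 : ∀ n ω, 0 ≤ A n ω := stepVar_nonneg
  have hAm := h.measurable_stepVar'
  have hMm := h.measurable_norm_stepSum'
  have key : ∀ k, ∫⁻ ω, ENNReal.ofReal (A k ω ^ r) ∂P ≤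
      ENNReal.ofReal r * ∫⁻ ω, ENNReal.ofReal (A k ω ^ (r - 1) * ‖M k ω‖ ^ 2) ∂P := by
    intro k
    induction k with
    | zero =>
      have : ∀ ω, A 0 ω = 0 := fun ω => by simp [hAdef, stepVar]
      simp [this, Real.zero_rpow (by linarith : r ≠ 0)]
    | succ k ih =>
      have e := h.lintegral_step k (G := fun q => ENNReal.ofReal (q.1 ^ (r - 1) * q.2 ^ 2))
        (by fun_prop) (w := A (k + 1)) (h.measurable_stepVar le_rfl)
      simp only at e
      have h1 : ∫⁻ ω, ENNReal.ofReal (A k ω ^ (r - 1) * ‖M k ω‖ ^ 2) ∂P +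
          ∫⁻ ω, ENNReal.ofReal (A (k + 1) ω ^ (r - 1) * (c k * ‖ξ k ω‖ ^ 2)) ∂P ≤
          ∫⁻ ω, ENNReal.ofReal (A (k + 1) ω ^ (r - 1) * ‖M (k + 1) ω‖ ^ 2) ∂P := by
        rw [hM, e]
        have hAk := hAm k
        have hMk := hMm k
        rw [← lintegral_add_left (by fun_prop)]
        refine lintegral_mono fun ω => ?_
        have hnn := Real.rpow_nonneg (hA0 (k + 1) ω) (r - 1)
        simp_rw [ENNReal.ofReal_mul hnn]
        rw [lintegral_const_mul' _ _ ENNReal.ofReal_ne_top]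
        refine le_trans ?_ (mul_le_mul_right (sq_norm_add_le_lintegral (c k) (stepSum D ξ k ω)
          (ξ k ω)) _)
        rw [mul_add, ENNReal.ofReal_mul (Real.rpow_nonneg (hA0 k ω) _)]
        gcongr
        · exact hA0 k ω
        · rw [hAdef, stepVar_succ]
          have : 0 ≤ c k * ‖ξ k ω‖ ^ 2 := by positivity
          linarith
      have h2 : ∀ ω, A (k + 1) ω ^ r ≤
          A k ω ^ r + r * (A (k + 1) ω ^ (r - 1) * (c k * ‖ξ k ω‖ ^ 2)) := by
        intro ω
        have hs : A (k + 1) ω = A k ω + c k * ‖ξ k ω‖ ^ 2 := stepVar_succ k ω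
        rcases (hA0 (k + 1) ω).eq_or_lt with h0 | h0
        · rw [← h0, Real.zero_rpow (by linarith : r ≠ 0)]
          have := Real.rpow_nonneg (hA0 k ω) r
          have h3 : (0 : ℝ) ≤ 0 ^ (r - 1) := Real.rpow_nonneg le_rfl _
          positivity
        · have hb := one_add_mul_self_le_rpow_one_add (s := A k ω / A (k + 1) ω - 1)
            (by linarith [div_nonneg (hA0 k ω) h0.le]) hr1
          have e2 : 1 + (A k ω / A (k + 1) ω - 1) = A k ω / A (k + 1) ω := by ring
          have hpos : 0 < A (k + 1) ω ^ r := by positivity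
          rw [e2, Real.div_rpow (hA0 k ω) h0.le, le_div_iff₀ hpos] at hb
          have e3 : A (k + 1) ω ^ r = A (k + 1) ω ^ (r - 1) * A (k + 1) ω := by
            rw [← Real.rpow_add_one h0.ne']; congr 1; ring
          have e4 : (1 + r * (A k ω / A (k + 1) ω - 1)) * A (k + 1) ω ^ r =
              A (k + 1) ω ^ r - r * (A (k + 1) ω ^ (r - 1) * (A (k + 1) ω - A k ω)) := by
            rw [e3]; field_simp; ring
          rw [e4] at hb
          have : c k * ‖ξ k ω‖ ^ 2 = A (k + 1) ω - A k ω := by rw [hs]; ring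
          rw [this]
          linarith
      refine (lintegral_mono fun ω => ENNReal.ofReal_le_ofReal (h2 ω)).trans ?_
      have hAk := hAm k
      have hAk1 := hAm (k + 1)
      simp_rw [fun ω => ENNReal.ofReal_add (Real.rpow_nonneg (hA0 k ω) r)
        (mul_nonneg (by linarith : 0 ≤ r) (mul_nonneg (Real.rpow_nonneg (hA0 (k + 1) ω) (r - 1))
          (by positivity : 0 ≤ c k * ‖ξ k ω‖ ^ 2))), ENNReal.ofReal_mul (by linarith : 0 ≤ r)]
      rw [lintegral_add_left (by fun_prop), lintegral_const_mul' _ _ ENNReal.ofReal_ne_top]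
      refine (add_le_add_left ih _).trans ?_
      rw [← mul_add]
      gcongr
  -- Boundedness of the integrands makes the bracket bounded, which licenses the absorption below.
  have hfin : ∫⁻ ω, ENNReal.ofReal (A n ω ^ r) ∂P ≠ ∞ := by
    obtain ⟨K, hK⟩ := h.bdd
    refine ne_top_of_le_ne_top ?_ (lintegral_mono (g := fun _ =>
      ENNReal.ofReal ((∑ k ∈ Finset.range n, c k * K ^ 2) ^ r)) fun ω => ?_)
    · simp
    · apply ENNReal.ofReal_le_ofReal
      refine Real.rpow_le_rpow (hA0 n ω) (Finset.sum_le_sum fun k _ => ?_) (by linarith)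
      gcongr
      exact hK k ω
  have hp0 : 0 < p := by linarith
  have hAn := hAm n
  have hMn := hMm n
  -- The weight `1 / p` against the factor `r = p / 2` leaves the coefficient `1 / 2`.
  have h1 : ∫⁻ ω, ENNReal.ofReal (A n ω ^ (r - 1) * ‖M n ω‖ ^ 2) ∂P ≤
      ENNReal.ofReal (1 / p) * ∫⁻ ω, ENNReal.ofReal (A n ω ^ r) ∂P +
      ENNReal.ofReal ((1 / p) ^ (1 - r)) * ∫⁻ ω, ENNReal.ofReal (‖M n ω‖ ^ p) ∂P := by
    rw [← lintegral_const_mul' _ _ ENNReal.ofReal_ne_top,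
      ← lintegral_const_mul' _ _ ENNReal.ofReal_ne_top, ← lintegral_add_left (by fun_prop)]
    refine lintegral_mono fun ω => ?_
    have hnn := Real.rpow_nonneg (hA0 n ω) r
    rw [← ENNReal.ofReal_mul (by positivity), ← ENNReal.ofReal_mul (by positivity),
      ← ENNReal.ofReal_add (by positivity) (by positivity)]
    apply ENNReal.ofReal_le_ofReal
    have := rpow_sub_one_mul_le hr1 (by positivity : 0 < 1 / p) (hA0 n ω) (sq_nonneg ‖M n ω‖)
    refine this.trans (le_of_eq ?_)
    congr 2
    rw [← Real.rpow_natCast, ← Real.rpow_mul (norm_nonneg _)]; congr 1; push_cast; ring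
  have h2 := (key n).trans (mul_le_mul_right h1 _)
  have e1 : ENNReal.ofReal r * ENNReal.ofReal (1 / p) = 2⁻¹ := by
    rw [← ENNReal.ofReal_mul (by linarith)]
    have : r * (1 / p) = 2⁻¹ := by rw [hr]; field_simp
    rw [this, ENNReal.ofReal_inv_of_pos (by norm_num)]; norm_num
  rw [mul_add, ← mul_assoc, e1, ← mul_assoc] at h2
  refine (le_two_mul_of_le_half_mul_add hfin h2).trans (le_of_eq ?_)
  rw [← mul_assoc]
  congr 1
  rw [← ENNReal.ofReal_mul (by linarith), show (2 : ℝ≥0∞) = ENNReal.ofReal 2 by norm_num,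
    ← ENNReal.ofReal_mul (by norm_num)]
  congr 1
  rw [one_div, Real.inv_rpow hp0.le, ← Real.rpow_neg hp0.le, neg_sub, hr]
  ring

theorem IsPoissonSteps.lintegral_stepPow_le {p : ℝ} (hp : 2 ≤ p) (h : IsPoissonSteps P 𝒢 c D ξ)
    (n : ℕ) : ENNReal.ofReal ((1 / 2) ^ p * (1 / 2) ^ p) *
      ∫⁻ ω, ENNReal.ofReal (stepPow p c ξ n ω) ∂P ≤
        ∫⁻ ω, ENNReal.ofReal (‖stepSum D ξ n ω‖ ^ p) ∂P := by
  induction n with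
  | zero => simp [stepPow]
  | succ n ih =>
    have e := h.lintegral_step n (G := fun q => ENNReal.ofReal (q.2 ^ p)) (by fun_prop)
      (w := fun _ => 0) measurable_const
    simp only at e
    rw [e]
    refine le_trans ?_ (lintegral_mono fun ω =>
      rpow_norm_add_le_lintegral hp (h.c_le n) (stepSum D ξ n ω) (ξ n ω))
    have h1 := h.measurable_norm_stepSum' n
    have h2 := h.measurable_stepPow p n
    rw [lintegral_add_left (by fun_prop), lintegral_const_mul' _ _ ENNReal.ofReal_ne_top]
    refine le_trans ?_ (add_le_add_left ih _)
    rw [← mul_add, ← lintegral_add_left (by fun_prop)]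
    gcongr with ω
    rw [← ENNReal.ofReal_add (stepPow_nonneg p n ω) (by positivity), stepPow,
      Finset.sum_range_succ]
    rfl

theorem measurable_gain₂ {p : ℝ} {α : Type*} {_ : MeasurableSpace α} {R f : α → ℝ}
    (hR : Measurable R) (hf : Measurable f) : Measurable (fun a => gain p (R a) (f a)) := by
  unfold gain; fun_prop

/-- Telescoping gives the gain at the running level `‖M k‖`. As `gain` decreases in its level, it
may be lowered to the single level given by the maximum, the one at which the integrand is later
truncated. -/
theorem IsPoissonSteps.lintegral_gain_le {p : ℝ} (hp1 : 1 < p) (hp2 : p < 2)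
    (h : IsPoissonSteps P 𝒢 c D ξ) (n : ℕ) : ENNReal.ofReal (p * (p - 1) / 128) *
      ∫⁻ ω, ENNReal.ofReal (∑ k ∈ Finset.range n, c k * gain p (stepMax D ξ n ω) ‖ξ k ω‖) ∂P ≤
        ∫⁻ ω, ENNReal.ofReal (‖stepSum D ξ n ω‖ ^ p) ∂P := by
  have key : ∀ n, ENNReal.ofReal (p * (p - 1) / 128) *
      ∫⁻ ω, ENNReal.ofReal (∑ k ∈ Finset.range n, c k * gain p ‖stepSum D ξ k ω‖ ‖ξ k ω‖) ∂P ≤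
        ∫⁻ ω, ENNReal.ofReal (‖stepSum D ξ n ω‖ ^ p) ∂P := by
    intro n
    induction n with
    | zero => simp
    | succ n ih =>
      have e := h.lintegral_step n (G := fun q => ENNReal.ofReal (q.2 ^ p)) (by fun_prop)
        (w := fun _ => 0) measurable_const
      simp only at e
      rw [e]
      refine le_trans ?_ (lintegral_mono fun ω =>
        rpow_norm_add_gain_le_lintegral hp1 hp2 (h.c_le n) (stepSum D ξ n ω) (ξ n ω))
      have h1 := h.measurable_norm_stepSum' n
      have h2 : Measurable (fun ω =>
          ∑ k ∈ Finset.range n, c k * gain p ‖stepSum D ξ k ω‖ ‖ξ k ω‖) :=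
        Finset.measurable_fun_sum _ fun l _ => (measurable_gain₂ (h.measurable_norm_stepSum' l)
          (h.measurable_norm' l)).const_mul _
      rw [lintegral_add_left (by fun_prop), lintegral_const_mul' _ _ ENNReal.ofReal_ne_top]
      refine le_trans ?_ (add_le_add_left ih _)
      rw [← mul_add, ← lintegral_add_left (by fun_prop)]
      gcongr with ω
      rw [← ENNReal.ofReal_add (Finset.sum_nonneg fun k _ =>
        mul_nonneg (c k).coe_nonneg (gain_nonneg (norm_nonneg _)))
        (mul_nonneg (c n).coe_nonneg (gain_nonneg (norm_nonneg _))), Finset.sum_range_succ]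
  refine le_trans ?_ (key n)
  gcongr with ω k hk
  exact gain_anti hp2.le (norm_nonneg _)
    (norm_stepSum_le_stepMax D ξ (Finset.mem_range.1 hk).le ω)

/-- The `p`-th power of a predictable majorant, defined recursively. -/
noncomputable def predMajorant (p : ℝ) (c : ℕ → ℝ≥0) (x : ℕ → ℝ) : ℕ → ℝ
  | 0 => 0
  | n + 1 => predMajorant p c x n + c n * gain p (predMajorant p c x n ^ p⁻¹) (x n)

theorem predMajorant_nonneg {p : ℝ} {x : ℕ → ℝ} (hx : ∀ k, 0 ≤ x k) (n : ℕ) :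
    0 ≤ predMajorant p c x n := by
  induction n with
  | zero => exact le_rfl
  | succ n ih => exact add_nonneg ih (mul_nonneg (c n).coe_nonneg (gain_nonneg (hx n)))

theorem measurable_predMajorant {p : ℝ} {α : Type*} {_ : MeasurableSpace α} {x : ℕ → α → ℝ} {n : ℕ}
    (hx : ∀ k < n, Measurable (x k)) :
    Measurable (fun a => predMajorant p c (fun k => x k a) n) := by
  induction n with
  | zero => exact measurable_const
  | succ n ih =>
    have h1 := ih fun k hk => hx k (by omega)
    exact h1.add ((measurable_gain₂ (h1.pow_const _) (hx n (by omega))).const_mul _)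

/-- Once the majorant exceeds `s ^ p`, its increments are at most those at the fixed level `s`.
Before that, an increment with `x n ≤ s` is at most `s ^ p / 2` because `c n ≤ 1 / 2`, so the
overshoot stays below `2 * s ^ p`; one with `x n ≥ s` is at most `c n * x n ^ p`, which is the
increment at level `s`. -/
theorem predMajorant_le {p s : ℝ} (hp1 : 1 < p) (hp2 : p < 2) (hs : 0 < s) {x : ℕ → ℝ}
    (hx : ∀ k, 0 ≤ x k) (hc : ∀ k, (c k : ℝ) ≤ 1 / 2) (n : ℕ) :
    predMajorant p c x n ≤ 2 * s ^ p + ∑ k ∈ Finset.range n, c k * gain p s (x k) := by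
  have hsp : 0 < s ^ p := by positivity
  induction n with
  | zero => simp only [predMajorant, Finset.range_zero, Finset.sum_empty]; positivity
  | succ n ih =>
    have hL := predMajorant_nonneg (p := p) (c := c) hx n
    have hg : ∀ k, 0 ≤ c k * gain p s (x k) := fun k =>
      mul_nonneg (c k).coe_nonneg (gain_nonneg (hx k))
    have hG : 0 ≤ ∑ k ∈ Finset.range n, c k * gain p s (x k) := Finset.sum_nonneg fun k _ => hg k
    rw [predMajorant, Finset.sum_range_succ]
    rcases le_total (predMajorant p c x n) (s ^ p) with h | h
    · have h1 := gain_le_rpow (R := predMajorant p c x n ^ p⁻¹) (by linarith : 0 < p) hp2.le (hx n)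
      have h2 := mul_le_mul_of_nonneg_left h1 (c n).coe_nonneg
      rcases le_total (x n) s with h3 | h3
      · have h4 : x n ^ p ≤ s ^ p := Real.rpow_le_rpow (hx n) h3 (by linarith)
        have h5 : c n * x n ^ p ≤ 1 / 2 * s ^ p :=
          mul_le_mul (hc n) h4 (Real.rpow_nonneg (hx n) _) (by norm_num)
        linarith [hg n]
      · rw [gain_of_le (by linarith : 0 < p) (hx n) h3]
        linarith
    · have h1 : s ≤ predMajorant p c x n ^ p⁻¹ := by
        rw [Real.le_rpow_inv_iff_of_pos hs.le hL (by linarith)]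
        exact h
      have h2 := mul_le_mul_of_nonneg_left (gain_anti (p := p) hp2.le (hx n) h1) (c n).coe_nonneg
      linarith

/-- Let `L` be the majorant and `Λ = L ^ (1 / p)`. The quantity `(‖M‖ ^ 2 + Λ ^ 2) ^ (p / 2)` grows
in mean by at most a constant times the increment of `L`: first the level is raised, then the
martingale moves. The new level is predictable, so it can be used during the move. -/
theorem exists_lintegral_stepSum_le_of_lt_two {p : ℝ} (hp1 : 1 < p) (hp2 : p < 2) : ∃ C : ℝ≥0,
    ∀ {Ω : Type uΩ} [MeasurableSpace Ω] {H : Type uH} [NormedAddCommGroup H]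
      [InnerProductSpace ℝ H] {P : Measure Ω} [IsProbabilityMeasure P] {𝒢 : ℕ → MeasurableSpace Ω}
      {c : ℕ → ℝ≥0} {D : ℕ → Ω → ℝ} {ξ : ℕ → Ω → H}, IsPoissonSteps P 𝒢 c D ξ → ∀ n : ℕ,
      ∫⁻ ω, ENNReal.ofReal (‖stepSum D ξ n ω‖ ^ p) ∂P ≤
        C * ∫⁻ ω, ENNReal.ofReal (predMajorant p c (fun k => ‖ξ k ω‖) n) ∂P := by
  obtain ⟨C, hstep⟩ := exists_lintegral_sqrt_norm_add_le.{uH} hp1 hp2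
  refine ⟨1 + C, ?_⟩
  intro Ω _ H _ _ P _ 𝒢 c D ξ h n
  set L : ℕ → Ω → ℝ := fun k ω => predMajorant p c (fun k => ‖ξ k ω‖) k with hL
  have hL0 : ∀ k ω, 0 ≤ L k ω := fun k ω => predMajorant_nonneg (fun _ => norm_nonneg _) k
  have hLm : ∀ k, Measurable (L k) := fun k =>
    measurable_predMajorant (x := fun k ω => ‖ξ k ω‖) fun l _ => h.measurable_norm' l
  have hMm := h.measurable_norm_stepSum'
  have hΛ : ∀ k ω, 0 ≤ L k ω ^ p⁻¹ := fun k ω => Real.rpow_nonneg (hL0 k ω) _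
  have key : ∀ k, ∫⁻ ω, ENNReal.ofReal ((‖stepSum D ξ k ω‖ ^ 2 + (L k ω ^ p⁻¹) ^ 2) ^ (p / 2)) ∂P ≤
      (1 + C : ℝ≥0) * ∫⁻ ω, ENNReal.ofReal (L k ω) ∂P := by
    intro k
    induction k with
    | zero =>
      have h0 : p⁻¹ ≠ 0 := inv_ne_zero (by linarith)
      simp [hL, predMajorant, stepSum, Real.zero_rpow h0, Real.zero_rpow (by linarith : p / 2 ≠ 0)]
    | succ k ih =>
      have e := h.lintegral_step k (w := L (k + 1))
        (G := fun q => ENNReal.ofReal ((q.2 ^ 2 + (q.1 ^ p⁻¹) ^ 2) ^ (p / 2))) (by fun_prop)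
        (measurable_predMajorant (x := fun k ω => ‖ξ k ω‖) fun l hl =>
          h.measurable_norm (Nat.lt_succ_iff.1 hl))
      simp only at e
      rw [e]
      have hsucc : ∀ ω, L (k + 1) ω = L k ω + c k * gain p (L k ω ^ p⁻¹) ‖ξ k ω‖ := fun ω => rfl
      have hδ : ∀ ω, 0 ≤ c k * gain p (L k ω ^ p⁻¹) ‖ξ k ω‖ := fun ω =>
        mul_nonneg (c k).coe_nonneg (gain_nonneg (norm_nonneg _))
      have hle : ∀ ω, L k ω ^ p⁻¹ ≤ L (k + 1) ω ^ p⁻¹ := fun ω => by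
        refine Real.rpow_le_rpow (hL0 k ω) ?_ (by positivity)
        rw [hsucc]; linarith [hδ ω]
      have e2 : ∀ j ω, ((L j ω ^ p⁻¹) ^ 2) ^ (p / 2) = L j ω := by
        intro j ω
        rw [← Real.rpow_natCast, ← Real.rpow_mul (hΛ j ω), ← Real.rpow_mul (hL0 j ω)]
        have : p⁻¹ * ((2 : ℕ) * (p / 2)) = 1 := by push_cast; field_simp
        rw [this, Real.rpow_one]
      -- Raising the level with `M` fixed: by concavity of `t ^ (p / 2)` this costs no more than it
      -- would at `M = 0`, namely the increment of `L`.
      have h1 : ∀ ω, (‖stepSum D ξ k ω‖ ^ 2 + (L (k + 1) ω ^ p⁻¹) ^ 2) ^ (p / 2) ≤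
          (‖stepSum D ξ k ω‖ ^ 2 + (L k ω ^ p⁻¹) ^ 2) ^ (p / 2) +
            c k * gain p (L k ω ^ p⁻¹) ‖ξ k ω‖ := by
        intro ω
        have hsq : (L k ω ^ p⁻¹) ^ 2 ≤ (L (k + 1) ω ^ p⁻¹) ^ 2 := pow_le_pow_left₀ (hΛ k ω) (hle ω) 2
        have := rpow_add_rpow_le_of_add_eq (q := p / 2) (u := (L k ω ^ p⁻¹) ^ 2)
          (v := ‖stepSum D ξ k ω‖ ^ 2 + (L k ω ^ p⁻¹) ^ 2) (w := (L (k + 1) ω ^ p⁻¹) ^ 2)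
          (z := ‖stepSum D ξ k ω‖ ^ 2 + (L (k + 1) ω ^ p⁻¹) ^ 2) (by linarith) (by linarith)
          (by positivity) (by linarith [sq_nonneg ‖stepSum D ξ k ω‖]) hsq (by ring)
        rw [e2, e2, hsucc] at this
        rw [hsucc]
        linarith
      have h2 : ∀ ω, ∫⁻ z, ENNReal.ofReal ((‖stepSum D ξ k ω + z • ξ k ω‖ ^ 2 +
          (L (k + 1) ω ^ p⁻¹) ^ 2) ^ (p / 2)) ∂compPoisson (c k) ≤
          ENNReal.ofReal ((‖stepSum D ξ k ω‖ ^ 2 + (L k ω ^ p⁻¹) ^ 2) ^ (p / 2)) +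
            (1 + C : ℝ≥0) * ENNReal.ofReal (c k * gain p (L k ω ^ p⁻¹) ‖ξ k ω‖) := by
        intro ω
        refine (hstep (c k) (h.c_le k) _ (hΛ (k + 1) ω) _ _).trans ?_
        have h3 := ENNReal.ofReal_le_ofReal (h1 ω)
        rw [ENNReal.ofReal_add (by positivity) (hδ ω)] at h3
        refine (add_le_add_left h3 _).trans ?_
        push_cast
        rw [add_mul, one_mul, add_assoc]
        gcongr
        exact gain_anti hp2.le (norm_nonneg _) (hle ω)
      refine (lintegral_mono h2).trans ?_
      have hm1 := hMm k
      have hm2 := hLm k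
      rw [lintegral_add_left (by fun_prop), lintegral_const_mul' _ _ ENNReal.coe_ne_top]
      refine (add_le_add_left ih _).trans ?_
      rw [← mul_add, ← lintegral_add_left (by fun_prop)]
      gcongr with ω
      rw [← ENNReal.ofReal_add (hL0 k ω) (hδ ω), hsucc]
  refine le_trans (lintegral_mono fun ω => ENNReal.ofReal_le_ofReal ?_) (key n)
  have e3 : ‖stepSum D ξ n ω‖ ^ p = (‖stepSum D ξ n ω‖ ^ 2) ^ (p / 2) := by
    rw [← Real.rpow_natCast, ← Real.rpow_mul (norm_nonneg _)]; congr 1; push_cast; ring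
  rw [e3]
  refine Real.rpow_le_rpow (sq_nonneg _) ?_ (by linarith)
  linarith [sq_nonneg (L n ω ^ p⁻¹)]

end StepInequalities

/-! ### Independence properties of Poisson random measures -/

section Independence

set_option linter.unusedSectionVars false

variable {Ω : Type*} [MeasurableSpace Ω] {E : Type*} [MeasurableSpace E]

/-- The `σ`-algebra generated by the random variables `N(B)` with `B ⊆ C`. -/
@[reducible] def pastAlgebra (N : Ω → Measure E) (C : Set E) : MeasurableSpace Ω :=
  ⨆ (B : {B : Set E // MeasurableSet B ∧ B ⊆ C}),
    MeasurableSpace.comap (fun ω => N ω B.1) inferInstance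

theorem measurable_pastAlgebra (N : Ω → Measure E) {C B : Set E} (hB : MeasurableSet B)
    (h : B ⊆ C) : Measurable[pastAlgebra N C] (fun ω => N ω B) :=
  Measurable.mono (comap_measurable _)
    (le_iSup (fun B : {B : Set E // MeasurableSet B ∧ B ⊆ C} =>
      MeasurableSpace.comap (fun ω => N ω B.1) inferInstance) ⟨B, hB, h⟩) le_rfl

theorem pastAlgebra_mono (N : Ω → Measure E) {C C' : Set E} (h : C ⊆ C') :
    pastAlgebra N C ≤ pastAlgebra N C' :=
  iSup_le fun B => (measurable_pastAlgebra N B.2.1 (B.2.2.trans h)).comap_le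

variable {P : Measure Ω} {N : Ω → Measure E} {μ : Measure E}

theorem IsPoissonRandomMeasure.pastAlgebra_le (hN : IsPoissonRandomMeasure P N μ) (C : Set E) :
    pastAlgebra N C ≤ ‹MeasurableSpace Ω› :=
  iSup_le fun B => (hN.measurable B.1 B.2.1).comap_le

theorem IsPoissonRandomMeasure.iIndepFun (hN : IsPoissonRandomMeasure P N μ) {κ : Type*}
    [Fintype κ] {B : κ → Set E} (hB : ∀ i, MeasurableSet (B i))
    (hd : Pairwise (fun i j => Disjoint (B i) (B j))) :
    iIndepFun (fun (i : κ) (ω : Ω) => N ω (B i)) P := by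
  have e := Fintype.equivFin κ
  have := hN.indep _ (fun i => B (e.symm i)) (fun i => hB _)
    (fun i j hij => hd (e.symm.injective.ne hij))
  have h2 := this.precomp e.injective
  simpa [Function.comp_def] using h2

/-- Independence is given only for disjoint sets, whereas the past is generated by overlapping ones.
For finitely many generators one passes to the atoms of the generated set algebra, of which each
`N(b)` is a sum; the general case is a directed union. -/
theorem IsPoissonRandomMeasure.indep_pastAlgebra [IsProbabilityMeasure P]
    (hN : IsPoissonRandomMeasure P N μ) {C B : Set E} (hB : MeasurableSet B)
    (h : Disjoint B C) :
    Indep (pastAlgebra N C) (MeasurableSpace.comap (fun ω => N ω B) inferInstance) P := by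
  classical
  set σ := {B : Set E // MeasurableSet B ∧ B ⊆ C}
  have e : pastAlgebra N C = ⨆ T : Finset σ, ⨆ b ∈ T,
      MeasurableSpace.comap (fun ω => N ω b.1) inferInstance :=
    iSup_eq_iSup_finset _
  rw [e]
  refine indep_iSup_of_directed_le (fun T => ?_) (fun T => ?_) (hN.measurable B hB).comap_le ?_
  -- An atom is indexed by the members of `T` containing it. The empty index is excluded, since its
  -- atom would not lie in `C`.
  · let κ := {U : Finset σ // U ∈ T.powerset ∧ U.Nonempty}
    have : Finite κ := Finite.of_injective (fun U : κ => (⟨U.1, U.2.1⟩ : {U // U ∈ T.powerset}))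
      fun U U' hU => Subtype.ext (congrArg (fun V : {U // U ∈ T.powerset} => V.1) hU)
    let _ : Fintype κ := Fintype.ofFinite κ
    let at' : κ → Set E := fun U => {z | ∀ b ∈ T, z ∈ b.1 ↔ b ∈ U.1}
    have hat : ∀ U, MeasurableSet (at' U) := fun U => by
      have : at' U = ⋂ b ∈ T, {z | z ∈ b.1 ↔ b ∈ U.1} := by
        ext z; simp [at']
      rw [this]
      refine Finset.measurableSet_biInter _ fun b _ => ?_
      by_cases hb : b ∈ U.1
      · simpa [hb] using b.2.1
      · have e : {z | z ∈ b.1 ↔ b ∈ U.1} = b.1ᶜ := by ext z; simp [hb]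
        rw [e]
        exact b.2.1.compl
    let B' : Option κ → Set E := fun o => o.elim B at'
    have hB' : ∀ o, MeasurableSet (B' o) := fun o => by
      cases o with
      | none => exact hB
      | some U => exact hat U
    have hatC : ∀ U, at' U ⊆ C := fun U z hz => by
      obtain ⟨b, hb⟩ := U.2.2
      exact b.2.2 ((hz b (Finset.mem_powerset.1 U.2.1 hb)).2 hb)
    have hatd : ∀ U U', U ≠ U' → Disjoint (at' U) (at' U') := fun U U' hne => by
      rw [Set.disjoint_left]
      intro z hz hz'
      apply hne
      apply Subtype.ext
      ext b
      constructor
      · intro hb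
        have hbT := Finset.mem_powerset.1 U.2.1 hb
        exact (hz' b hbT).1 ((hz b hbT).2 hb)
      · intro hb
        have hbT := Finset.mem_powerset.1 U'.2.1 hb
        exact (hz b hbT).1 ((hz' b hbT).2 hb)
    have hd : Pairwise (fun i j => Disjoint (B' i) (B' j)) := by
      intro i j hij
      cases i with
      | none =>
        cases j with
        | none => exact absurd rfl hij
        | some U => exact h.mono_right (hatC U)
      | some U =>
        cases j with
        | none => exact (h.mono_right (hatC U)).symm
        | some U' => exact hatd U U' fun h' => hij (by rw [h'])
    have hi := (hN.iIndepFun hB' hd).iIndep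
    have hle : ∀ o, MeasurableSpace.comap (fun ω => N ω (B' o)) inferInstance ≤
        ‹MeasurableSpace Ω› := fun o => (hN.measurable _ (hB' o)).comap_le
    have hI := indep_iSup_of_disjoint hle hi (S := {o | o ≠ none}) (T := {none}) (by simp)
    refine indep_of_indep_of_le hI ?_ ?_
    · refine iSup₂_le fun b hb => Measurable.comap_le ?_
      have hu : b.1 = ⋃ U ∈ (Finset.univ.filter fun U : κ => b ∈ U.1), at' U := by
        ext z
        simp only [Finset.mem_filter, Finset.mem_univ, true_and, mem_iUnion, exists_prop]
        constructor
        · intro hz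
          refine ⟨⟨T.filter fun b => z ∈ b.1, by simp, ⟨b, by simp [hb, hz]⟩⟩, by simp [hb, hz], ?_⟩
          intro b' hb'
          simp [hb']
        · rintro ⟨U, hU, hz⟩
          exact (hz b hb).2 hU
      have hs : ∀ ω, N ω b.1 = ∑ U ∈ (Finset.univ.filter fun U : κ => b ∈ U.1), N ω (at' U) := by
        intro ω
        conv_lhs => rw [hu]
        exact measure_biUnion_finset (fun U _ U' _ hne => hatd U U' hne) fun U _ => hat U
      simp_rw [hs]
      refine Finset.measurable_fun_sum _ fun U _ => ?_
      refine Measurable.mono (comap_measurable _) ?_ le_rfl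
      exact le_iSup₂ (f := fun (o : Option κ) (_ : o ∈ {o | o ≠ none}) =>
        MeasurableSpace.comap (fun ω => N ω (B' o)) inferInstance) (some U) (by simp)
    · exact le_iSup₂ (f := fun (o : Option κ) (_ : o ∈ ({none} : Set (Option κ))) =>
        MeasurableSpace.comap (fun ω => N ω (B' o)) inferInstance) none rfl
  · exact iSup₂_le fun b _ => (hN.measurable b.1 b.2.1).comap_le
  · intro T T'
    exact ⟨T ∪ T', biSup_mono fun b hb => Finset.mem_union_left _ hb,
      biSup_mono fun b hb => Finset.mem_union_right _ hb⟩

theorem IsPoissonRandomMeasure.ae_lt_top (hN : IsPoissonRandomMeasure P N μ) {B : Set E}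
    (hB : MeasurableSet B) (h : μ B ≠ ∞) : ∀ᵐ ω ∂P, N ω B < ∞ :=
  MeasureTheory.ae_lt_top (hN.measurable B hB) (by rwa [hN.intensity B hB])

theorem IsPoissonRandomMeasure.map_compensated (hN : IsPoissonRandomMeasure P N μ) {B : Set E}
    (hB : MeasurableSet B) (h : μ B ≠ ∞) :
    P.map (compensated N μ B) = compPoisson (μ B).toNNReal := by
  have hg : Measurable (fun x : ℝ≥0∞ => x.toReal - (μ B).toReal) := by fun_prop
  have : compensated N μ B = (fun x : ℝ≥0∞ => x.toReal - (μ B).toReal) ∘ fun ω => N ω B := rfl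
  rw [this, ← Measure.map_map hg (hN.measurable B hB), hN.poisson B hB h,
    Measure.map_map hg .of_discrete, compPoisson]
  congr 1

theorem measurable_compensated {m : MeasurableSpace Ω} {B : Set E}
    (h : Measurable (fun ω => N ω B)) : Measurable (compensated N μ B) :=
  h.ennreal_toReal.sub_const _

theorem compensated_biUnion {κ : Type*} {I : Finset κ} {B : κ → Set E}
    (hB : ∀ k, MeasurableSet (B k)) (hd : (I : Set κ).PairwiseDisjoint B)
    (hμ : ∀ k ∈ I, μ (B k) ≠ ∞) {ω : Ω} (hω : ∀ k ∈ I, N ω (B k) < ∞) :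
    compensated N μ (⋃ k ∈ I, B k) ω = ∑ k ∈ I, compensated N μ (B k) ω := by
  simp only [compensated]
  rw [measure_biUnion_finset hd fun k _ => hB k, measure_biUnion_finset hd fun k _ => hB k,
    ENNReal.toReal_sum hμ, ENNReal.toReal_sum fun k hk => (hω k hk).ne, Finset.sum_sub_distrib]

end Independence

/-! ### Time grids -/

/-- The prescribed times are merged with the multiples of `δ` up to a bound for them; the increasing
enumeration of this finite set is continued by its last value. -/
theorem exists_grid (T : Finset ℝ≥0) {δ : ℝ≥0} (hδ : 0 < δ) : ∃ (L : ℕ) (s : ℕ → ℝ≥0),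
    Monotone s ∧ s 0 = 0 ∧ (∀ t ∈ T, ∃ i ≤ L, s i = t) ∧ ∀ i, s (i + 1) ≤ s i + δ := by
  classical
  obtain ⟨M, hM⟩ : ∃ M : ℕ, ∀ t ∈ T, t ≤ δ * M := by
    obtain ⟨M, hM⟩ := exists_nat_ge ((∑ t ∈ T, t) / δ)
    refine ⟨M, fun t ht => ?_⟩
    rw [div_le_iff₀ hδ, mul_comm] at hM
    exact (Finset.single_le_sum (f := fun t : ℝ≥0 => t) (fun _ _ => zero_le) ht).trans hM
  set S : Finset ℝ≥0 := T ∪ (Finset.range (M + 1)).image (fun j : ℕ => δ * j) with hS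
  have hS0 : (0 : ℝ≥0) ∈ S := Finset.mem_union_right _ (Finset.mem_image.2 ⟨0, by simp, by simp⟩)
  have hSM : ∀ t ∈ S, t ≤ δ * M := by
    intro t ht
    rcases Finset.mem_union.1 ht with h | h
    · exact hM t h
    · obtain ⟨j, hj, rfl⟩ := Finset.mem_image.1 h
      have : j ≤ M := by simpa [Nat.lt_succ_iff] using hj
      gcongr
  have hc : 0 < S.card := Finset.card_pos.2 ⟨0, hS0⟩
  set f := S.orderEmbOfFin rfl with hf
  have hfr : ∀ t ∈ S, ∃ i, f i = t := fun t ht => by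
    have : t ∈ Set.range f := by rw [hf, Finset.range_orderEmbOfFin]; exact ht
    exact this
  refine ⟨S.card - 1, fun i => f ⟨min i (S.card - 1), by omega⟩, ?_, ?_, ?_, ?_⟩
  · intro i j hij
    exact f.monotone (Fin.mk_le_mk.2 (by omega))
  · obtain ⟨i, hi⟩ := hfr 0 hS0
    refine le_antisymm ?_ zero_le
    rw [← hi]
    exact f.monotone (Fin.mk_le_of_le_val (by simp))
  · intro t ht
    obtain ⟨i, hi⟩ := hfr t (Finset.mem_union_left _ ht)
    refine ⟨i, by omega, ?_⟩
    rw [← hi]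
    exact congrArg f (Fin.ext (by simp only; omega))
  · intro i
    by_contra! hlt
    have hi : i + 1 ≤ S.card - 1 := by
      by_contra! h
      have e : min (i + 1) (S.card - 1) = min i (S.card - 1) := by omega
      simp only [e] at hlt
      exact absurd hlt (not_lt.2 le_self_add)
    set x := f ⟨min i (S.card - 1), by omega⟩ with hx
    set y := f ⟨min (i + 1) (S.card - 1), by omega⟩ with hy
    -- If a gap exceeded `δ`, the first multiple of `δ` beyond `x` would be a grid point strictly
    -- between two consecutive ones.
    set j := ⌊x / δ⌋₊ + 1 with hj
    have h1 : x < δ * j := by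
      have := Nat.lt_floor_add_one (x / δ)
      rw [div_lt_iff₀ hδ, mul_comm] at this
      rw [hj]; push_cast; exact this
    have h2 : δ * j ≤ x + δ := by
      have := Nat.floor_le (zero_le : 0 ≤ x / δ)
      rw [le_div_iff₀ hδ, mul_comm] at this
      rw [hj]; push_cast; rw [mul_add, mul_one]; gcongr
    have h3 : δ * j < y := h2.trans_lt hlt
    have h4 : y ≤ δ * M := hSM y (Finset.orderEmbOfFin_mem S rfl _)
    have h5 : j ≤ M := by
      have := h3.trans_le h4
      have := lt_of_mul_lt_mul_left this zero_le
      exact_mod_cast this.le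
    obtain ⟨k, hk⟩ := hfr (δ * j) (Finset.mem_union_right _
      (Finset.mem_image.2 ⟨j, by simpa [Nat.lt_succ_iff] using h5, rfl⟩))
    rw [← hk] at h1 h3
    have h6 := f.lt_iff_lt.1 h1
    have h7 := f.lt_iff_lt.1 h3
    rw [Fin.lt_def] at h6 h7
    simp only at h6 h7
    omega

/-! ### Elementary processes -/

section Elementary

set_option linter.unusedSectionVars false

/-- At most one summand is nonzero at `z`, so any map fixing zero passes through the sum. -/
theorem comp_sum_indicator_of_disjoint {κ E F G : Type*} [AddCommMonoid F] [AddCommMonoid G]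
    (I : Finset κ) {C : κ → Set E} (hd : (I : Set κ).PairwiseDisjoint C) (v : κ → F) (g : F → G)
    (hg : g 0 = 0) (z : E) :
    g (∑ k ∈ I, (C k).indicator (fun _ => v k) z) = ∑ k ∈ I, (C k).indicator (fun _ => g (v k)) z := by
  by_cases h : ∃ k ∈ I, z ∈ C k
  · obtain ⟨k, hk, hz⟩ := h
    have hne : ∀ l ∈ I, l ≠ k → z ∉ C l := fun l hl hlk hzl =>
      Set.disjoint_left.1 (hd hl hk hlk) hzl hz
    rw [Finset.sum_eq_single_of_mem k hk fun l hl hlk => indicator_of_notMem (hne l hl hlk) _,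
      Finset.sum_eq_single_of_mem k hk fun l hl hlk => indicator_of_notMem (hne l hl hlk) _,
      indicator_of_mem hz, indicator_of_mem hz]
  · push Not at h
    rw [Finset.sum_eq_zero fun l hl => indicator_of_notMem (h l hl) _,
      Finset.sum_eq_zero fun l hl => indicator_of_notMem (h l hl) _, hg]

variable {Ω : Type uΩ} [MeasurableSpace Ω] {J : Type uJ} [MeasurableSpace J]
  {H : Type uH} [NormedAddCommGroup H] [InnerProductSpace ℝ H] {ι : Type*} [Fintype ι]

/-- Data of an elementary process `∑ₐ 1_{(sₐ, uₐ]} 1_{Aₐ} ζₐ` with bounded coefficients `ζₐ`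
measurable with respect to `𝓕_{sₐ}`. -/
structure IsElementary (ν : Measure J) (N : Ω → Measure (ℝ≥0 × J)) (s : ι → ℝ≥0)
    (A : ι → Set J) (ζ : ι → Ω → H) : Prop where
  A_meas : ∀ a, MeasurableSet (A a)
  A_fin : ∀ a, ν (A a) < ∞
  meas : ∀ a, StronglyMeasurable[natFiltration N (s a)] (ζ a)
  bdd : ∃ K, ∀ a ω, ‖ζ a ω‖ ≤ K

/-- The process `∑ₐ 1_{(sₐ, uₐ]} 1_{Aₐ} ζₐ`. -/
noncomputable def elemProc (s u : ι → ℝ≥0) (A : ι → Set J) (ζ : ι → Ω → H) (ω : Ω)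
    (z : ℝ≥0 × J) : H :=
  ∑ a, (Ioc (s a) (u a) ×ˢ A a).indicator (fun _ => ζ a ω) z

/-- The stochastic integral over `(0, t]` of an elementary process. -/
noncomputable def elemInt (ν : Measure J) (N : Ω → Measure (ℝ≥0 × J)) (s u : ι → ℝ≥0)
    (A : ι → Set J) (ζ : ι → Ω → H) (t : ℝ≥0) (ω : Ω) : H :=
  ∑ a, compensated N (timeMeasure.prod ν) (Ioc (min (s a) t) (min (u a) t) ×ˢ A a) ω • ζ a ω

theorem natFiltration_le_pastAlgebra (N : Ω → Measure (ℝ≥0 × J)) (t : ℝ≥0) :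
    natFiltration N t ≤ pastAlgebra N (Ioc 0 t ×ˢ univ) := by
  refine iSup_le fun s => iSup_le fun u => iSup_le fun A => iSup_le fun _ => iSup_le fun hu =>
    iSup_le fun hA => (measurable_pastAlgebra N (measurableSet_Ioc.prod hA) ?_).comap_le
  exact prod_mono (Ioc_subset_Ioc zero_le hu) (subset_univ _)

theorem timeMeasure_prod_Ioc (ν : Measure J) [SigmaFinite ν] (a b : ℝ≥0) (A : Set J) :
    (timeMeasure.prod ν) (Ioc a b ×ˢ A) = ENNReal.ofReal ((b : ℝ) - a) * ν A := by
  rw [Measure.prod_prod, timeMeasure_Ioc]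

/-- The atoms generated by finitely many sets. -/
def atom (A : ι → Set J) (U : Finset ι) : Set J := {x | U.Nonempty ∧ ∀ a, x ∈ A a ↔ a ∈ U}

theorem measurableSet_atom {A : ι → Set J} (hA : ∀ a, MeasurableSet (A a)) (U : Finset ι) :
    MeasurableSet (atom A U) := by
  classical
  have : atom A U = {_x | U.Nonempty} ∩ ⋂ a, (if a ∈ U then A a else (A a)ᶜ) := by
    ext x
    simp only [atom, mem_ofPred_eq, mem_inter_iff, mem_iInter]
    refine and_congr_right fun _ => forall_congr' fun a => ?_
    by_cases h : a ∈ U <;> simp [h]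
  rw [this]
  refine (MeasurableSet.const _).inter (MeasurableSet.iInter fun a => ?_)
  split_ifs
  · exact hA a
  · exact (hA a).compl

theorem disjoint_atom (A : ι → Set J) {U U' : Finset ι} (h : U ≠ U') :
    Disjoint (atom A U) (atom A U') := by
  rw [Set.disjoint_left]
  rintro x ⟨_, h1⟩ ⟨_, h2⟩
  exact h (Finset.ext fun a => (h1 a).symm.trans (h2 a))

theorem atom_subset {A : ι → Set J} {U : Finset ι} {a : ι} (ha : a ∈ U) : atom A U ⊆ A a :=
  fun _ hx => (hx.2 a).2 ha

theorem elemInt_eq_of_le {ν : Measure J} {N : Ω → Measure (ℝ≥0 × J)} {s u : ι → ℝ≥0}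
    {A : ι → Set J} {ζ : ι → Ω → H} {t t' : ℝ≥0} (ht : ∀ a, u a ≤ t) (ht' : ∀ a, u a ≤ t') :
    elemInt ν N s u A ζ t = elemInt ν N s u A ζ t' := by
  have e : ∀ {t}, (∀ a, u a ≤ t) → ∀ a, Ioc (min (s a) t) (min (u a) t) = Ioc (s a) (u a) := by
    intro t ht a
    rw [min_eq_left (ht a)]
    ext τ
    simp only [mem_Ioc, min_lt_iff]
    exact ⟨fun h => ⟨h.1.resolve_right (not_lt.2 (h.2.trans (ht a))), h.2⟩,
      fun h => ⟨Or.inl h.1, h.2⟩⟩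
  funext ω
  simp only [elemInt, e ht, e ht']

/-- Cells are products of a grid interval with an atom of the sets `A a`, enumerated time interval
by time interval. Within one interval the earlier cells belong to the past, which is harmless since
disjoint cells are independent and the coefficients depend only on times up to the left endpoint.
The three conclusions transfer the norms, the values at prescribed times and the terminal value to
the discrete sum. -/
theorem exists_steps {P : Measure Ω} [IsProbabilityMeasure P] {ν : Measure J} [SigmaFinite ν]
    {N : Ω → Measure (ℝ≥0 × J)} (hN : IsPoissonRandomMeasure P N (timeMeasure.prod ν))
    {s u : ι → ℝ≥0} {A : ι → Set J} {ζ : ι → Ω → H} (h : IsElementary ν N s A ζ)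
    (T : Finset ℝ≥0) : ∃ (n : ℕ) (𝒢 : ℕ → MeasurableSpace Ω) (c : ℕ → ℝ≥0) (D : ℕ → Ω → ℝ)
      (ξ : ℕ → Ω → H), IsPoissonSteps P 𝒢 c D ξ ∧
      (∀ g : H → ℝ≥0∞, g 0 = 0 → ∀ ω, ∫⁻ z, g (elemProc s u A ζ ω z) ∂(timeMeasure.prod ν) =
        ∑ k ∈ Finset.range n, c k * g (ξ k ω)) ∧
      (∀ t ∈ T, ∃ k ≤ n, ∀ᵐ ω ∂P, elemInt ν N s u A ζ t ω = stepSum D ξ k ω) ∧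
      (∀ t, (∀ a, u a ≤ t) → ∀ᵐ ω ∂P, elemInt ν N s u A ζ t ω = stepSum D ξ n ω) := by
  classical
  set V : ℝ≥0 := ∑ a, (ν (A a)).toNNReal with hV
  have hVa : ∀ a, ν (A a) ≤ V := fun a => by
    rw [← ENNReal.coe_toNNReal (h.A_fin a).ne]
    exact_mod_cast Finset.single_le_sum (f := fun a => (ν (A a)).toNNReal) (fun _ _ => zero_le)
      (Finset.mem_univ a)
  -- `V` bounds the measure of every atom, so a mesh of this size gives cells of intensity at most
  -- `1 / 2`; the added `1` covers `V = 0`.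
  set δ : ℝ≥0 := 1 / (2 * (V + 1)) with hδ
  have hδ0 : 0 < δ := by positivity
  have hδV : δ * V ≤ 1 / 2 := by
    rw [hδ, ← NNReal.coe_le_coe]
    push_cast
    rw [div_mul_eq_mul_div, div_le_div_iff₀ (by positivity) (by norm_num)]
    linarith [V.coe_nonneg]
  obtain ⟨L, σ, hσm, hσ0, hσT, hσδ⟩ :=
    exists_grid (T ∪ Finset.univ.image s ∪ Finset.univ.image u) hδ0
  have hσs : ∀ a, ∃ i ≤ L, σ i = s a := fun a => hσT _ (by simp)
  have hσu : ∀ a, ∃ i ≤ L, σ i = u a := fun a => hσT _ (by simp)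
  set m := Fintype.card (Finset ι) with hm
  have hm0 : 0 < m := Fintype.card_pos
  let ε : Finset ι ≃ Fin m := Fintype.equivFin _
  let U : ℕ → Finset ι := fun k => ε.symm ⟨k % m, Nat.mod_lt _ hm0⟩
  let cell : ℕ → Set (ℝ≥0 × J) := fun k => Ioc (σ (k / m)) (σ (k / m + 1)) ×ˢ atom A (U k)
  have hcell : ∀ k, MeasurableSet (cell k) := fun k =>
    measurableSet_Ioc.prod (measurableSet_atom h.A_meas _)
  have hcd : ∀ k l, k ≠ l → Disjoint (cell k) (cell l) := by
    intro k l hkl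
    rw [Set.disjoint_prod]
    rcases lt_trichotomy (k / m) (l / m) with h1 | h1 | h1
    · exact Or.inl (Set.disjoint_left.2 fun τ h2 h3 =>
        absurd (h2.2.trans (hσm (Nat.succ_le_of_lt h1))) (not_le.2 h3.1))
    · refine Or.inr (disjoint_atom A fun hU => hkl ?_)
      have := ε.symm.injective hU
      rw [Fin.mk.injEq] at this
      rw [← Nat.div_add_mod k m, ← Nat.div_add_mod l m, h1, this]
    · exact Or.inl (Set.disjoint_left.2 fun τ h2 h3 =>
        absurd (h3.2.trans (hσm (Nat.succ_le_of_lt h1))) (not_le.2 h2.1))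
  have hμ : ∀ k, (timeMeasure.prod ν) (cell k) ≤ ((1 / 2 : ℝ≥0) : ℝ≥0∞) := by
    intro k
    rw [timeMeasure_prod_Ioc]
    have h1 : ENNReal.ofReal ((σ (k / m + 1) : ℝ) - σ (k / m)) ≤ δ := by
      rw [ENNReal.ofReal_le_iff_le_toReal ENNReal.coe_ne_top, ENNReal.coe_toReal]
      have := hσδ (k / m)
      rw [← NNReal.coe_le_coe] at this
      push_cast at this
      linarith
    have h2 : ν (atom A (U k)) ≤ V := by
      rcases (U k).eq_empty_or_nonempty with h3 | ⟨a, ha⟩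
      · have : atom A (U k) = ∅ := by
          ext x; simp [atom, h3]
        rw [this]; simp
      · exact (measure_mono (atom_subset ha)).trans (hVa a)
    calc _ ≤ (δ : ℝ≥0∞) * V := mul_le_mul' h1 h2
      _ ≤ _ := by exact_mod_cast hδV
  have hμt : ∀ k, (timeMeasure.prod ν) (cell k) ≠ ∞ := fun k =>
    ne_top_of_le_ne_top ENNReal.coe_ne_top (hμ k)
  -- The strip up to the current left endpoint makes the coefficients measurable; the earlier cells
  -- make the previous increments measurable.
  let past : ℕ → Set (ℝ≥0 × J) := fun k =>
    (Ioc 0 (σ (k / m)) ×ˢ univ) ∪ ⋃ l ∈ Finset.range k, cell l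
  have hpast : Monotone past := by
    intro k l hkl
    refine union_subset_union (prod_mono (Ioc_subset_Ioc le_rfl (hσm (Nat.div_le_div_right hkl)))
      le_rfl) (biUnion_subset_biUnion_left fun j hj => ?_)
    exact Finset.mem_range.2 ((Finset.mem_range.1 hj).trans_le hkl)
  have hcp : ∀ k, Disjoint (cell k) (past k) := by
    intro k
    refine Set.disjoint_union_right.2 ⟨Set.disjoint_prod.2 (Or.inl ?_), ?_⟩
    · exact Set.disjoint_left.2 fun τ h2 h3 => absurd h3.2 (not_le.2 h2.1)
    · exact Set.disjoint_iUnion₂_right.2 fun l hl => hcd k l (Finset.mem_range.1 hl).ne'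
  have hcp' : ∀ k, cell k ⊆ past (k + 1) := fun k =>
    (subset_biUnion_of_mem (u := cell) (by simp)).trans subset_union_right
  -- The cells contained in box `a`, up to empty cells; the grid contains all `s a` and `u a`, so no
  -- cell is cut by a box.
  let R : ι → ℕ → Prop := fun a k => s a ≤ σ (k / m) ∧ σ (k / m + 1) ≤ u a ∧ a ∈ U k
  let ξ : ℕ → Ω → H := fun k ω => ∑ a, if R a k then ζ a ω else 0
  have hunion : ∀ i ≤ L, ∀ a, Ioc (min (s a) (σ i)) (min (u a) (σ i)) ×ˢ A a =
      ⋃ k ∈ (Finset.range (i * m)).filter (R a), cell k := by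
    intro i hi a
    obtain ⟨ps, -, hps⟩ := hσs a
    obtain ⟨pu, -, hpu⟩ := hσu a
    ext ⟨τ, x⟩
    simp only [mem_prod, mem_Ioc, mem_iUnion, Finset.mem_filter, Finset.mem_range, exists_prop,
      min_lt_iff, le_min_iff]
    constructor
    · rintro ⟨⟨h1, h2, h3⟩, hx⟩
      have h1 : s a < τ := h1.resolve_right (not_lt.2 h3)
      have hex : ∃ j, τ ≤ σ j := ⟨i, h3⟩
      set j := Nat.find hex with hj
      have hj1 : τ ≤ σ j := Nat.find_spec hex
      have hj0 : j ≠ 0 := fun h0 => by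
        rw [h0, hσ0] at hj1
        exact absurd (zero_le.trans_lt h1) (not_lt.2 hj1)
      obtain ⟨q, hq⟩ := Nat.exists_eq_succ_of_ne_zero hj0
      have hq1 : σ q < τ := not_le.1 (Nat.find_min hex (by omega : q < j))
      have hji : j ≤ i := Nat.find_min' hex h3
      -- The cell containing `(τ, x)` is located by the first grid time not before `τ` and by the
      -- atom `W` of `x`.
      set W : Finset ι := Finset.univ.filter fun b => x ∈ A b with hW
      have hdiv : (q * m + ε W) / m = q := by
        rw [add_comm, Nat.add_mul_div_right _ _ hm0, Nat.div_eq_of_lt (ε W).2, zero_add]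
      have hU : U (q * m + ε W) = W := by
        have : (⟨(q * m + ε W) % m, Nat.mod_lt _ hm0⟩ : Fin m) = ε W := by
          apply Fin.ext
          simp only
          rw [add_comm, Nat.add_mul_mod_self_right, Nat.mod_eq_of_lt (ε W).2]
        simp only [U, this, Equiv.symm_apply_apply]
      refine ⟨q * m + ε W, ⟨?_, ?_, ?_, ?_⟩, ?_⟩
      · calc q * m + ε W < q * m + m := by have := (ε W).2; omega
          _ = (q + 1) * m := by ring
          _ ≤ i * m := Nat.mul_le_mul_right _ (by omega)
      · rw [hdiv, ← hps]
        refine hσm ?_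
        by_contra! hlt
        have := hσm (Nat.succ_le_of_lt hlt)
        rw [← hq, hps] at this
        exact absurd (hj1.trans this) (not_le.2 h1)
      · rw [hdiv, ← hpu]
        refine hσm ?_
        by_contra! hlt
        have := hσm (Nat.lt_succ_iff.1 hlt)
        rw [hpu] at this
        exact absurd (h2.trans this) (not_le.2 hq1)
      · rw [hU]; simp [hW, hx]
      · refine ⟨?_, ?_⟩
        · simp only [hdiv]
          exact ⟨hq1, by rw [← Nat.succ_eq_add_one, ← hq]; exact hj1⟩
        · rw [hU]
          exact ⟨⟨a, by simp [hW, hx]⟩, fun b => by simp [hW]⟩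
    · rintro ⟨k, ⟨hk, hR1, hR2, hR3⟩, ⟨h1, h2⟩, hx⟩
      have hki : k / m + 1 ≤ i := Nat.succ_le_of_lt ((Nat.div_lt_iff_lt_mul hm0).2 hk)
      exact ⟨⟨Or.inl (hR1.trans_lt h1), h2.trans hR2, h2.trans (hσm hki)⟩, atom_subset hR3 hx⟩
  have hsteps : IsPoissonSteps P (fun k => pastAlgebra N (past k))
      (fun k => ((timeMeasure.prod ν) (cell k)).toNNReal)
      (fun k => compensated N (timeMeasure.prod ν) (cell k)) ξ := by
    refine ⟨fun k => hN.pastAlgebra_le _, fun k l hkl => pastAlgebra_mono N (hpast hkl), fun k => ?_,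
      fun k => ?_, fun k => ?_, fun k => hN.map_compensated (hcell k) (hμt k), fun k => ?_, ?_⟩
    · have := ENNReal.toNNReal_mono ENNReal.coe_ne_top (hμ k)
      rw [ENNReal.toNNReal_coe, ← NNReal.coe_le_coe] at this
      simpa using this
    · exact measurable_compensated (measurable_pastAlgebra N (hcell k) (hcp' k))
    · refine indep_of_indep_of_le_right (hN.indep_pastAlgebra (hcell k) (hcp k)) ?_
      exact (measurable_compensated (comap_measurable _)).comap_le
    · refine Finset.stronglyMeasurable_fun_sum _ fun a _ => ?_
      by_cases hR : R a k
      · simp only [hR, if_true]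
        refine (h.meas a).mono ((natFiltration_le_pastAlgebra N _).trans (pastAlgebra_mono N ?_))
        exact (prod_mono (Ioc_subset_Ioc le_rfl hR.1) le_rfl).trans subset_union_left
      · simp only [hR, if_false]
        exact stronglyMeasurable_const
    · obtain ⟨K, hK⟩ := h.bdd
      refine ⟨∑ _a : ι, |K|, fun k ω => (norm_sum_le _ _).trans (Finset.sum_le_sum fun a _ => ?_)⟩
      split_ifs
      · exact (hK a ω).trans (le_abs_self K)
      · simp
  have hfin : ∀ᵐ ω ∂P, ∀ k, N ω (cell k) < ∞ :=
    ae_all_iff.2 fun k => hN.ae_lt_top (hcell k) (hμt k)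
  have hint : ∀ i ≤ L, ∀ᵐ ω ∂P, elemInt ν N s u A ζ (σ i) ω =
      stepSum (fun k => compensated N (timeMeasure.prod ν) (cell k)) ξ (i * m) ω := by
    intro i hi
    filter_upwards [hfin] with ω hω
    simp only [elemInt, stepSum, hunion i hi]
    simp_rw [compensated_biUnion hcell (fun k _ l _ hkl => hcd k l hkl) (fun k _ => hμt k)
      (fun k _ => hω k)]
    simp only [ξ, Finset.smul_sum, Finset.sum_smul]
    rw [Finset.sum_comm]
    refine Finset.sum_congr rfl fun a _ => ?_
    rw [Finset.sum_filter]
    refine Finset.sum_congr rfl fun k _ => ?_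
    split_ifs <;> simp
  refine ⟨L * m, _, _, _, ξ, hsteps, ?_, ?_, ?_⟩
  · intro g hg ω
    have hlast : ∀ a, u a ≤ σ L := fun a => by
      obtain ⟨i, hi, e⟩ := hσu a
      rw [← e]; exact hσm hi
    have e : ∀ z, elemProc s u A ζ ω z =
        ∑ k ∈ Finset.range (L * m), (cell k).indicator (fun _ => ξ k ω) z := by
      intro z
      have e1 : ∀ a, Ioc (s a) (u a) ×ˢ A a =
          ⋃ k ∈ (Finset.range (L * m)).filter (R a), cell k := by
        intro a
        rw [← hunion L le_rfl a, min_eq_left (hlast a)]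
        ext ⟨τ, x⟩
        simp only [mem_prod, mem_Ioc, min_lt_iff]
        exact ⟨fun h => ⟨⟨Or.inl h.1.1, h.1.2⟩, h.2⟩, fun h => ⟨⟨h.1.1.resolve_right
          (not_lt.2 (h.1.2.trans (hlast a))), h.1.2⟩, h.2⟩⟩
      simp only [elemProc, e1]
      simp_rw [Finset.indicator_biUnion_apply _ _ (fun k _ l _ hkl => hcd k l hkl)]
      have e2 : ∀ k, (cell k).indicator (fun _ => ξ k ω) z =
          ∑ a, if R a k then (cell k).indicator (fun _ => ζ a ω) z else 0 := by
        intro k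
        by_cases hz : z ∈ cell k
        · simp [hz, ξ]
        · simp [hz]
      simp_rw [e2]
      rw [Finset.sum_comm]
      refine Finset.sum_congr rfl fun a _ => ?_
      rw [Finset.sum_filter]
    simp_rw [e, comp_sum_indicator_of_disjoint (Finset.range (L * m))
      (fun k _ l _ hkl => hcd k l hkl) (fun k => ξ k ω) g hg]
    rw [lintegral_finsetSum' _ fun k _ => (measurable_const.indicator (hcell k)).aemeasurable]
    refine Finset.sum_congr rfl fun k _ => ?_
    rw [lintegral_indicator_const (hcell k), ENNReal.coe_toNNReal (hμt k), mul_comm]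
  · intro t ht
    obtain ⟨i, hi, rfl⟩ := hσT t (by simp [ht])
    exact ⟨i * m, Nat.mul_le_mul_right _ hi, hint i hi⟩
  · intro t ht
    rw [elemInt_eq_of_le ht (t' := σ L) fun a => by
      obtain ⟨i, hi, e⟩ := hσu a
      rw [← e]; exact hσm hi]
    exact hint L le_rfl

end Elementary

/-! ### Estimates for elementary processes -/

section ElementaryEstimates

set_option linter.unusedSectionVars false

variable {Ω : Type uΩ} [MeasurableSpace Ω] {J : Type uJ} [MeasurableSpace J]
  {H : Type uH} [NormedAddCommGroup H] [InnerProductSpace ℝ H] {ι : Type*} [Fintype ι]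
  {P : Measure Ω} [IsProbabilityMeasure P] {ν : Measure J} [SigmaFinite ν]
  {N : Ω → Measure (ℝ≥0 × J)} {s u : ι → ℝ≥0} {A : ι → Set J} {ζ : ι → Ω → H}

theorem tendsto_measure_Ioc_prod {M : Measure (ℝ≥0 × J)} {a b : ℝ≥0} {B : Set J}
    (hB : MeasurableSet B) (hM : M (Ioc a b ×ˢ B) ≠ ∞) (t : ℝ≥0) :
    Tendsto (fun r => M (Ioc (min a r) (min b r) ×ˢ B)) (𝓝[>] t)
      (𝓝 (M (Ioc (min a t) (min b t) ×ˢ B))) := by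
  have hmono : ∀ r, Ioc (min a r) (min b r) ×ˢ B = (Ioc a b ∩ Iic r) ×ˢ B := by
    intro r
    congr 1
    ext τ
    simp only [mem_Ioc, min_lt_iff, le_min_iff, mem_inter_iff, mem_Iic]
    exact ⟨fun h => ⟨⟨h.1.resolve_right (not_lt.2 h.2.2), h.2.1⟩, h.2.2⟩,
      fun h => ⟨Or.inl h.1.1, h.1.2, h.2⟩⟩
  simp_rw [hmono]
  have e : (Ioc a b ∩ Iic t) ×ˢ B = ⋂ r > t, (Ioc a b ∩ Iic r) ×ˢ B := by
    ext ⟨τ, x⟩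
    simp only [mem_prod, mem_inter_iff, mem_Iic, mem_iInter]
    constructor
    · rintro ⟨⟨h1, h2⟩, h3⟩ r hr
      exact ⟨⟨h1, h2.trans hr.le⟩, h3⟩
    · intro h
      have h1 := h (t + 1) (by simp)
      exact ⟨⟨h1.1.1, le_of_forall_gt_imp_ge_of_dense fun r hr => (h r hr).1.2⟩, h1.2⟩
  rw [e]
  refine tendsto_measure_biInter_gt (fun r _ =>
    ((measurableSet_Ioc.inter measurableSet_Iic).prod hB).nullMeasurableSet)
    (fun r r' _ hr => prod_mono (inter_subset_inter_right _ (Iic_subset_Iic.2 hr)) le_rfl)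
    ⟨t + 1, by simp, ne_top_of_le_ne_top hM (measure_mono (prod_mono inter_subset_left le_rfl))⟩

theorem IsElementary.tendsto_elemInt (h : IsElementary ν N s A ζ)
    (hN : IsPoissonRandomMeasure P N (timeMeasure.prod ν)) :
    ∀ᵐ ω ∂P, ∀ t, Tendsto (fun r => elemInt ν N s u A ζ r ω) (𝓝[>] t)
      (𝓝 (elemInt ν N s u A ζ t ω)) := by
  have hfin : ∀ a, (timeMeasure.prod ν) (Ioc (s a) (u a) ×ˢ A a) ≠ ∞ := fun a => by
    rw [timeMeasure_prod_Ioc]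
    exact ENNReal.mul_ne_top ENNReal.ofReal_ne_top (h.A_fin a).ne
  have h1 : ∀ᵐ ω ∂P, ∀ a, N ω (Ioc (s a) (u a) ×ˢ A a) < ∞ :=
    ae_all_iff.2 fun a => hN.ae_lt_top (measurableSet_Ioc.prod (h.A_meas a)) (hfin a)
  have hsub : ∀ a t, Ioc (min (s a) t) (min (u a) t) ×ˢ A a ⊆ Ioc (s a) (u a) ×ˢ A a := by
    rintro a t ⟨τ, x⟩ ⟨⟨h1, h2⟩, hx⟩
    have h3 := le_min_iff.1 h2
    exact ⟨⟨(min_lt_iff.1 h1).resolve_right (not_lt.2 h3.2), h3.1⟩, hx⟩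
  filter_upwards [h1] with ω hω t
  refine tendsto_finsetSum _ fun a _ => Tendsto.smul_const ?_ _
  refine Tendsto.sub ?_ ?_
  · exact (ENNReal.tendsto_toReal (ne_top_of_le_ne_top (hω a).ne (measure_mono (hsub a t)))).comp
      (tendsto_measure_Ioc_prod (h.A_meas a) (hω a).ne t)
  · exact (ENNReal.tendsto_toReal (ne_top_of_le_ne_top (hfin a) (measure_mono (hsub a t)))).comp
      (tendsto_measure_Ioc_prod (h.A_meas a) (hfin a) t)

theorem natFiltration_le (hN : IsPoissonRandomMeasure P N (timeMeasure.prod ν)) (t : ℝ≥0) :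
    natFiltration N t ≤ ‹MeasurableSpace Ω› :=
  (natFiltration_le_pastAlgebra N t).trans (hN.pastAlgebra_le _)

theorem IsElementary.stronglyMeasurable (h : IsElementary ν N s A ζ)
    (hN : IsPoissonRandomMeasure P N (timeMeasure.prod ν)) (a : ι) : StronglyMeasurable (ζ a) :=
  (h.meas a).mono (natFiltration_le hN _)

theorem IsElementary.stronglyMeasurable_elemInt (h : IsElementary ν N s A ζ)
    (hN : IsPoissonRandomMeasure P N (timeMeasure.prod ν)) (t : ℝ≥0) :
    StronglyMeasurable (elemInt ν N s u A ζ t) := by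
  refine Finset.stronglyMeasurable_fun_sum _ fun a _ => ?_
  exact (measurable_compensated (hN.measurable _
    (measurableSet_Ioc.prod (h.A_meas a)))).stronglyMeasurable.smul (h.stronglyMeasurable hN a)

theorem IsElementary.stronglyMeasurable_elemProc (h : IsElementary ν N s A ζ)
    (hN : IsPoissonRandomMeasure P N (timeMeasure.prod ν)) :
    StronglyMeasurable (fun y : Ω × (ℝ≥0 × J) => elemProc s u A ζ y.1 y.2) := by
  refine Finset.stronglyMeasurable_fun_sum _ fun a _ => ?_
  have := ((h.stronglyMeasurable hN a).comp_measurable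
    (measurable_fst : Measurable (fun y : Ω × (ℝ≥0 × J) => y.1))).indicator
    ((measurableSet_Ioc.prod (h.A_meas a)).preimage
      (measurable_snd : Measurable (fun y : Ω × (ℝ≥0 × J) => y.2))) (s := Prod.snd ⁻¹'
        (Ioc (s a) (u a) ×ˢ A a))
  exact this

/-- Doob's inequality for elementary integrals in continuous time. -/
theorem IsElementary.lintegral_iSup_le {p : ℝ} (hp : 1 < p) (h : IsElementary ν N s A ζ)
    (hN : IsPoissonRandomMeasure P N (timeMeasure.prod ν)) {t₀ : ℝ≥0} (ht₀ : ∀ a, u a ≤ t₀) :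
    ∫⁻ ω, ⨆ t : ℝ≥0, ‖elemInt ν N s u A ζ t ω‖ₑ ^ p ∂P ≤
      ENNReal.ofReal (2 * (p / (p - 1)) * ((p - 1) / (2 * p)) ^ (1 - p)) *
        ∫⁻ ω, ‖elemInt ν N s u A ζ t₀ ω‖ₑ ^ p ∂P := by
  classical
  set e := TopologicalSpace.denseSeq ℝ≥0
  have hp0 : 0 ≤ p := by linarith
  -- Right continuity of almost every path reduces the supremum to a countable dense set, which is
  -- then exhausted by finite sets.
  have h1 : ∀ᵐ ω ∂P, ⨆ t : ℝ≥0, ‖elemInt ν N s u A ζ t ω‖ₑ ^ p ≤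
      ⨆ n : ℕ, ⨆ k ∈ Finset.range (n + 1), ‖elemInt ν N s u A ζ (e k) ω‖ₑ ^ p := by
    filter_upwards [h.tendsto_elemInt (u := u) hN] with ω hω
    refine iSup_le fun t => ?_
    have h2 : Tendsto (fun r => ‖elemInt ν N s u A ζ r ω‖ₑ ^ p) (𝓝[>] t)
        (𝓝 (‖elemInt ν N s u A ζ t ω‖ₑ ^ p)) :=
      ((ENNReal.continuous_rpow_const.comp continuous_enorm).tendsto _).comp (hω t)
    refine le_of_tendsto_of_frequently h2 ?_
    rw [Filter.frequently_iff]
    intro U hU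
    obtain ⟨b, hb, hbU⟩ := (mem_nhdsGT_iff_exists_Ioo_subset' (show t < t + 1 by simp)).1 hU
    obtain ⟨x, hx, n, rfl⟩ := (TopologicalSpace.denseRange_denseSeq ℝ≥0).exists_mem_open
      isOpen_Ioo (nonempty_Ioo.2 hb) |>.elim fun n hn => (⟨_, hn, n, rfl⟩ :
        ∃ x, x ∈ Ioo t b ∧ ∃ n, e n = x)
    exact ⟨e n, hbU hx, le_iSup_of_le n (le_iSup₂_of_le n (by simp) le_rfl)⟩
  refine (lintegral_mono_ae h1).trans ?_
  have hmeas : ∀ t, Measurable (fun ω => ‖elemInt ν N s u A ζ t ω‖ₑ ^ p) := fun t =>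
    (h.stronglyMeasurable_elemInt hN t).enorm.pow_const p
  have h2 := lintegral_iSup (μ := P)
    (f := fun (n : ℕ) ω => ⨆ k ∈ Finset.range (n + 1), ‖elemInt ν N s u A ζ (e k) ω‖ₑ ^ p)
    (fun n => Measurable.iSup fun k => Measurable.iSup fun _ => hmeas (e k))
    (fun n m hnm ω => biSup_mono fun k hk => Finset.range_mono (by omega) hk)
  rw [h2]
  refine iSup_le fun n => ?_
  -- All sampled times are put into one grid, so the discrete maximum dominates the values there and
  -- Doob's constant is independent of the sample.
  obtain ⟨M, 𝒢, c, D, ξ, hs, -, hT, hend⟩ := exists_steps (u := u) hN h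
    ((Finset.range (n + 1)).image e)
  have h3 : ∀ᵐ ω ∂P, (⨆ k ∈ Finset.range (n + 1), ‖elemInt ν N s u A ζ (e k) ω‖ₑ ^ p) ≤
      ENNReal.ofReal (stepMax D ξ M ω ^ p) := by
    have : ∀ k ∈ Finset.range (n + 1), ∀ᵐ ω ∂P, ‖elemInt ν N s u A ζ (e k) ω‖ₑ ^ p ≤
        ENNReal.ofReal (stepMax D ξ M ω ^ p) := by
      intro k hk
      obtain ⟨j, hj, hje⟩ := hT (e k) (Finset.mem_image_of_mem e hk)
      filter_upwards [hje] with ω hω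
      rw [hω, ← ofReal_norm_rpow _ hp0]
      exact ENNReal.ofReal_le_ofReal (Real.rpow_le_rpow (norm_nonneg _)
        (norm_stepSum_le_stepMax D ξ hj ω) hp0)
    have := (Finset.eventually_all (Finset.range (n + 1))).2 this
    filter_upwards [this] with ω hω
    exact iSup₂_le hω
  refine (lintegral_mono_ae h3).trans ((hs.lintegral_stepMax_le hp M).trans ?_)
  refine mul_le_mul_right (lintegral_mono_ae ?_) _
  filter_upwards [hend t₀ ht₀] with ω hω
  rw [hω, ofReal_norm_rpow _ hp0]

theorem mixedNorm_rpow {E : Type*} [MeasurableSpace E] {F : Type*} [NormedAddCommGroup F]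
    (P : Measure Ω) (μ : Measure E) {p : ℝ} (hp : 0 < p) (q : ℝ) (f : Ω → E → F) :
    mixedNorm P μ p q f ^ p = ∫⁻ ω, (∫⁻ z, ‖f ω z‖ₑ ^ q ∂μ) ^ (p / q) ∂P := by
  rw [mixedNorm, ← ENNReal.rpow_mul, one_div_mul_cancel hp.ne', ENNReal.rpow_one]

theorem mixedNorm_self_rpow {E : Type*} [MeasurableSpace E] {F : Type*} [NormedAddCommGroup F]
    (P : Measure Ω) (μ : Measure E) {p : ℝ} (hp : 0 < p) (f : Ω → E → F) :
    mixedNorm P μ p p f ^ p = ∫⁻ ω, ∫⁻ z, ‖f ω z‖ₑ ^ p ∂μ ∂P := by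
  rw [mixedNorm_rpow P μ hp, div_self hp.ne']
  simp

theorem le_mul_of_rpow_le {p : ℝ} (hp : 0 < p) {a b : ℝ≥0∞} {C : ℝ≥0} (h : a ^ p ≤ C * b) :
    a ≤ ((C ^ (1 / p) : ℝ≥0) : ℝ≥0∞) * b ^ (1 / p) := by
  have := ENNReal.rpow_le_rpow h (by positivity : 0 ≤ 1 / p)
  rwa [← ENNReal.rpow_mul, mul_one_div_cancel hp.ne', ENNReal.rpow_one,
    ENNReal.mul_rpow_of_nonneg _ _ (by positivity),
    ← ENNReal.coe_rpow_of_nonneg _ (by positivity)] at this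

/-- Evaluating the cell decomposition on the powers `2` and `p` of the norm identifies the bracket
and the power sum with the two mixed norms; the discrete bounds then give both directions. -/
theorem exists_norm_estimate_of_two_le {p : ℝ} (hp : 2 ≤ p) : ∃ C : ℝ≥0,
    ∀ {Ω : Type uΩ} [MeasurableSpace Ω] {J : Type uJ} [MeasurableSpace J]
      {H : Type uH} [NormedAddCommGroup H] [InnerProductSpace ℝ H] {ι : Type} [Fintype ι]
      {P : Measure Ω} [IsProbabilityMeasure P] {ν : Measure J} [SigmaFinite ν]
      {N : Ω → Measure (ℝ≥0 × J)} {s u : ι → ℝ≥0} {A : ι → Set J} {ζ : ι → Ω → H},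
      IsPoissonRandomMeasure P N (timeMeasure.prod ν) → IsElementary ν N s A ζ →
      ∀ t, (∀ a, u a ≤ t) →
      (∫⁻ ω, ‖elemInt ν N s u A ζ t ω‖ₑ ^ p ∂P) ^ (1 / p) ≤
        C * interNorm P (timeMeasure.prod ν) p (elemProc s u A ζ) ∧
      interNorm P (timeMeasure.prod ν) p (elemProc s u A ζ) ≤
        C * (∫⁻ ω, ‖elemInt ν N s u A ζ t ω‖ₑ ^ p ∂P) ^ (1 / p) := by
  have hp0 : 0 < p := by linarith
  obtain ⟨C₁, h₁⟩ := exists_lintegral_stepSum_le_of_two_le.{uΩ, uH} hp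
  set C₂ : ℝ≥0 := (p * p ^ (p / 2 - 1)).toNNReal with hC₂
  set κ : ℝ := (1 / 2) ^ p * (1 / 2) ^ p with hκ
  have hκ0 : 0 < κ := by positivity
  set C₃ : ℝ≥0 := (κ⁻¹).toNNReal with hC₃
  refine ⟨max ((C₁ * 2) ^ (1 / p)) (max (C₂ ^ (1 / p)) (C₃ ^ (1 / p))), ?_⟩
  intro Ω _ J _ H _ _ ι _ P _ ν _ N s u A ζ hN h t ht
  obtain ⟨n, 𝒢, c, D, ξ, hs, hg, -, hend⟩ := exists_steps (u := u) hN h ∅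
  have hX : ∫⁻ ω, ‖elemInt ν N s u A ζ t ω‖ₑ ^ p ∂P =
      ∫⁻ ω, ENNReal.ofReal (‖stepSum D ξ n ω‖ ^ p) ∂P := by
    refine lintegral_congr_ae ?_
    filter_upwards [hend t ht] with ω hω
    rw [hω, ofReal_norm_rpow _ hp0.le]
  have hq : ∀ q : ℝ, 0 < q → ∀ ω, ∫⁻ z, ‖elemProc s u A ζ ω z‖ₑ ^ q ∂(timeMeasure.prod ν) =
      ENNReal.ofReal (∑ k ∈ Finset.range n, c k * ‖ξ k ω‖ ^ q) := by
    intro q hq ω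
    rw [hg (fun x => ‖x‖ₑ ^ q) (by simp [hq]) ω, ENNReal.ofReal_sum_of_nonneg
      fun k _ => by positivity]
    refine Finset.sum_congr rfl fun k _ => ?_
    rw [ENNReal.ofReal_mul (c k).coe_nonneg, ofReal_norm_rpow _ hq.le, ENNReal.ofReal_coe_nnreal]
  have ha : mixedNorm P (timeMeasure.prod ν) p 2 (elemProc s u A ζ) ^ p =
      ∫⁻ ω, ENNReal.ofReal (stepVar c ξ n ω ^ (p / 2)) ∂P := by
    rw [mixedNorm_rpow _ _ hp0]
    refine lintegral_congr fun ω => ?_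
    rw [hq 2 (by norm_num), ENNReal.ofReal_rpow_of_nonneg
      (Finset.sum_nonneg fun k _ => by positivity) (by positivity)]
    simp [stepVar]
  have hb : mixedNorm P (timeMeasure.prod ν) p p (elemProc s u A ζ) ^ p =
      ∫⁻ ω, ENNReal.ofReal (stepPow p c ξ n ω) ∂P := by
    rw [mixedNorm_self_rpow _ _ hp0]
    exact lintegral_congr fun ω => hq p hp0 ω
  set X := ∫⁻ ω, ‖elemInt ν N s u A ζ t ω‖ₑ ^ p ∂P
  constructor
  · have h1 := h₁ hs n
    rw [← hX, ← ha, ← hb] at h1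
    have h2 : (X ^ (1 / p)) ^ p ≤ ((C₁ * 2 : ℝ≥0) : ℝ≥0∞) *
        interNorm P (timeMeasure.prod ν) p (elemProc s u A ζ) ^ p := by
      rw [← ENNReal.rpow_mul, one_div_mul_cancel hp0.ne', ENNReal.rpow_one]
      refine h1.trans ?_
      push_cast
      rw [mul_assoc, two_mul]
      gcongr
      · exact le_max_left _ _
      · exact le_max_right _ _
    have h3 := le_mul_of_rpow_le hp0 h2
    rw [← ENNReal.rpow_mul, mul_one_div_cancel hp0.ne', ENNReal.rpow_one] at h3
    refine h3.trans ?_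
    gcongr
    exact le_max_left _ _
  · refine max_le ?_ ?_
    · have h1 := hs.lintegral_stepVar_le hp n
      rw [← hX, ← ha] at h1
      refine (le_mul_of_rpow_le hp0 (C := C₂) h1).trans ?_
      gcongr
      exact (le_max_left _ _).trans (le_max_right _ _)
    · have h1 := hs.lintegral_stepPow_le hp n
      rw [← hX, ← hb] at h1
      have h2 : mixedNorm P (timeMeasure.prod ν) p p (elemProc s u A ζ) ^ p ≤ C₃ * X := by
        refine le_trans (le_of_eq ?_) (mul_le_mul_right h1 _)
        rw [← mul_assoc, hC₃]
        change _ = ENNReal.ofReal κ⁻¹ * _ * _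
        rw [← ENNReal.ofReal_mul (by positivity), inv_mul_cancel₀ hκ0.ne']
        simp
      refine (le_mul_of_rpow_le hp0 h2).trans ?_
      gcongr
      exact (le_max_right _ _).trans (le_max_right _ _)

/-- A weighted geometric mean of `R ^ p` and `w`, hence at most their sum. It turns the truncated
square function back into the maximum and the total gain. -/
theorem mul_rpow_le_rpow_add {p R w : ℝ} (hp0 : 0 < p) (hp2 : p < 2) (hR : 0 ≤ R) (hw : 0 ≤ w) :
    (R ^ (2 - p) * w) ^ (p / 2) ≤ R ^ p + w := by
  rcases hR.eq_or_lt with rfl | hR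
  · rw [Real.zero_rpow (by linarith), zero_mul, Real.zero_rpow (by linarith),
      Real.zero_rpow hp0.ne', zero_add]
    exact hw
  have hRp : 0 < R ^ p := by positivity
  rcases le_total w (R ^ p) with h | h
  · have h1 : R ^ (2 - p) * w ≤ R ^ (2 : ℝ) := by
      calc R ^ (2 - p) * w ≤ R ^ (2 - p) * R ^ p := by gcongr
        _ = R ^ (2 : ℝ) := by rw [← Real.rpow_add hR]; congr 1; ring
    calc (R ^ (2 - p) * w) ^ (p / 2) ≤ (R ^ (2 : ℝ)) ^ (p / 2) := by gcongr
      _ = R ^ p := by rw [← Real.rpow_mul hR.le]; congr 1; ring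
      _ ≤ _ := by linarith
  · have hw0 : 0 < w := hRp.trans_le h
    have h1 : R ^ (2 - p) ≤ w ^ ((2 - p) / p) := by
      calc R ^ (2 - p) = (R ^ p) ^ ((2 - p) / p) := by
            rw [← Real.rpow_mul hR.le]; congr 1; field_simp
        _ ≤ _ := Real.rpow_le_rpow hRp.le h (div_nonneg (by linarith) hp0.le)
    calc (R ^ (2 - p) * w) ^ (p / 2) ≤ (w ^ ((2 - p) / p) * w) ^ (p / 2) := by gcongr
      _ = w := by
        rw [← Real.rpow_add_one hw0.ne', ← Real.rpow_mul hw0.le]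
        have : ((2 - p) / p + 1) * (p / 2) = 1 := by field_simp; ring
        rw [this, Real.rpow_one]
      _ ≤ _ := by linarith

end ElementaryEstimates

/-! ### Norm estimates for `1 < p < 2` -/

/-- The level `s = q₁ ^ (1 / 2)` balances the two terms containing `s`, giving `2 + 4 = 6`; if `q₁ =
0`, one lets `s` tend to zero. -/
theorem le_of_forall_le_add_mul {p : ℝ} (hp0 : 0 < p) {L q₁ q₂ : ℝ≥0∞}
    (h : ∀ s : ℝ, 0 < s → L ≤ ENNReal.ofReal (2 * s ^ p) +
      (ENNReal.ofReal (4 * s ^ (p - 2)) * q₁ + 4 * q₂)) :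
    L ≤ 6 * q₁ ^ (p / 2) + 4 * q₂ := by
  rcases eq_or_ne q₁ ∞ with rfl | htop
  · rw [ENNReal.top_rpow_of_pos (by positivity)]
    simp
  rcases eq_or_ne q₁ 0 with rfl | h0
  · rw [ENNReal.zero_rpow_of_pos (by positivity), mul_zero, zero_add]
    refine ENNReal.le_of_forall_pos_le_add fun ε hε _ => ?_
    have hε' : 0 < (ε : ℝ) / 2 := by positivity
    refine (h (((ε : ℝ) / 2) ^ (1 / p)) (by positivity)).trans ?_
    rw [← Real.rpow_mul hε'.le, one_div_mul_cancel hp0.ne', Real.rpow_one, mul_zero, zero_add,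
      mul_div_cancel₀ _ (by norm_num), ENNReal.ofReal_coe_nnreal, add_comm]
  · have hr : 0 < q₁.toReal := ENNReal.toReal_pos h0 htop
    set r := q₁.toReal with hr_def
    have hq : q₁ = ENNReal.ofReal r := (ENNReal.ofReal_toReal htop).symm
    refine (h (r ^ (1 / 2 : ℝ)) (by positivity)).trans ?_
    have e1 : (r ^ (1 / 2 : ℝ)) ^ p = r ^ (p / 2) := by
      rw [← Real.rpow_mul hr.le]; congr 1; ring
    have e2 : (r ^ (1 / 2 : ℝ)) ^ (p - 2) * r = r ^ (p / 2) := by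
      rw [← Real.rpow_mul hr.le, ← Real.rpow_add_one hr.ne']; congr 1; ring
    rw [hq, ENNReal.ofReal_rpow_of_pos hr, ← ENNReal.ofReal_mul (by positivity), mul_assoc, e1, e2,
      ← add_assoc, ← ENNReal.ofReal_add (by positivity) (by positivity), ← add_mul,
      ENNReal.ofReal_mul (by norm_num)]
    norm_num

theorem le_mul_sumNorm {Ω E F : Type*} [MeasurableSpace Ω] [MeasurableSpace E]
    [NormedAddCommGroup F] {P : Measure Ω} {μ : Measure E} {p : ℝ} {f : Ω → E → F} {x : ℝ≥0∞}
    {C : ℝ≥0} (hC : 0 < C)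
    (h : ∀ f₁ f₂ : Ω → E → F, AEStronglyMeasurable (fun y : Ω × E => f₁ y.1 y.2) (P.prod μ) →
      AEStronglyMeasurable (fun y : Ω × E => f₂ y.1 y.2) (P.prod μ) →
      (∀ᵐ y ∂(P.prod μ), f y.1 y.2 = f₁ y.1 y.2 + f₂ y.1 y.2) →
      x ≤ C * (mixedNorm P μ p 2 f₁ + mixedNorm P μ p p f₂)) : x ≤ C * sumNorm P μ p f := by
  have hC' : (C : ℝ≥0∞) ≠ 0 := ENNReal.coe_ne_zero.2 hC.ne'
  rw [← ENNReal.div_le_iff' hC' ENNReal.coe_ne_top]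
  refine le_iInf₂ fun f₁ f₂ => le_iInf₂ fun h₁ h₂ => le_iInf fun h₃ => ?_
  rw [ENNReal.div_le_iff' hC' ENNReal.coe_ne_top]
  exact h f₁ f₂ h₁ h₂ h₃

/-- The upper bound holds against every decomposition, adapted or not, because the majorant is
estimated for each `ω` separately. The lower bound exhibits one decomposition: the integrand
truncated at the maximum of its own integral. -/
theorem exists_norm_estimate_of_lt_two {p : ℝ} (hp1 : 1 < p) (hp2 : p < 2) : ∃ C : ℝ≥0,
    ∀ {Ω : Type uΩ} [MeasurableSpace Ω] {J : Type uJ} [MeasurableSpace J]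
      {H : Type uH} [NormedAddCommGroup H] [InnerProductSpace ℝ H] {ι : Type} [Fintype ι]
      {P : Measure Ω} [IsProbabilityMeasure P] {ν : Measure J} [SigmaFinite ν]
      {N : Ω → Measure (ℝ≥0 × J)} {s u : ι → ℝ≥0} {A : ι → Set J} {ζ : ι → Ω → H},
      IsPoissonRandomMeasure P N (timeMeasure.prod ν) → IsElementary ν N s A ζ →
      ∀ t, (∀ a, u a ≤ t) →
      (∫⁻ ω, ‖elemInt ν N s u A ζ t ω‖ₑ ^ p ∂P) ^ (1 / p) ≤
        C * sumNorm P (timeMeasure.prod ν) p (elemProc s u A ζ) ∧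
      sumNorm P (timeMeasure.prod ν) p (elemProc s u A ζ) ≤
        C * (∫⁻ ω, ‖elemInt ν N s u A ζ t ω‖ₑ ^ p ∂P) ^ (1 / p) := by
  have hp0 : 0 < p := by linarith
  obtain ⟨C₁, h₁⟩ := exists_lintegral_stepSum_le_of_lt_two.{uΩ, uH} hp1 hp2
  set C₂ : ℝ≥0 := (2 * (p / (p - 1)) * ((p - 1) / (2 * p)) ^ (1 - p)).toNNReal with hC₂
  set κ : ℝ := p * (p - 1) / 128 with hκ
  have hκ0 : 0 < κ := by have := sub_pos.2 hp1; positivity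
  set C₃ : ℝ≥0 := (κ⁻¹).toNNReal with hC₃
  refine ⟨max ((C₁ * 10 + 1) ^ (1 / p)) ((C₂ + C₃) ^ (1 / p) + C₃ ^ (1 / p)), ?_⟩
  intro Ω _ J _ H _ _ ι _ P _ ν _ N s u A ζ hN h t ht
  obtain ⟨n, 𝒢, c, D, ξ, hs, hg, -, hend⟩ := exists_steps (u := u) hN h ∅
  have hX : ∫⁻ ω, ‖elemInt ν N s u A ζ t ω‖ₑ ^ p ∂P =
      ∫⁻ ω, ENNReal.ofReal (‖stepSum D ξ n ω‖ ^ p) ∂P := by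
    refine lintegral_congr_ae ?_
    filter_upwards [hend t ht] with ω hω
    rw [hω, ofReal_norm_rpow _ hp0.le]
  have hgain : ∀ R ω, ∫⁻ z, ENNReal.ofReal (gain p R ‖elemProc s u A ζ ω z‖)
      ∂(timeMeasure.prod ν) = ENNReal.ofReal (∑ k ∈ Finset.range n, c k * gain p R ‖ξ k ω‖) := by
    intro R ω
    rw [hg (fun x => ENNReal.ofReal (gain p R ‖x‖)) (by simp [gain_zero]) ω,
      ENNReal.ofReal_sum_of_nonneg fun k _ => mul_nonneg (c k).coe_nonneg
        (gain_nonneg (norm_nonneg _))]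
    refine Finset.sum_congr rfl fun k _ => ?_
    rw [ENNReal.ofReal_mul (c k).coe_nonneg, ENNReal.ofReal_coe_nnreal]
  have hZ := h.stronglyMeasurable_elemProc (u := u) hN
  set Z := elemProc s u A ζ with hZdef
  set X := ∫⁻ ω, ‖elemInt ν N s u A ζ t ω‖ₑ ^ p ∂P
  constructor
  · refine le_trans ?_ (mul_le_mul_left (ENNReal.coe_le_coe.2 (le_max_left _ _)) _)
    refine le_mul_sumNorm (by positivity) fun f₁ f₂ hm₁ hm₂ hf => ?_
    set a := mixedNorm P (timeMeasure.prod ν) p 2 f₁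
    set b := mixedNorm P (timeMeasure.prod ν) p p f₂
    have h2 : AEMeasurable (fun ω => (∫⁻ z, ‖f₁ ω z‖ₑ ^ (2 : ℝ) ∂(timeMeasure.prod ν)) ^ (p / 2)) P :=
      ((hm₁.enorm.pow_const (2 : ℝ)).lintegral_prod_right').pow_const _
    have h3 : ∀ᵐ ω ∂P, ENNReal.ofReal (predMajorant p c (fun k => ‖ξ k ω‖) n) ≤
        6 * (∫⁻ z, ‖f₁ ω z‖ₑ ^ (2 : ℝ) ∂(timeMeasure.prod ν)) ^ (p / 2) +
          4 * ∫⁻ z, ‖f₂ ω z‖ₑ ^ p ∂(timeMeasure.prod ν) := by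
      filter_upwards [Measure.ae_ae_of_ae_prod hf, hm₁.prodMk_left] with ω hω hω₁
      -- The level `s` is deterministic for the fixed `ω` but is optimised afterwards depending on
      -- `ω`.
      refine le_of_forall_le_add_mul hp0 fun s hs0 => ?_
      have h4 := predMajorant_le hp1 hp2 hs0 (c := c) (x := fun k => ‖ξ k ω‖)
        (fun k => norm_nonneg _) hs.c_le n
      refine (ENNReal.ofReal_le_ofReal h4).trans ?_
      rw [ENNReal.ofReal_add (by positivity) (Finset.sum_nonneg fun k _ =>
        mul_nonneg (c k).coe_nonneg (gain_nonneg (norm_nonneg _))), ← hgain]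
      refine add_le_add_right ?_ _
      rw [← lintegral_const_mul' _ _ ENNReal.ofReal_ne_top,
        ← lintegral_const_mul' _ _ (by norm_num), ← lintegral_add_left'
          ((hω₁.enorm.pow_const (2 : ℝ)).const_mul _)]
      refine lintegral_mono_ae ?_
      filter_upwards [hω] with z hz
      have hz' : ‖Z ω z‖ ≤ ‖f₁ ω z‖ + ‖f₂ ω z‖ := by
        change Z ω z = f₁ ω z + f₂ ω z at hz
        rw [hz]; exact norm_add_le _ _
      refine (ENNReal.ofReal_le_ofReal (gain_add_le hp0 hp2.le hs0 (norm_nonneg _) (norm_nonneg _)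
        (norm_nonneg _) hz')).trans_eq ?_
      rw [ENNReal.ofReal_add (by positivity) (by positivity), mul_left_comm, mul_comm (‖f₁ ω z‖ ^ 2),
        ENNReal.ofReal_mul (by positivity), ENNReal.ofReal_mul (q := ‖f₂ ω z‖ ^ p) (by norm_num),
        ofReal_norm_rpow _ hp0.le, ← Real.rpow_two, ofReal_norm_rpow _ (by norm_num)]
      norm_num
    have h4 : ∫⁻ ω, ENNReal.ofReal (predMajorant p c (fun k => ‖ξ k ω‖) n) ∂P ≤
        6 * a ^ p + 4 * b ^ p := by
      refine (lintegral_mono_ae h3).trans ?_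
      rw [lintegral_add_left' (h2.const_mul _), lintegral_const_mul' _ _ (by norm_num),
        lintegral_const_mul' _ _ (by norm_num), mixedNorm_rpow _ _ hp0, mixedNorm_self_rpow _ _ hp0]
    have h5 : (X ^ (1 / p)) ^ p ≤ ((C₁ * 10 + 1 : ℝ≥0) : ℝ≥0∞) * (a + b) ^ p := by
      rw [← ENNReal.rpow_mul, one_div_mul_cancel hp0.ne', ENNReal.rpow_one, hX]
      refine (h₁ hs n).trans ?_
      calc C₁ * ∫⁻ ω, ENNReal.ofReal (predMajorant p c (fun k => ‖ξ k ω‖) n) ∂P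
          ≤ C₁ * (6 * (a + b) ^ p + 4 * (a + b) ^ p) := by
            refine mul_le_mul_right (h4.trans ?_) _
            gcongr
            · exact le_self_add
            · exact le_add_self
        _ = (C₁ * 10) * (a + b) ^ p := by ring
        _ ≤ _ := by
          push_cast
          gcongr
          exact le_self_add
    have h6 := le_mul_of_rpow_le hp0 h5
    rwa [← ENNReal.rpow_mul, mul_one_div_cancel hp0.ne', ENNReal.rpow_one] at h6
  · set R := stepMax D ξ n with hR
    have hR0 : ∀ ω, 0 ≤ R ω := fun ω => stepMax_nonneg D ξ n ω
    have hRm : Measurable R := hs.measurable_stepMax' n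
    set w : Ω → ℝ := fun ω => ∑ k ∈ Finset.range n, c k * gain p (R ω) ‖ξ k ω‖ with hw
    have hw0 : ∀ ω, 0 ≤ w ω := fun ω => Finset.sum_nonneg fun k _ =>
      mul_nonneg (c k).coe_nonneg (gain_nonneg (norm_nonneg _))
    have hRX : ∫⁻ ω, ENNReal.ofReal (R ω ^ p) ∂P ≤ C₂ * X := by
      have := hs.lintegral_stepMax_le hp1 n
      rw [← hX] at this
      exact this
    have hwX : ∫⁻ ω, ENNReal.ofReal (w ω) ∂P ≤ C₃ * X := by
      have h1 := hs.lintegral_gain_le hp1 hp2 n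
      rw [← hX] at h1
      refine le_trans (le_of_eq ?_) (mul_le_mul_right h1 _)
      rw [← mul_assoc, hC₃]
      change _ = ENNReal.ofReal κ⁻¹ * _ * _
      rw [← ENNReal.ofReal_mul (by positivity), inv_mul_cancel₀ hκ0.ne']
      simp [hw, hR]
    have hS : MeasurableSet {y : Ω × (ℝ≥0 × J) | ‖Z y.1 y.2‖ ≤ R y.1} :=
      measurableSet_le hZ.norm.measurable (hRm.comp measurable_fst)
    classical
    -- At the level `R` the gain is `R ^ (p - 2)` times the square on the small part and exactly the
    -- `p`-th power on the large part.
    set f₁ : Ω → ℝ≥0 × J → H := fun ω z => if ‖Z ω z‖ ≤ R ω then Z ω z else 0 with hf₁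
    set f₂ : Ω → ℝ≥0 × J → H := fun ω z => if ‖Z ω z‖ ≤ R ω then 0 else Z ω z with hf₂
    have hm₁ : StronglyMeasurable (fun y : Ω × (ℝ≥0 × J) => f₁ y.1 y.2) :=
      StronglyMeasurable.ite hS hZ stronglyMeasurable_zero
    have hm₂ : StronglyMeasurable (fun y : Ω × (ℝ≥0 × J) => f₂ y.1 y.2) :=
      StronglyMeasurable.ite hS stronglyMeasurable_zero hZ
    have hle : sumNorm P (timeMeasure.prod ν) p Z ≤ mixedNorm P (timeMeasure.prod ν) p 2 f₁ +
        mixedNorm P (timeMeasure.prod ν) p p f₂ := by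
      refine iInf₂_le_of_le f₁ f₂ (iInf₂_le_of_le hm₁.aestronglyMeasurable
        hm₂.aestronglyMeasurable (iInf_le_of_le ?_ le_rfl))
      refine Eventually.of_forall fun y => ?_
      by_cases hy : ‖Z y.1 y.2‖ ≤ R y.1 <;> simp [hf₁, hf₂, hy]
    have h2 : mixedNorm P (timeMeasure.prod ν) p p f₂ ^ p ≤ C₃ * X := by
      rw [mixedNorm_self_rpow _ _ hp0]
      refine (lintegral_mono fun ω => ?_).trans hwX
      rw [hw, ← hgain (R ω) ω]
      refine lintegral_mono fun z => ?_
      by_cases hy : ‖Z ω z‖ ≤ R ω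
      · simp [hf₂, hy, hp0]
      · simp only [hf₂, hy, if_false]
        rw [gain_of_le hp0 (norm_nonneg _) (not_le.1 hy).le, ofReal_norm_rpow _ hp0.le]
    have h1 : mixedNorm P (timeMeasure.prod ν) p 2 f₁ ^ p ≤ (C₂ + C₃ : ℝ≥0) * X := by
      rw [mixedNorm_rpow _ _ hp0]
      push_cast
      rw [add_mul]
      refine le_trans ?_ (add_le_add hRX hwX)
      rw [← lintegral_add_left (by fun_prop)]
      refine lintegral_mono fun ω => ?_
      have h3 : ∫⁻ z, ‖f₁ ω z‖ₑ ^ (2 : ℝ) ∂(timeMeasure.prod ν) ≤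
          ENNReal.ofReal (R ω ^ (2 - p) * w ω) := by
        rw [ENNReal.ofReal_mul (Real.rpow_nonneg (hR0 ω) _), hw, ← hgain (R ω) ω,
          ← lintegral_const_mul' _ _ ENNReal.ofReal_ne_top]
        refine lintegral_mono fun z => ?_
        by_cases hy : ‖Z ω z‖ ≤ R ω
        · simp only [hf₁, hy, if_true]
          rw [gain_of_ge hy, ← ofReal_norm_rpow _ (by norm_num : (0 : ℝ) ≤ 2),
            ← ENNReal.ofReal_mul (Real.rpow_nonneg (hR0 ω) _)]
          refine ENNReal.ofReal_le_ofReal ?_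
          rcases (hR0 ω).eq_or_lt with h0 | h0
          · have : ‖Z ω z‖ = 0 := le_antisymm (hy.trans h0.symm.le) (norm_nonneg _)
            simp [this]
          · rw [mul_left_comm, ← Real.rpow_add h0]
            simp
        · simp [hf₁, hy]
      refine (ENNReal.rpow_le_rpow h3 (by positivity)).trans ?_
      have h4 : 0 ≤ R ω ^ (2 - p) * w ω := mul_nonneg (Real.rpow_nonneg (hR0 ω) _) (hw0 ω)
      rw [ENNReal.ofReal_rpow_of_nonneg h4 (by positivity),
        ← ENNReal.ofReal_add (Real.rpow_nonneg (hR0 ω) _) (hw0 ω)]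
      exact ENNReal.ofReal_le_ofReal (mul_rpow_le_rpow_add hp0 hp2 (hR0 ω) (hw0 ω))
    refine hle.trans ((add_le_add (le_mul_of_rpow_le hp0 h1) (le_mul_of_rpow_le hp0 h2)).trans ?_)
    rw [← add_mul]
    gcongr
    rw [← ENNReal.coe_add]
    exact_mod_cast le_max_right _ _

/-! ### Norms on processes -/

section ProcessNorm

theorem lintegral_Lp_sum_le {α : Type*} [MeasurableSpace α] {μ : Measure α} {p : ℝ} (hp : 1 ≤ p)
    {f : ℕ → α → ℝ≥0∞} (hf : ∀ j, AEMeasurable (f j) μ) (n : ℕ) :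
    (∫⁻ a, (∑ j ∈ Finset.range n, f j a) ^ p ∂μ) ^ (1 / p) ≤
      ∑ j ∈ Finset.range n, (∫⁻ a, f j a ^ p ∂μ) ^ (1 / p) := by
  have hp0 : 0 < p := by linarith
  induction n with
  | zero => simp [hp0]
  | succ n ih =>
    simp only [Finset.sum_range_succ]
    refine le_trans ?_ (add_le_add_left ih _)
    exact ENNReal.lintegral_Lp_add_le (Finset.aemeasurable_fun_sum _ fun j _ => hf j) (hf n) hp

/-- Countable Minkowski inequality, by monotone convergence from the finite one; applied in both
variables it gives the mixed version. -/
theorem lintegral_Lp_tsum_le {α : Type*} [MeasurableSpace α] {μ : Measure α} {p : ℝ} (hp : 1 ≤ p)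
    {f : ℕ → α → ℝ≥0∞} (hf : ∀ j, AEMeasurable (f j) μ) :
    (∫⁻ a, (∑' j, f j a) ^ p ∂μ) ^ (1 / p) ≤ ∑' j, (∫⁻ a, f j a ^ p ∂μ) ^ (1 / p) := by
  have hp0 : 0 < p := by linarith
  have hmono : ∀ a, Monotone fun n => (∑ j ∈ Finset.range n, f j a) ^ p := fun a n m hnm =>
    ENNReal.rpow_le_rpow (Finset.sum_le_sum_of_subset (Finset.range_mono hnm)) hp0.le
  have h1 : Tendsto (fun n => ∫⁻ a, (∑ j ∈ Finset.range n, f j a) ^ p ∂μ) atTop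
      (𝓝 (∫⁻ a, (∑' j, f j a) ^ p ∂μ)) := by
    refine lintegral_tendsto_of_tendsto_of_monotone
      (fun n => (Finset.aemeasurable_fun_sum _ fun j _ => hf j).pow_const p)
      (Eventually.of_forall hmono) (Eventually.of_forall fun a => ?_)
    exact (ENNReal.continuous_rpow_const.tendsto _).comp (ENNReal.tendsto_nat_tsum fun j => f j a)
  have h2 := (ENNReal.continuous_rpow_const (y := 1 / p)).tendsto _ |>.comp h1
  exact le_of_tendsto h2 (Eventually.of_forall fun n =>
    (lintegral_Lp_sum_le hp hf n).trans (ENNReal.sum_le_tsum _))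

variable {Ω E : Type*} [MeasurableSpace Ω] [MeasurableSpace E] {P : Measure Ω} {μ : Measure E}

/-- The mixed norm of a `[0, ∞]`-valued function. -/
noncomputable def mixedENorm (P : Measure Ω) (μ : Measure E) (p q : ℝ) (G : Ω → E → ℝ≥0∞) : ℝ≥0∞ :=
  (∫⁻ ω, (∫⁻ z, G ω z ^ q ∂μ) ^ (p / q) ∂P) ^ (1 / p)

variable {p q : ℝ}

theorem mixedENorm_mono_ae [SFinite μ] (hp : 0 < p) (hq : 0 < q) {G G' : Ω → E → ℝ≥0∞}
    (h : ∀ᵐ y ∂P.prod μ, G y.1 y.2 ≤ G' y.1 y.2) :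
    mixedENorm P μ p q G ≤ mixedENorm P μ p q G' := by
  refine ENNReal.rpow_le_rpow (lintegral_mono_ae ?_) (by positivity)
  filter_upwards [Measure.ae_ae_of_ae_prod h] with ω hω
  refine ENNReal.rpow_le_rpow (lintegral_mono_ae ?_) (by positivity)
  filter_upwards [hω] with z hz
  exact ENNReal.rpow_le_rpow hz hq.le

theorem mixedENorm_tsum_le [SFinite μ] (hp : 1 ≤ p) (hq : 1 ≤ q) {G : ℕ → Ω → E → ℝ≥0∞}
    (hG : ∀ j, AEMeasurable (fun y : Ω × E => G j y.1 y.2) (P.prod μ)) :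
    mixedENorm P μ p q (fun ω z => ∑' j, G j ω z) ≤ ∑' j, mixedENorm P μ p q (G j) := by
  have hp0 : 0 < p := by linarith
  have hq0 : 0 < q := by linarith
  have e : ∀ x : ℝ≥0∞, x ^ (p / q) = (x ^ (1 / q)) ^ p := fun x => by
    rw [← ENNReal.rpow_mul]; congr 1; ring
  simp only [mixedENorm, e]
  refine le_trans (ENNReal.rpow_le_rpow (lintegral_mono_ae ?_) (by positivity))
    (lintegral_Lp_tsum_le hp (f := fun j ω => (∫⁻ z, G j ω z ^ q ∂μ) ^ (1 / q)) fun j =>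
      (((hG j).pow_const q).lintegral_prod_right').pow_const _)
  have h1 : ∀ᵐ ω ∂P, ∀ j, AEMeasurable (fun z => G j ω z) μ :=
    ae_all_iff.2 fun j => ((hG j).aestronglyMeasurable.prodMk_left).mono fun ω h => h.aemeasurable
  filter_upwards [h1] with ω hω
  exact ENNReal.rpow_le_rpow (lintegral_Lp_tsum_le hq hω) hp0.le

theorem ae_lt_top_of_mixedENorm_ne_top [SFinite μ] (hp : 0 < p) (hq : 0 < q) {G : Ω → E → ℝ≥0∞}
    (hG : AEMeasurable (fun y : Ω × E => G y.1 y.2) (P.prod μ)) (h : mixedENorm P μ p q G ≠ ∞) :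
    ∀ᵐ y ∂P.prod μ, G y.1 y.2 < ∞ := by
  have h1 : ∫⁻ ω, (∫⁻ z, G ω z ^ q ∂μ) ^ (p / q) ∂P ≠ ∞ := fun h' => h (by
    rw [mixedENorm, h', ENNReal.top_rpow_of_pos (by positivity)])
  have h2 := ae_lt_top' (((hG.pow_const q).lintegral_prod_right').pow_const (p / q)) h1
  have hae := hG.ae_eq_mk
  have h3 : ∀ᵐ ω ∂P, ∀ᵐ z ∂μ, hG.mk _ (ω, z) < ∞ := by
    filter_upwards [h2, hG.aestronglyMeasurable.prodMk_left, Measure.ae_ae_of_ae_prod hae]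
      with ω h4 h5 h6
    have h7 : ∫⁻ z, G ω z ^ q ∂μ ≠ ∞ := fun h' => h4.ne (by
      rw [h', ENNReal.top_rpow_of_pos (by positivity)])
    filter_upwards [ae_lt_top' (h5.aemeasurable.pow_const q) h7, h6] with z h8 h9
    rw [← h9]
    refine lt_top_iff_ne_top.2 fun h' => h8.ne ?_
    rw [show G ω z = ∞ from h', ENNReal.top_rpow_of_pos hq]
  have h4 := (Measure.ae_prod_iff_ae_ae (μ := P) (ν := μ)
    (measurableSet_lt hG.measurable_mk measurable_const)).2 h3
  filter_upwards [h4, hae] with y h5 h6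
  rwa [h6]

/-- The properties of the norms of integrands that are used in the characterization of stochastic
integrability. -/
structure IsProcessNorm {H : Type*} [NormedAddCommGroup H] (P : Measure Ω) (μ : Measure E)
    (nrm : (Ω → E → H) → ℝ≥0∞) : Prop where
  zero : nrm (fun _ _ => 0) = 0
  neg : ∀ f, nrm (fun ω z => - f ω z) = nrm f
  indicator_le : ∀ f S, MeasurableSet S → nrm (indicatorProcess f S) ≤ nrm f
  le_tsum : ∀ (f : ℕ → Ω → E → H) (g : Ω → E → H),
    (∀ j, AEStronglyMeasurable (fun y : Ω × E => f j y.1 y.2) (P.prod μ)) →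
    (∀ᵐ y ∂P.prod μ, Tendsto (fun n => ∑ j ∈ Finset.range n, f j y.1 y.2) atTop (𝓝 (g y.1 y.2))) →
    nrm g ≤ ∑' j, nrm (f j)
  ae_lt_top : ∀ f : ℕ → Ω → E → H,
    (∀ j, AEStronglyMeasurable (fun y : Ω × E => f j y.1 y.2) (P.prod μ)) →
    ∑' j, nrm (f j) ≠ ∞ → ∀ᵐ y ∂P.prod μ, ∑' j, ‖f j y.1 y.2‖ₑ < ∞

namespace IsProcessNorm

variable {H : Type*} [NormedAddCommGroup H] {nrm : (Ω → E → H) → ℝ≥0∞}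

/-- Countable subadditivity applied to the series `f + g + 0 + 0 + ⋯`. -/
theorem le_add (h : IsProcessNorm P μ nrm) {f g k : Ω → E → H}
    (hf : AEStronglyMeasurable (fun y : Ω × E => f y.1 y.2) (P.prod μ))
    (hg : AEStronglyMeasurable (fun y : Ω × E => g y.1 y.2) (P.prod μ))
    (hk : ∀ᵐ y ∂P.prod μ, k y.1 y.2 = f y.1 y.2 + g y.1 y.2) : nrm k ≤ nrm f + nrm g := by
  set F : ℕ → Ω → E → H := fun j => if j = 0 then f else if j = 1 then g else fun _ _ => 0 with hF
  have h1 := h.le_tsum F k (fun j => ?_) ?_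
  · refine h1.trans_eq ?_
    rw [tsum_eq_sum (s := Finset.range 2)]
    · simp [Finset.sum_range_succ, hF]
    · intro j hj
      have : 1 < j := by simpa using hj
      simp [hF, show j ≠ 0 by omega, show j ≠ 1 by omega, h.zero]
  · by_cases h0 : j = 0
    · simpa [hF, h0] using hf
    · by_cases h1 : j = 1
      · simpa [hF, h1] using hg
      · simpa [hF, h0, h1] using aestronglyMeasurable_const
  · filter_upwards [hk] with y hy
    refine tendsto_const_nhds.congr' ?_
    filter_upwards [eventually_ge_atTop 2] with n hn
    rw [hy, ← Finset.sum_subset (Finset.range_mono hn)]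
    · simp [Finset.sum_range_succ, hF]
    · intro j _ hj
      have : 1 < j := by simpa using hj
      simp [hF, show j ≠ 0 by omega, show j ≠ 1 by omega]

theorem congr_le (h : IsProcessNorm P μ nrm) {f g : Ω → E → H}
    (hf : AEStronglyMeasurable (fun y : Ω × E => f y.1 y.2) (P.prod μ))
    (hfg : ∀ᵐ y ∂P.prod μ, g y.1 y.2 = f y.1 y.2) : nrm g ≤ nrm f := by
  have := h.le_add hf (g := fun _ _ => 0) aestronglyMeasurable_const (k := g) (by simpa using hfg)
  rwa [h.zero, add_zero] at this

end IsProcessNorm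

variable {H : Type*} [NormedAddCommGroup H]

theorem enorm_le_tsum_of_tendsto {f : ℕ → H} {g : H}
    (h : Tendsto (fun n => ∑ j ∈ Finset.range n, f j) atTop (𝓝 g)) : ‖g‖ₑ ≤ ∑' j, ‖f j‖ₑ :=
  le_of_tendsto ((continuous_enorm.tendsto _).comp h) (Eventually.of_forall fun _ =>
    (enorm_sum_le _ _).trans (ENNReal.sum_le_tsum _))

theorem isProcessNorm_mixedNorm [SFinite μ] (hp : 1 ≤ p) (hq : 1 ≤ q) :
    IsProcessNorm (H := H) P μ (mixedNorm P μ p q) where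
  zero := by
    have : 0 < p := by linarith
    have : 0 < q := by linarith
    simp [mixedNorm, *]
  neg f := by simp [mixedNorm]
  indicator_le f S _ := by
    refine mixedENorm_mono_ae (by linarith) (by linarith) (Eventually.of_forall fun y => ?_)
    by_cases hy : y.2 ∈ S <;> simp [indicatorProcess, hy]
  le_tsum f g hf hg := by
    refine (mixedENorm_mono_ae (G' := fun ω z => ∑' j, ‖f j ω z‖ₑ) (by linarith) (by linarith) ?_).trans
      (mixedENorm_tsum_le hp hq fun j => (hf j).enorm)
    filter_upwards [hg] with y hy using enorm_le_tsum_of_tendsto hy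
  ae_lt_top f hf h := by
    refine ae_lt_top_of_mixedENorm_ne_top (G := fun ω z => ∑' j, ‖f j ω z‖ₑ) (p := p) (q := q)
      (by linarith) (by linarith) (AEMeasurable.tsum fun j => (hf j).enorm) ?_
    exact ne_top_of_le_ne_top h (mixedENorm_tsum_le hp hq fun j => (hf j).enorm)

theorem isProcessNorm_interNorm [SFinite μ] (hp : 1 ≤ p) :
    IsProcessNorm (H := H) P μ (interNorm P μ p) := by
  have h2 := isProcessNorm_mixedNorm (H := H) (P := P) (μ := μ) hp (one_le_two : (1 : ℝ) ≤ 2)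
  have h1 := isProcessNorm_mixedNorm (H := H) (P := P) (μ := μ) hp hp
  refine ⟨?_, fun f => ?_, fun f S hS => ?_, fun f g hf hg => ?_, fun f hf h => ?_⟩
  · simp [interNorm, h1.zero, h2.zero]
  · simp [interNorm, h1.neg, h2.neg]
  · exact max_le_max (h2.indicator_le f S hS) (h1.indicator_le f S hS)
  · exact max_le ((h2.le_tsum f g hf hg).trans (ENNReal.tsum_le_tsum fun j => le_max_left _ _))
      ((h1.le_tsum f g hf hg).trans (ENNReal.tsum_le_tsum fun j => le_max_right _ _))
  · exact h2.ae_lt_top f hf (ne_top_of_le_ne_top h (ENNReal.tsum_le_tsum fun j => le_max_left _ _))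

/-- Near-optimal decompositions are chosen for all terms at once, with errors summing to less than
`ε`. -/
theorem exists_decomposition {f : ℕ → Ω → E → H} (h : ∑' j, sumNorm P μ p (f j) ≠ ∞)
    {ε : ℝ≥0∞} (hε : ε ≠ 0) : ∃ F₁ F₂ : ℕ → Ω → E → H,
      (∀ j, AEStronglyMeasurable (fun y : Ω × E => F₁ j y.1 y.2) (P.prod μ)) ∧
      (∀ j, AEStronglyMeasurable (fun y : Ω × E => F₂ j y.1 y.2) (P.prod μ)) ∧
      (∀ j, ∀ᵐ y ∂(P.prod μ), f j y.1 y.2 = F₁ j y.1 y.2 + F₂ j y.1 y.2) ∧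
      ∑' j, mixedNorm P μ p 2 (F₁ j) + ∑' j, mixedNorm P μ p p (F₂ j) ≤
        ∑' j, sumNorm P μ p (f j) + ε := by
  obtain ⟨δ, hδ, hδε⟩ := ENNReal.exists_pos_sum_of_countable hε ℕ
  have key : ∀ j, ∃ F₁ F₂ : Ω → E → H,
      AEStronglyMeasurable (fun y : Ω × E => F₁ y.1 y.2) (P.prod μ) ∧
      AEStronglyMeasurable (fun y : Ω × E => F₂ y.1 y.2) (P.prod μ) ∧
      (∀ᵐ y ∂(P.prod μ), f j y.1 y.2 = F₁ y.1 y.2 + F₂ y.1 y.2) ∧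
      mixedNorm P μ p 2 F₁ + mixedNorm P μ p p F₂ ≤ sumNorm P μ p (f j) + δ j := by
    intro j
    have h1 : sumNorm P μ p (f j) < sumNorm P μ p (f j) + δ j :=
      ENNReal.lt_add_right (ne_top_of_le_ne_top h (ENNReal.le_tsum j))
        (ENNReal.coe_ne_zero.2 (hδ j).ne')
    conv_lhs at h1 => rw [sumNorm]
    simp only [iInf_lt_iff] at h1
    obtain ⟨F₁, F₂, a, b, c, d⟩ := h1
    exact ⟨F₁, F₂, a, b, c, d.le⟩
  choose F₁ F₂ a b c d using key
  refine ⟨F₁, F₂, a, b, c, ?_⟩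
  rw [← ENNReal.tsum_add]
  refine (ENNReal.tsum_le_tsum d).trans ?_
  rw [ENNReal.tsum_add]
  exact add_le_add_right hδε.le _

theorem summable_of_tsum_enorm_lt_top [CompleteSpace H] {f : ℕ → H} (h : ∑' j, ‖f j‖ₑ < ∞) :
    Summable f := by
  refine Summable.of_nnnorm ?_
  rw [← ENNReal.tsum_coe_ne_top_iff_summable]
  exact h.ne

/-- The chosen pieces are summed separately. Finiteness of the two series of mixed norms makes both
sums converge absolutely almost everywhere; completeness of `H` provides their limits, which
decompose the limit process. -/
theorem isProcessNorm_sumNorm [SFinite μ] [CompleteSpace H] (hp : 1 ≤ p) :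
    IsProcessNorm (H := H) P μ (sumNorm P μ p) := by
  have h2 := isProcessNorm_mixedNorm (H := H) (P := P) (μ := μ) hp (one_le_two : (1 : ℝ) ≤ 2)
  have h1 := isProcessNorm_mixedNorm (H := H) (P := P) (μ := μ) hp hp
  have hle : ∀ {f f₁ f₂ : Ω → E → H},
      AEStronglyMeasurable (fun y : Ω × E => f₁ y.1 y.2) (P.prod μ) →
      AEStronglyMeasurable (fun y : Ω × E => f₂ y.1 y.2) (P.prod μ) →
      (∀ᵐ y ∂(P.prod μ), f y.1 y.2 = f₁ y.1 y.2 + f₂ y.1 y.2) →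
      sumNorm P μ p f ≤ mixedNorm P μ p 2 f₁ + mixedNorm P μ p p f₂ := fun a b c =>
    iInf₂_le_of_le _ _ (iInf₂_le_of_le a b (iInf_le_of_le c le_rfl))
  have hneg : ∀ f : Ω → E → H, sumNorm P μ p (fun ω z => - f ω z) ≤ sumNorm P μ p f := by
    intro f
    refine le_iInf₂ fun f₁ f₂ => le_iInf₂ fun a b => le_iInf fun c => ?_
    rw [← h2.neg f₁, ← h1.neg f₂]
    refine hle a.neg b.neg ?_
    filter_upwards [c] with y hy
    rw [hy, neg_add]
  refine ⟨?_, fun f => le_antisymm (hneg f) ?_, fun f S hS => ?_, fun f g hf hg => ?_,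
    fun f hf h => ?_⟩
  · refine le_antisymm ((hle (f₁ := fun _ _ => 0) (f₂ := fun _ _ => 0) aestronglyMeasurable_const
      aestronglyMeasurable_const (by simp)).trans ?_) zero_le
    rw [h1.zero, h2.zero, add_zero]
  · simpa using hneg (fun ω z => - f ω z)
  · refine le_iInf₂ fun f₁ f₂ => le_iInf₂ fun a b => le_iInf fun c => ?_
    have hS' : MeasurableSet (Prod.snd ⁻¹' S : Set (Ω × E)) := measurable_snd hS
    refine (hle (a.indicator hS') (b.indicator hS') (f₁ := indicatorProcess f₁ S)
      (f₂ := indicatorProcess f₂ S) ?_).trans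
        (add_le_add (h2.indicator_le _ S hS) (h1.indicator_le _ S hS))
    filter_upwards [c] with y hy
    by_cases hyS : y.2 ∈ S <;> simp [indicatorProcess, hyS, hy]
  · by_cases h : ∑' j, sumNorm P μ p (f j) = ∞
    · rw [h]; exact le_top
    refine ENNReal.le_of_forall_pos_le_add fun ε hε _ => ?_
    obtain ⟨F₁, F₂, a, b, c, d⟩ := exists_decomposition h (ENNReal.coe_ne_zero.2 hε.ne')
    have hfin := ne_top_of_le_ne_top (ENNReal.add_ne_top.2 ⟨h, ENNReal.coe_ne_top⟩) d
    have s1 : ∀ᵐ y ∂P.prod μ, Tendsto (fun n => ∑ j ∈ Finset.range n, F₁ j y.1 y.2) atTop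
        (𝓝 (∑' j, F₁ j y.1 y.2)) := by
      filter_upwards [h2.ae_lt_top F₁ a (ENNReal.add_ne_top.1 hfin).1] with y hy
      exact (summable_of_tsum_enorm_lt_top hy).hasSum.tendsto_sum_nat
    have s2 : ∀ᵐ y ∂P.prod μ, Tendsto (fun n => ∑ j ∈ Finset.range n, F₂ j y.1 y.2) atTop
        (𝓝 (∑' j, F₂ j y.1 y.2)) := by
      filter_upwards [h1.ae_lt_top F₂ b (ENNReal.add_ne_top.1 hfin).2] with y hy
      exact (summable_of_tsum_enorm_lt_top hy).hasSum.tendsto_sum_nat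
    have m1 := aestronglyMeasurable_of_tendsto_ae atTop
      (fun n => Finset.aestronglyMeasurable_fun_sum (Finset.range n) fun j _ => a j) s1
    have m2 := aestronglyMeasurable_of_tendsto_ae atTop
      (fun n => Finset.aestronglyMeasurable_fun_sum (Finset.range n) fun j _ => b j) s2
    refine (hle (f₁ := fun ω z => ∑' j, F₁ j ω z) (f₂ := fun ω z => ∑' j, F₂ j ω z) m1 m2 ?_).trans
      ((add_le_add (h2.le_tsum F₁ _ a s1) (h1.le_tsum F₂ _ b s2)).trans d)
    filter_upwards [s1, s2, hg, ae_all_iff.2 c] with y e1 e2 e3 e4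
    refine tendsto_nhds_unique e3 ?_
    simp only [e4, Finset.sum_add_distrib]
    exact e1.add e2
  · obtain ⟨F₁, F₂, a, b, c, d⟩ := exists_decomposition h one_ne_zero
    have hfin := ne_top_of_le_ne_top (ENNReal.add_ne_top.2 ⟨h, ENNReal.one_ne_top⟩) d
    filter_upwards [h2.ae_lt_top F₁ a (ENNReal.add_ne_top.1 hfin).1,
      h1.ae_lt_top F₂ b (ENNReal.add_ne_top.1 hfin).2, ae_all_iff.2 c] with y e1 e2 e3
    refine lt_of_le_of_lt ?_ (ENNReal.add_lt_top.2 ⟨e1, e2⟩)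
    rw [← ENNReal.tsum_add]
    refine ENNReal.tsum_le_tsum fun j => ?_
    rw [e3]
    exact enorm_add_le _ _

end ProcessNorm

/-! ### Simple adapted processes as elementary processes -/

/-- A measurable version is cut off at the essential supremum; this changes it only on a null set
and keeps measurability with respect to the small σ-algebra. -/
theorem exists_bounded_version {Ω 𝕜 : Type*} {m m0 : MeasurableSpace Ω} [NormedAddCommGroup 𝕜]
    {P : Measure Ω} {F : Ω → 𝕜} (hF : AEStronglyMeasurable[m] F P) (hb : eLpNorm F ⊤ P < ∞) :
    ∃ F' : Ω → 𝕜, StronglyMeasurable[m] F' ∧ (∃ K : ℝ, ∀ ω, ‖F' ω‖ ≤ K) ∧ F =ᵐ[P] F' := by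
  classical
  set K := (eLpNorm F ⊤ P).toReal with hK
  have hm := hF.stronglyMeasurable_mk
  refine ⟨{ω | ‖hF.mk F ω‖ ≤ K}.indicator (hF.mk F),
    hm.indicator (measurableSet_le hm.norm.measurable measurable_const), ⟨K, fun ω => ?_⟩, ?_⟩
  · by_cases h : ω ∈ {ω | ‖hF.mk F ω‖ ≤ K}
    · rw [indicator_of_mem h]; exact h
    · rw [indicator_of_notMem h, norm_zero]; exact ENNReal.toReal_nonneg
  · have h1 : ∀ᵐ ω ∂P, ‖F ω‖ₑ ≤ eLpNorm F ⊤ P := by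
      rw [eLpNorm_exponent_top]; exact ae_le_eLpNormEssSup
    filter_upwards [h1, hF.ae_eq_mk] with ω h2 h3
    have h4 : ω ∈ {ω | ‖hF.mk F ω‖ ≤ K} := by
      change ‖hF.mk F ω‖ ≤ K
      rw [← h3, hK, ← toReal_enorm]
      exact ENNReal.toReal_mono hb.ne h2
    rw [indicator_of_mem h4, h3]

namespace SimpleAdapted

variable {𝕜 : Type uK} [RCLike 𝕜] {Ω : Type uΩ} [MeasurableSpace Ω] {P : Measure Ω}
  {J : Type uJ} [MeasurableSpace J] {ν : Measure J} {N : Ω → Measure (ℝ≥0 × J)}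
  {H : Type uH} [NormedAddCommGroup H]

section

variable [NormedSpace 𝕜 H]

theorem indicator_toFun (φ : SimpleAdapted 𝕜 P ν N H) (S : Set (ℝ≥0 × J)) (ω : Ω) (z : ℝ≥0 × J) :
    indicatorProcess φ.toFun S ω z = ∑ i, ∑ j, ∑ k,
      (S ∩ Ioc (φ.t i.castSucc) (φ.t i.succ) ×ˢ φ.A j).indicator
        (fun _ => φ.F i j k ω • φ.x i j k) z := by
  by_cases hz : z ∈ S
  · rw [indicatorProcess, indicator_of_mem hz, toFun]
    refine Finset.sum_congr rfl fun i _ => Finset.sum_congr rfl fun j _ =>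
      Finset.sum_congr rfl fun k _ => ?_
    by_cases h : z ∈ Ioc (φ.t i.castSucc) (φ.t i.succ) ×ˢ φ.A j
    · rw [indicator_of_mem h, indicator_of_mem (show z ∈ S ∩ _ from ⟨hz, h⟩)]
    · rw [indicator_of_notMem h, indicator_of_notMem fun h' => h h'.2]
  · rw [indicatorProcess, indicator_of_notMem hz]
    refine (Finset.sum_eq_zero fun i _ => Finset.sum_eq_zero fun j _ =>
      Finset.sum_eq_zero fun k _ => indicator_of_notMem (fun h' => hz h'.1) _).symm

theorem t_le_last (φ : SimpleAdapted 𝕜 P ν N H) (i : Fin (φ.l + 1)) : φ.t i ≤ φ.t (Fin.last _) :=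
  φ.t_strictMono.monotone (Fin.le_last i)

theorem indicatorProcess_toFun_eq (φ : SimpleAdapted 𝕜 P ν N H) {T : ℝ≥0}
    (hT : φ.t (Fin.last _) ≤ T) (B : Set J) :
    indicatorProcess φ.toFun (Ioc 0 T ×ˢ B) = indicatorProcess φ.toFun (univ ×ˢ B) := by
  funext ω z
  rw [indicator_toFun, indicator_toFun]
  refine Finset.sum_congr rfl fun i _ => Finset.sum_congr rfl fun j _ =>
    Finset.sum_congr rfl fun k _ => ?_
  congr 1
  ext ⟨τ, x⟩
  simp only [mem_inter_iff, mem_prod, mem_Ioc, mem_univ, true_and, and_congr_left_iff,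
    and_iff_right_iff_imp]
  exact fun h _ => ⟨(zero_le).trans_lt h.1.1, h.1.2.trans ((φ.t_le_last _).trans hT)⟩

theorem integral_min_eq (φ : SimpleAdapted 𝕜 P ν N H) {T : ℝ≥0}
    (hT : φ.t (Fin.last _) ≤ T) (B : Set J) (τ : ℝ≥0) :
    φ.integral (min τ T) B = φ.integral τ B := by
  have e : ∀ i, min (φ.t i) (min τ T) = min (φ.t i) τ := fun i => by
    rw [min_comm τ T, ← min_assoc, min_eq_left ((φ.t_le_last i).trans hT)]
  funext ω
  simp only [integral, e]

/-- Every simple adapted process, restricted to `(0, T] × B`, is elementary. -/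
theorem exists_isElementary [InnerProductSpace ℝ H]
    (hsmul : ∀ (r : ℝ) (x : H), r • x = (r : 𝕜) • x)
    (φ : SimpleAdapted 𝕜 P ν N H) (T : ℝ≥0) {B : Set J} (hB : MeasurableSet B) :
    ∃ (ι : Type) (_ : Fintype ι) (s u : ι → ℝ≥0) (A : ι → Set J) (ζ : ι → Ω → H),
      IsElementary ν N s A ζ ∧ (∀ a, u a ≤ T) ∧
      (∀ᵐ ω ∂P, ∀ z, elemProc s u A ζ ω z = indicatorProcess φ.toFun (Ioc 0 T ×ˢ B) ω z) ∧
      (∀ᵐ ω ∂P, ∀ τ, elemInt ν N s u A ζ τ ω = φ.integral (min τ T) B ω) := by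
  choose F' hm hb hae using fun i j k => exists_bounded_version (φ.F_meas i j k) (φ.F_bdd i j k)
  choose K hK using hb
  have hall : ∀ᵐ ω ∂P, ∀ i j k, φ.F i j k ω = F' i j k ω :=
    ae_all_iff.2 fun i => ae_all_iff.2 fun j => ae_all_iff.2 fun k => hae i j k
  refine ⟨Fin φ.l × Fin φ.m × Fin φ.n, inferInstance, fun a => φ.t a.1.castSucc,
    fun a => min (φ.t a.1.succ) T, fun a => φ.A a.2.1 ∩ B,
    fun a ω => F' a.1 a.2.1 a.2.2 ω • φ.x a.1 a.2.1 a.2.2, ⟨fun a => (φ.A_meas _).inter hB,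
      fun a => (measure_mono inter_subset_left).trans_lt (φ.A_fin _),
      fun a => (hm _ _ _).smul_const _, ?_⟩, fun a => min_le_right _ _, ?_, ?_⟩
  · refine ⟨∑ a : Fin φ.l × Fin φ.m × Fin φ.n,
      ‖K a.1 a.2.1 a.2.2‖ * ‖φ.x a.1 a.2.1 a.2.2‖, fun a ω => ?_⟩
    rw [norm_smul]
    refine le_trans ?_ (Finset.single_le_sum (f := fun a : Fin φ.l × Fin φ.m × Fin φ.n =>
      ‖K a.1 a.2.1 a.2.2‖ * ‖φ.x a.1 a.2.1 a.2.2‖) (fun _ _ => by positivity) (Finset.mem_univ a))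
    gcongr
    exact (hK _ _ _ ω).trans (Real.le_norm_self _)
  · filter_upwards [hall] with ω hω z
    rw [indicator_toFun]
    simp only [elemProc, Fintype.sum_prod_type, hω]
    refine Finset.sum_congr rfl fun i _ => Finset.sum_congr rfl fun j _ =>
      Finset.sum_congr rfl fun k _ => ?_
    congr 1
    ext ⟨τ, x⟩
    simp only [mem_inter_iff, mem_prod, mem_Ioc, le_min_iff]
    exact ⟨fun h => ⟨⟨⟨(zero_le).trans_lt h.1.1, h.1.2.2⟩, h.2.2⟩, ⟨h.1.1, h.1.2.1⟩, h.2.1⟩,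
      fun h => ⟨⟨h.2.1.1, h.2.1.2, h.1.1.2⟩, h.2.2, h.1.2⟩⟩
  · filter_upwards [hall] with ω hω τ
    simp only [elemInt, integral, Fintype.sum_prod_type, hω]
    refine Finset.sum_congr rfl fun i _ => Finset.sum_congr rfl fun j _ =>
      Finset.sum_congr rfl fun k _ => ?_
    have e : Ioc (min (φ.t i.castSucc) τ) (min (min (φ.t i.succ) T) τ) =
        Ioc (min (φ.t i.castSucc) (min τ T)) (min (φ.t i.succ) (min τ T)) := by
      ext r
      simp only [mem_Ioc, min_lt_iff, le_min_iff]
      constructor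
      · rintro ⟨h1, ⟨h2, h3⟩, h4⟩
        exact ⟨h1.imp_right Or.inl, h2, h4, h3⟩
      · rintro ⟨h1, h2, h4, h3⟩
        refine ⟨?_, ⟨h2, h3⟩, h4⟩
        rcases h1 with h1 | h1 | h1
        · exact Or.inl h1
        · exact Or.inr h1
        · exact absurd h3 (not_le.2 h1)
    rw [e, hsmul, smul_smul, mul_comm]

/-- The difference of two simple adapted processes, restricted to `(0, T] × B`, is elementary. -/
theorem exists_isElementary_sub [InnerProductSpace ℝ H]
    (hsmul : ∀ (r : ℝ) (x : H), r • x = (r : 𝕜) • x)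
    (φ ψ : SimpleAdapted 𝕜 P ν N H) (T : ℝ≥0) {B : Set J} (hB : MeasurableSet B) :
    ∃ (ι : Type) (_ : Fintype ι) (s u : ι → ℝ≥0) (A : ι → Set J) (ζ : ι → Ω → H),
      IsElementary ν N s A ζ ∧ (∀ a, u a ≤ T) ∧
      (∀ᵐ ω ∂P, ∀ z, elemProc s u A ζ ω z =
        indicatorProcess (fun ω z => φ.toFun ω z - ψ.toFun ω z) (Ioc 0 T ×ˢ B) ω z) ∧
      (∀ᵐ ω ∂P, elemInt ν N s u A ζ T ω = φ.integral T B ω - ψ.integral T B ω) := by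
  obtain ⟨ι, _, s, u, A, ζ, h, hu, hp, hi⟩ := exists_isElementary hsmul φ T hB
  obtain ⟨ι', _, s', u', A', ζ', h', hu', hp', hi'⟩ := exists_isElementary hsmul ψ T hB
  obtain ⟨K, hK⟩ := h.bdd
  obtain ⟨K', hK'⟩ := h'.bdd
  -- Elementary processes need neither disjoint sets nor a common partition, so a difference is a
  -- mere juxtaposition of the two families of boxes.
  refine ⟨ι ⊕ ι', inferInstance, Sum.elim s s', Sum.elim u u', Sum.elim A A',
    Sum.elim ζ fun a ω => - ζ' a ω, ⟨?_, ?_, ?_, max K K', ?_⟩, ?_, ?_, ?_⟩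
  · rintro (a | a)
    exacts [h.A_meas a, h'.A_meas a]
  · rintro (a | a)
    exacts [h.A_fin a, h'.A_fin a]
  · rintro (a | a)
    exacts [h.meas a, (h'.meas a).neg]
  · rintro (a | a) ω
    · exact (hK a ω).trans (le_max_left _ _)
    · simpa using Or.inr (hK' a ω)
  · rintro (a | a)
    exacts [hu a, hu' a]
  · filter_upwards [hp, hp'] with ω e e' z
    have e1 : indicatorProcess (fun ω z => φ.toFun ω z - ψ.toFun ω z) (Ioc 0 T ×ˢ B) ω z =
        indicatorProcess φ.toFun (Ioc 0 T ×ˢ B) ω z - indicatorProcess ψ.toFun (Ioc 0 T ×ˢ B) ω z :=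
      congrFun (indicator_sub _ _ _) z
    rw [e1, ← e, ← e', sub_eq_add_neg]
    simp only [elemProc, Fintype.sum_sum_type, Sum.elim_inl, Sum.elim_inr, ← Finset.sum_neg_distrib]
    congr 1
    refine Finset.sum_congr rfl fun a _ => ?_
    by_cases hz : z ∈ Ioc (s' a) (u' a) ×ˢ A' a
    · rw [indicator_of_mem hz, indicator_of_mem hz]
    · rw [indicator_of_notMem hz, indicator_of_notMem hz, neg_zero]
  · filter_upwards [hi, hi'] with ω e e'
    have e1 := e T
    have e1' := e' T
    rw [min_self] at e1 e1'
    rw [← e1, ← e1', sub_eq_add_neg]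
    simp only [elemInt, Fintype.sum_sum_type, Sum.elim_inl, Sum.elim_inr, smul_neg,
      Finset.sum_neg_distrib]

/-- The restriction of a simple adapted process to `(0, T]` is simple and adapted. -/
theorem exists_restrict (φ : SimpleAdapted 𝕜 P ν N H) {T : ℝ≥0} :
    ∃ ψ : SimpleAdapted 𝕜 P ν N H, ψ.toFun = indicatorProcess φ.toFun (Ioc 0 T ×ˢ univ) := by
  classical
  -- `n` is the number of intervals kept: the first index whose time reaches `T`, or all of them if
  -- there is none. Their left endpoints lie before `T`, so the coefficients stay adapted.
  have hex : ∃ n, n = φ.l ∨ ∃ h : n < φ.l + 1, T ≤ φ.t ⟨n, h⟩ := ⟨φ.l, Or.inl rfl⟩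
  obtain ⟨n, hn, hmin⟩ : ∃ n, (n = φ.l ∨ ∃ h : n < φ.l + 1, T ≤ φ.t ⟨n, h⟩) ∧
      ∀ m < n, ¬ (m = φ.l ∨ ∃ h : m < φ.l + 1, T ≤ φ.t ⟨m, h⟩) :=
    ⟨Nat.find hex, Nat.find_spec hex, fun m hm => Nat.find_min hex hm⟩
  have hnl : n ≤ φ.l := by
    rcases hn with h | ⟨h, -⟩ <;> omega
  have hlt : ∀ m (h : m < φ.l + 1), m < n → φ.t ⟨m, h⟩ < T := fun m h hm =>
    not_le.1 fun h' => hmin m hm (Or.inr ⟨h, h'⟩)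
  have hge : ∀ m (h : m < φ.l), n ≤ m → T ≤ φ.t ⟨m, h.trans (Nat.lt_succ_self _)⟩ := by
    intro m h hm
    rcases hn with h' | ⟨h', h''⟩
    · omega
    · exact h''.trans (φ.t_strictMono.monotone hm)
  set e : Fin n → Fin φ.l := Fin.castLE hnl with he
  refine ⟨⟨n, φ.m, φ.n, fun k => min (φ.t (Fin.castLE (by omega) k)) T, ?_, ?_, φ.A, φ.A_meas,
    φ.A_disj, φ.A_fin, fun i => φ.F (e i), ?_, fun i j k => φ.F_bdd _ _ _, fun i => φ.x (e i)⟩, ?_⟩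
  · have : (Fin.castLE (by omega) (0 : Fin (n + 1)) : Fin (φ.l + 1)) = 0 := rfl
    rw [this, φ.t_zero]
    exact min_eq_left zero_le
  · intro a b hab
    have h1 := hlt a.1 (by omega) (by omega)
    exact lt_min ((min_le_left _ _).trans_lt (φ.t_strictMono hab)) ((min_le_left _ _).trans_lt h1)
  · intro i j k
    have h1 := hlt i.1 (by omega) i.2
    have h2 : min (φ.t (Fin.castLE (by omega) i.castSucc)) T = φ.t (e i).castSucc := min_eq_left h1.le
    rw [h2]
    exact φ.F_meas _ _ _
  · funext ω z
    rw [indicator_toFun]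
    refine Fintype.sum_of_injective e (Fin.castLE_injective hnl) _ _ (fun i hi => ?_) fun i => ?_
    · have hi' : n ≤ i.1 := by
        by_contra h
        exact hi ⟨⟨i.1, by omega⟩, rfl⟩
      have h1 := hge i.1 i.2 hi'
      refine Finset.sum_eq_zero fun j _ => Finset.sum_eq_zero fun k _ =>
        indicator_of_notMem (fun h => ?_) _
      exact absurd (h.1.1.2.trans h1) (not_le.2 h.2.1.1)
    · refine Finset.sum_congr rfl fun j _ => Finset.sum_congr rfl fun k _ => ?_
      congr 1
      have h1 := hlt i.1 (by omega) i.2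
      have h2 : min (φ.t (Fin.castLE (by omega) i.castSucc)) T = φ.t (e i).castSucc :=
        min_eq_left h1.le
      have h3 : min (φ.t (Fin.castLE (by omega) i.succ)) T = min (φ.t (e i).succ) T := rfl
      ext ⟨τ, x⟩
      simp only [mem_inter_iff, mem_prod, mem_Ioc, h2, h3, le_min_iff, mem_univ, and_true]
      exact ⟨fun h => ⟨⟨(zero_le).trans_lt h.1.1, h.1.2.2⟩, ⟨h.1.1, h.1.2.1⟩, h.2⟩,
        fun h => ⟨⟨h.2.1.1, h.2.1.2, h.1.2⟩, h.2.2⟩⟩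

end

end SimpleAdapted

/-! ### Estimates for simple adapted processes -/

/-- A two-sided estimate for the stochastic integrals of elementary processes. -/
def ElementaryEstimate {Ω : Type uΩ} [MeasurableSpace Ω] (P : Measure Ω) {J : Type uJ}
    [MeasurableSpace J] (ν : Measure J) (N : Ω → Measure (ℝ≥0 × J)) {H : Type uH}
    [NormedAddCommGroup H] [InnerProductSpace ℝ H] (p : ℝ) (nrm : (Ω → ℝ≥0 × J → H) → ℝ≥0∞)
    (C : ℝ≥0) : Prop :=
  ∀ {ι : Type} [Fintype ι] {s u : ι → ℝ≥0} {A : ι → Set J} {ζ : ι → Ω → H},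
    IsElementary ν N s A ζ → ∀ t, (∀ a, u a ≤ t) →
      (∫⁻ ω, ‖elemInt ν N s u A ζ t ω‖ₑ ^ p ∂P) ^ (1 / p) ≤ C * nrm (elemProc s u A ζ) ∧
      nrm (elemProc s u A ζ) ≤ C * (∫⁻ ω, ‖elemInt ν N s u A ζ t ω‖ₑ ^ p ∂P) ^ (1 / p)

theorem eLpNorm_ofReal {Ω F : Type*} [MeasurableSpace Ω] [NormedAddCommGroup F] {P : Measure Ω}
    {p : ℝ} (hp : 0 < p) (f : Ω → F) :
    eLpNorm f (ENNReal.ofReal p) P = (∫⁻ ω, ‖f ω‖ₑ ^ p ∂P) ^ (1 / p) := by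
  rw [eLpNorm_eq_lintegral_rpow_enorm_toReal (by simpa using hp) ENNReal.ofReal_ne_top,
    ENNReal.toReal_ofReal hp.le]

theorem aestronglyMeasurable_indicatorProcess {Ω J H : Type*} [MeasurableSpace Ω]
    [MeasurableSpace J] [NormedAddCommGroup H] {P : Measure Ω} {ν : Measure J} {φ : Ω → ℝ≥0 × J → H}
    (h : AEStronglyMeasurable (fun y : Ω × (ℝ≥0 × J) => φ y.1 y.2) (P.prod (timeMeasure.prod ν)))
    {S : Set (ℝ≥0 × J)} (hS : MeasurableSet S) :
    AEStronglyMeasurable (fun y : Ω × (ℝ≥0 × J) => indicatorProcess φ S y.1 y.2)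
      (P.prod (timeMeasure.prod ν)) :=
  h.indicator (s := Prod.snd ⁻¹' S) (measurable_snd hS)

/-- The strips `(0, t] × J` miss time zero, which must be a null set for local convergence to give
convergence almost everywhere. -/
theorem ae_time_pos {Ω J : Type*} [MeasurableSpace Ω] [MeasurableSpace J] (P : Measure Ω)
    (ν : Measure J) : ∀ᵐ y ∂P.prod (timeMeasure.prod ν), 0 < y.2.1 := by
  have h0 : timeMeasure {0} = 0 := by
    rw [timeMeasure, measurableEmbedding_toReal.comap_apply, image_singleton, Real.volume_singleton]
  have h1 : ∀ᵐ τ ∂timeMeasure, 0 < τ := by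
    refine (ae_iff (μ := timeMeasure)).2 (measure_mono_null (fun τ hτ => ?_) h0)
    exact le_antisymm (not_lt.1 hτ) zero_le
  have h2 : ∀ᵐ z ∂timeMeasure.prod ν, 0 < z.1 := Measure.quasiMeasurePreserving_fst.ae h1
  exact Measure.quasiMeasurePreserving_snd.ae h2

namespace SimpleAdapted

variable {𝕜 : Type uK} [RCLike 𝕜] {Ω : Type uΩ} [MeasurableSpace Ω] {P : Measure Ω}
  [IsProbabilityMeasure P] {J : Type uJ} [MeasurableSpace J] {ν : Measure J} [SigmaFinite ν]
  {N : Ω → Measure (ℝ≥0 × J)} {H : Type uH} [NormedAddCommGroup H] [NormedSpace 𝕜 H]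

theorem aestronglyMeasurable_toFun (hN : IsPoissonRandomMeasure P N (timeMeasure.prod ν))
    (φ : SimpleAdapted 𝕜 P ν N H) :
    AEStronglyMeasurable (fun y : Ω × (ℝ≥0 × J) => φ.toFun y.1 y.2)
      (P.prod (timeMeasure.prod ν)) := by
  refine Finset.aestronglyMeasurable_fun_sum _ fun i _ => Finset.aestronglyMeasurable_fun_sum _
    fun j _ => Finset.aestronglyMeasurable_fun_sum _ fun k _ => ?_
  have h1 : AEStronglyMeasurable (φ.F i j k) P := (φ.F_meas i j k).mono (natFiltration_le hN _)
  have h2 : AEStronglyMeasurable (fun y : Ω × (ℝ≥0 × J) => φ.F i j k y.1 • φ.x i j k)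
    (P.prod (timeMeasure.prod ν)) := (h1.smul_const _).comp_fst
  exact h2.indicator (s := Prod.snd ⁻¹' (Ioc (φ.t i.castSucc) (φ.t i.succ) ×ˢ φ.A j))
    (measurable_snd (measurableSet_Ioc.prod (φ.A_meas j)))

/-! ### Transfer of the estimates to simple processes. -/

section Real

variable [InnerProductSpace ℝ H] {p : ℝ} {nrm : (Ω → ℝ≥0 × J → H) → ℝ≥0∞} {C : ℝ≥0}

theorem memLp_integral (hsmul : ∀ (r : ℝ) (x : H), r • x = (r : 𝕜) • x)
    (hN : IsPoissonRandomMeasure P N (timeMeasure.prod ν)) (hp : 1 ≤ p)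
    (φ : SimpleAdapted 𝕜 P ν N H) (T : ℝ≥0) {B : Set J} (hB : MeasurableSet B) :
    MemLp (φ.integral T B) (ENNReal.ofReal p) P := by
  obtain ⟨ι, _, s, u, A, ζ, h, hu, -, hi⟩ := exists_isElementary hsmul φ T hB
  obtain ⟨n, 𝒢, c, D, ξ, hs, -, -, hend⟩ := exists_steps (u := u) hN h ∅
  refine (hs.memLp_stepSum hp n).ae_eq ?_
  filter_upwards [hi, hend T hu] with ω h1 h2
  rw [← h2, h1, min_self]

theorem nrm_eq_of_ae (hN : IsPoissonRandomMeasure P N (timeMeasure.prod ν))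
    (hnrm : IsProcessNorm P (timeMeasure.prod ν) nrm) {ι : Type} [Fintype ι] {s u : ι → ℝ≥0}
    {A : ι → Set J} {ζ : ι → Ω → H} (h : IsElementary ν N s A ζ) {f : Ω → ℝ≥0 × J → H}
    (hf : ∀ᵐ ω ∂P, ∀ z, elemProc s u A ζ ω z = f ω z) : nrm (elemProc s u A ζ) = nrm f := by
  have h1 : ∀ᵐ y ∂P.prod (timeMeasure.prod ν), elemProc s u A ζ y.1 y.2 = f y.1 y.2 := by
    filter_upwards [Measure.quasiMeasurePreserving_fst.ae hf] with y hy using hy _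
  have h2 := (h.stronglyMeasurable_elemProc (u := u) hN).aestronglyMeasurable
    (μ := P.prod (timeMeasure.prod ν))
  exact le_antisymm (hnrm.congr_le (h2.congr h1) h1)
    (hnrm.congr_le h2 (h1.mono fun y hy => hy.symm))

theorem eLpNorm_integral_sub_estimate (hsmul : ∀ (r : ℝ) (x : H), r • x = (r : 𝕜) • x)
    (hN : IsPoissonRandomMeasure P N (timeMeasure.prod ν)) (hp : 0 < p)
    (hnrm : IsProcessNorm P (timeMeasure.prod ν) nrm) (hE : ElementaryEstimate P ν N p nrm C)
    (φ ψ : SimpleAdapted 𝕜 P ν N H) (T : ℝ≥0) {B : Set J} (hB : MeasurableSet B) :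
    eLpNorm (fun ω => φ.integral T B ω - ψ.integral T B ω) (ENNReal.ofReal p) P ≤
      C * nrm (indicatorProcess (fun ω z => φ.toFun ω z - ψ.toFun ω z) (Ioc 0 T ×ˢ B)) ∧
    nrm (indicatorProcess (fun ω z => φ.toFun ω z - ψ.toFun ω z) (Ioc 0 T ×ˢ B)) ≤
      C * eLpNorm (fun ω => φ.integral T B ω - ψ.integral T B ω) (ENNReal.ofReal p) P := by
  obtain ⟨ι, _, s, u, A, ζ, h, hu, hpr, hi⟩ := exists_isElementary_sub hsmul φ ψ T hB
  have h1 := hE h T hu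
  rw [nrm_eq_of_ae hN hnrm h hpr, ← eLpNorm_ofReal hp, eLpNorm_congr_ae hi] at h1
  exact h1

theorem maximalNorm_estimate (hsmul : ∀ (r : ℝ) (x : H), r • x = (r : 𝕜) • x)
    (hN : IsPoissonRandomMeasure P N (timeMeasure.prod ν)) (hp : 1 < p)
    (hnrm : IsProcessNorm P (timeMeasure.prod ν) nrm) (hE : ElementaryEstimate P ν N p nrm C)
    (φ : SimpleAdapted 𝕜 P ν N H) {B : Set J} (hB : MeasurableSet B) :
    nrm (indicatorProcess φ.toFun (univ ×ˢ B)) ≤ C * φ.maximalNorm p B ∧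
    φ.maximalNorm p B ≤ ((2 * (p / (p - 1)) * ((p - 1) / (2 * p)) ^ (1 - p)).toNNReal ^ (1 / p) * C :
      ℝ≥0) * nrm (indicatorProcess φ.toFun (univ ×ˢ B)) := by
  have hp0 : 0 < p := by linarith
  -- The supremum runs over `t > 0`, while the last grid time is `0` when there are no intervals;
  -- adding `1` gives a positive admissible time.
  set T := φ.t (Fin.last _) + 1
  have hT : φ.t (Fin.last _) ≤ T := le_self_add
  have hT0 : 0 < T := by positivity
  obtain ⟨ι, _, s, u, A, ζ, h, hu, hpr, hi⟩ := exists_isElementary hsmul φ T hB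
  simp only [φ.integral_min_eq hT] at hi
  rw [φ.indicatorProcess_toFun_eq hT] at hpr
  obtain ⟨h1, h2⟩ := hE h T hu
  rw [nrm_eq_of_ae hN hnrm h hpr] at h1 h2
  constructor
  · refine h2.trans (mul_le_mul_right (ENNReal.rpow_le_rpow (lintegral_mono_ae ?_)
      (by positivity)) _)
    filter_upwards [hi] with ω hω
    rw [hω T]
    exact le_iSup₂_of_le T hT0 le_rfl
  · have h3 : φ.maximalNorm p B ^ p ≤
        ((2 * (p / (p - 1)) * ((p - 1) / (2 * p)) ^ (1 - p)).toNNReal : ℝ≥0∞) *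
          ∫⁻ ω, ‖elemInt ν N s u A ζ T ω‖ₑ ^ p ∂P := by
      rw [maximalNorm, ← ENNReal.rpow_mul, one_div_mul_cancel hp0.ne', ENNReal.rpow_one]
      refine le_trans (lintegral_mono_ae ?_) (h.lintegral_iSup_le hp hN hu)
      filter_upwards [hi] with ω hω
      refine iSup₂_le fun t _ => ?_
      rw [← hω t]
      exact le_iSup (fun t => ‖elemInt ν N s u A ζ t ω‖ₑ ^ p) t
    refine (le_mul_of_rpow_le hp0 h3).trans ?_
    rw [ENNReal.coe_mul]
    exact (mul_le_mul_right h1 _).trans_eq (mul_assoc _ _ _).symm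

end Real

/-- A sequence of simple adapted processes whose integrals converge is a Cauchy sequence of
integrands. -/
theorem locallyInClosure_of_isLpStochIntegrable {p : ℝ} (hp : 1 ≤ p)
    {nrm : (Ω → ℝ≥0 × J → H) → ℝ≥0∞} {C : ℝ≥0}
    (hN : IsPoissonRandomMeasure P N (timeMeasure.prod ν))
    (hnrm : IsProcessNorm P (timeMeasure.prod ν) nrm)
    (hmem : ∀ (φ : SimpleAdapted 𝕜 P ν N H) (T : ℝ≥0) (B : Set J), MeasurableSet B →
      MemLp (φ.integral T B) (ENNReal.ofReal p) P)
    (hlow : ∀ (φ ψ : SimpleAdapted 𝕜 P ν N H) (T : ℝ≥0) (B : Set J), MeasurableSet B →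
      nrm (indicatorProcess (fun ω z => φ.toFun ω z - ψ.toFun ω z) (Ioc 0 T ×ˢ B)) ≤
        C * eLpNorm (fun ω => φ.integral T B ω - ψ.integral T B ω) (ENNReal.ofReal p) P)
    {φ : Ω → ℝ≥0 × J → H} (h : IsLpStochIntegrable 𝕜 P ν N p φ) :
    LocallyInClosure 𝕜 P ν N nrm φ := by
  obtain ⟨φn, hφ, hI⟩ := h
  refine ⟨aestronglyMeasurable_of_tendsto_ae atTop
    (fun n => aestronglyMeasurable_toFun hN (φn n)) hφ, fun t ht ε hε => ?_⟩
  obtain ⟨Y, hY, hlim⟩ := hI univ MeasurableSet.univ t ht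
  have hp' : 1 ≤ ENNReal.ofReal p := by simpa using ENNReal.ofReal_le_ofReal hp
  have hC : (C : ℝ≥0∞) * 2 + 1 ≠ ∞ :=
    ENNReal.add_ne_top.2 ⟨ENNReal.mul_ne_top ENNReal.coe_ne_top (by norm_num), ENNReal.one_ne_top⟩
  obtain ⟨δ, hδ, hδε⟩ := ENNReal.exists_pos_sum_of_countable
    (ENNReal.div_ne_zero.2 ⟨hε.ne', hC⟩) ℕ
  -- A subsequence with summable errors, so that consecutive differences of integrands have summable
  -- norms by the lower estimate.
  obtain ⟨k, hk, hkδ⟩ := extraction_forall_of_eventually (P := fun j n => ∀ m, n ≤ m →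
    eLpNorm (fun ω => (φn m).integral t univ ω - Y ω) (ENNReal.ofReal p) P ≤ δ j) fun j =>
      eventually_forall_ge_atTop.2 (hlim.eventually_le_const (ENNReal.coe_pos.2 (hδ j)))
  set f : ℕ → Ω → ℝ≥0 × J → H := fun j => indicatorProcess
    (fun ω z => (φn (k (j + 1))).toFun ω z - (φn (k j)).toFun ω z) (Ioc 0 t ×ˢ univ) with hf
  have hS : MeasurableSet (Ioc 0 t ×ˢ (univ : Set J)) := measurableSet_Ioc.prod MeasurableSet.univ
  have hfm : ∀ j, AEStronglyMeasurable (fun y : Ω × (ℝ≥0 × J) => f j y.1 y.2)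
      (P.prod (timeMeasure.prod ν)) := fun j =>
    aestronglyMeasurable_indicatorProcess ((aestronglyMeasurable_toFun hN _).sub
      (aestronglyMeasurable_toFun hN _)) hS
  have hfδ : ∀ j, nrm (f j) ≤ (C * 2) * δ j := by
    intro j
    refine (hlow _ _ t univ MeasurableSet.univ).trans ?_
    rw [mul_assoc]
    refine mul_le_mul_right ?_ _
    have e : (fun ω => (φn (k (j + 1))).integral t univ ω - (φn (k j)).integral t univ ω) =
        (fun ω => (φn (k (j + 1))).integral t univ ω - Y ω) -
          (fun ω => (φn (k j)).integral t univ ω - Y ω) := by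
      funext ω; simp
    rw [e, two_mul]
    refine (eLpNorm_sub_le ((hmem _ t univ MeasurableSet.univ).sub hY).aestronglyMeasurable
      ((hmem _ t univ MeasurableSet.univ).sub hY).aestronglyMeasurable hp').trans
        (add_le_add (hkδ j _ (hk (Nat.lt_succ_self j)).le) (hkδ j _ le_rfl))
  -- The differences telescope to `φ` minus the first member of the subsequence, both restricted to
  -- `(0, t]`; countable subadditivity bounds this by less than `ε`.
  obtain ⟨ψ, hψ⟩ := exists_restrict (φn (k 0)) (T := t)
  refine ⟨ψ, (hnrm.le_tsum f _ hfm ?_).trans_lt ?_⟩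
  · filter_upwards [hφ] with y hy
    have h1 : Tendsto (fun n => (φn (k n)).toFun y.1 y.2 - (φn (k 0)).toFun y.1 y.2) atTop
        (𝓝 (φ y.1 y.2 - (φn (k 0)).toFun y.1 y.2)) :=
      (hy.comp hk.tendsto_atTop).sub_const _
    rw [hψ]
    by_cases hz : y.2 ∈ Ioc 0 t ×ˢ (univ : Set J)
    · simp only [hf, indicatorProcess, indicator_of_mem hz]
      refine h1.congr fun n => ?_
      rw [Finset.sum_range_sub (fun n => (φn (k n)).toFun y.1 y.2)]
    · simp [hf, indicatorProcess, indicator_of_notMem hz]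
  · calc ∑' j, nrm (f j) ≤ ∑' j, (C * 2) * (δ j : ℝ≥0∞) := ENNReal.tsum_le_tsum hfδ
      _ = (C * 2) * ∑' j, (δ j : ℝ≥0∞) := ENNReal.tsum_mul_left
      _ ≤ (C * 2 + 1) * ∑' j, (δ j : ℝ≥0∞) := by gcongr; exact le_self_add
      _ < ε := by
        rw [mul_comm]
        exact ENNReal.mul_lt_of_lt_div hδε

/-- A process that is locally in the closure of the simple adapted processes is the limit of simple
adapted processes whose integrals converge. -/
theorem isLpStochIntegrable_of_locallyInClosure {p : ℝ} (hp : 1 ≤ p)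
    {nrm : (Ω → ℝ≥0 × J → H) → ℝ≥0∞} {C : ℝ≥0} [CompleteSpace H]
    (hN : IsPoissonRandomMeasure P N (timeMeasure.prod ν))
    (hnrm : IsProcessNorm P (timeMeasure.prod ν) nrm)
    (hmem : ∀ (φ : SimpleAdapted 𝕜 P ν N H) (T : ℝ≥0) (B : Set J), MeasurableSet B →
      MemLp (φ.integral T B) (ENNReal.ofReal p) P)
    (hup : ∀ (φ ψ : SimpleAdapted 𝕜 P ν N H) (T : ℝ≥0) (B : Set J), MeasurableSet B →
      eLpNorm (fun ω => φ.integral T B ω - ψ.integral T B ω) (ENNReal.ofReal p) P ≤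
        C * nrm (indicatorProcess (fun ω z => φ.toFun ω z - ψ.toFun ω z) (Ioc 0 T ×ˢ B)))
    {φ : Ω → ℝ≥0 × J → H} (h : LocallyInClosure 𝕜 P ν N nrm φ) :
    IsLpStochIntegrable 𝕜 P ν N p φ := by
  obtain ⟨hφ, hcl⟩ := h
  -- One diagonal sequence serves all times: the `n`-th process is accurate to `2 ^ (-n)` on `(0, n
  -- + 1]`.
  choose ψ hψ using fun n : ℕ => hcl ((n : ℝ≥0) + 1) (by positivity) ((1 / 2) ^ n)
    (ENNReal.pow_pos (by norm_num) n)
  have hsum : ∑' n : ℕ, (1 / 2 : ℝ≥0∞) ^ n ≠ ∞ := by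
    rw [ENNReal.tsum_geometric]; simp
  have hd : ∀ n, AEStronglyMeasurable (fun y : Ω × (ℝ≥0 × J) => φ y.1 y.2 - (ψ n).toFun y.1 y.2)
      (P.prod (timeMeasure.prod ν)) := fun n => hφ.sub (aestronglyMeasurable_toFun hN _)
  have key : ∀ (T : ℝ≥0) (n : ℕ) (B : Set J), T ≤ n → MeasurableSet B →
      nrm (indicatorProcess (fun ω z => φ ω z - (ψ n).toFun ω z) (Ioc 0 T ×ˢ B)) ≤ (1 / 2) ^ n := by
    intro T n B hT hB
    refine le_trans (le_of_eq ?_) ((hnrm.indicator_le _ (Ioc 0 T ×ˢ B)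
      (measurableSet_Ioc.prod hB)).trans (hψ n).le)
    congr 1
    funext ω z
    by_cases hz : z ∈ Ioc 0 T ×ˢ B
    · have hz' : z ∈ Ioc 0 ((n : ℝ≥0) + 1) ×ˢ (univ : Set J) :=
        ⟨⟨hz.1.1, hz.1.2.trans (hT.trans le_self_add)⟩, mem_univ _⟩
      simp only [indicatorProcess, indicator_of_mem hz, indicator_of_mem hz']
    · simp only [indicatorProcess, indicator_of_notMem hz]
  refine ⟨ψ, ?_, fun B hB t ht => ?_⟩
  · have h1 : ∀ M : ℕ, ∀ᵐ y ∂P.prod (timeMeasure.prod ν), y.2 ∈ Ioc 0 (M : ℝ≥0) ×ˢ (univ : Set J) →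
        Tendsto (fun n => (ψ n).toFun y.1 y.2) atTop (𝓝 (φ y.1 y.2)) := by
      intro M
      -- On `(0, M]` the errors from index `M` on have summable norms, so they are summable
      -- pointwise and tend to zero.
      have h2 := hnrm.ae_lt_top (fun j => indicatorProcess
        (fun ω z => φ ω z - (ψ (j + M)).toFun ω z) (Ioc 0 (M : ℝ≥0) ×ˢ univ)) (fun j =>
          aestronglyMeasurable_indicatorProcess (hd _) (measurableSet_Ioc.prod MeasurableSet.univ))
        (ne_top_of_le_ne_top hsum (ENNReal.tsum_le_tsum fun j => (key M (j + M) univ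
          (by push_cast; exact le_add_self) MeasurableSet.univ).trans
            (pow_le_pow_of_le_one zero_le (by norm_num) (Nat.le_add_right _ _))))
      filter_upwards [h2] with y hy hz
      rw [← tendsto_add_atTop_iff_nat M, tendsto_iff_edist_tendsto_0]
      refine (ENNReal.tendsto_atTop_zero_of_tsum_ne_top hy.ne).congr fun j => ?_
      rw [edist_comm, edist_eq_enorm_sub, indicatorProcess, indicator_of_mem hz]
    filter_upwards [ae_all_iff.2 h1, ae_time_pos P ν] with y hy hy0
    obtain ⟨M, hM⟩ := exists_nat_ge y.2.1
    exact hy M ⟨⟨hy0, hM⟩, mem_univ _⟩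
  · obtain ⟨M, hM⟩ := exists_nat_ge t
    have hp' : 1 ≤ ENNReal.ofReal p := by simpa using ENNReal.ofReal_le_ofReal hp
    have hS : MeasurableSet (Ioc 0 t ×ˢ B) := measurableSet_Ioc.prod hB
    have hpow : ∀ i j : ℕ, i ≤ j → nrm (indicatorProcess
        (fun ω z => φ ω z - (ψ (j + M)).toFun ω z) (Ioc 0 t ×ˢ B)) ≤ (1 / 2) ^ i := by
      intro i j hij
      refine (key t (j + M) B (hM.trans (by push_cast; exact le_add_self)) hB).trans ?_
      exact pow_le_pow_of_le_one zero_le (by norm_num) (by omega)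
    -- The upper estimate makes the integrals Cauchy with geometric rate; the extra `1` in the
    -- factor `C * 2 + 1` makes the bound strict.
    obtain ⟨Y, hY, hlim⟩ := Lp.cauchy_complete_eLpNorm hp'
      (f := fun n => (ψ (n + M)).integral t B) (fun n => hmem _ t B hB)
      (B := fun n => (C * 2 + 1) * (1 / 2) ^ n) (by
        rw [ENNReal.tsum_mul_left]
        exact ENNReal.mul_ne_top (ENNReal.add_ne_top.2 ⟨ENNReal.mul_ne_top ENNReal.coe_ne_top
          (by norm_num), ENNReal.one_ne_top⟩) hsum) (by
        intro i n m hn hm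
        refine lt_of_le_of_lt (hup (ψ (n + M)) (ψ (m + M)) t B hB) ?_
        have h1 : nrm (indicatorProcess (fun ω z => (ψ (n + M)).toFun ω z - (ψ (m + M)).toFun ω z)
            (Ioc 0 t ×ˢ B)) ≤ (1 / 2) ^ i + (1 / 2) ^ i := by
          refine (hnrm.le_add (f := indicatorProcess
            (fun ω z => φ ω z - (ψ (m + M)).toFun ω z) (Ioc 0 t ×ˢ B)) (g := fun ω z =>
              - indicatorProcess (fun ω z => φ ω z - (ψ (n + M)).toFun ω z) (Ioc 0 t ×ˢ B) ω z)
            (aestronglyMeasurable_indicatorProcess (hd _) hS)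
            (aestronglyMeasurable_indicatorProcess (hd _) hS).neg
            (Eventually.of_forall fun y => ?_)).trans ?_
          · by_cases hz : y.2 ∈ Ioc 0 t ×ˢ B
            · simp only [indicatorProcess, indicator_of_mem hz]; abel
            · simp only [indicatorProcess, indicator_of_notMem hz]; simp
          · rw [hnrm.neg]
            exact add_le_add (hpow i m hm) (hpow i n hn)
        have h2 : ((1 : ℝ≥0∞) / 2) ^ i ≠ ∞ := ENNReal.pow_ne_top (by norm_num)
        have h3 : ((1 : ℝ≥0∞) / 2) ^ i ≠ 0 := (ENNReal.pow_pos (by norm_num) i).ne'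
        refine (mul_le_mul_right h1 _).trans_lt ?_
        rw [← two_mul, ← mul_assoc, add_mul, one_mul]
        exact ENNReal.lt_add_right (ENNReal.mul_ne_top (ENNReal.mul_ne_top ENNReal.coe_ne_top
          (by norm_num)) h2) h3)
    refine ⟨Y, hY, ?_⟩
    rw [← tendsto_add_atTop_iff_nat M]
    exact hlim

end SimpleAdapted

/-- The two assertions of the main theorem for an abstract norm of integrands. -/
theorem maximal_estimate_and_integrability {𝕜 : Type uK} [RCLike 𝕜] {H : Type uH}
    [NormedAddCommGroup H] [InnerProductSpace 𝕜 H] [CompleteSpace H]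
    {Ω : Type uΩ} [MeasurableSpace Ω] {P : Measure Ω} [IsProbabilityMeasure P]
    {J : Type uJ} [MeasurableSpace J] {ν : Measure J} [SigmaFinite ν]
    {N : Ω → Measure (ℝ≥0 × J)} (hN : IsPoissonRandomMeasure P N (timeMeasure.prod ν))
    {p : ℝ} (hp : 1 < p) {nrm : (Ω → ℝ≥0 × J → H) → ℝ≥0∞}
    (hnrm : IsProcessNorm P (timeMeasure.prod ν) nrm) {C : ℝ≥0}
    (hE : letI := InnerProductSpace.rclikeToReal 𝕜 H; ElementaryEstimate P ν N p nrm C) :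
    (∀ (φ : SimpleAdapted 𝕜 P ν N H) (B : Set J), MeasurableSet B →
      (((C + 1)⁻¹ : ℝ≥0) : ℝ≥0∞) * nrm (indicatorProcess φ.toFun (univ ×ˢ B)) ≤ φ.maximalNorm p B ∧
      φ.maximalNorm p B ≤ (((2 * (p / (p - 1)) * ((p - 1) / (2 * p)) ^ (1 - p)).toNNReal ^ (1 / p) * C
        + 1 : ℝ≥0) : ℝ≥0∞) * nrm (indicatorProcess φ.toFun (univ ×ˢ B))) ∧
    (∀ φ : Ω → ℝ≥0 × J → H,
      IsLpStochIntegrable 𝕜 P ν N p φ ↔ LocallyInClosure 𝕜 P ν N nrm φ) := by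
  let _ := InnerProductSpace.rclikeToReal 𝕜 H
  -- The real structure is obtained by restriction of scalars, so real multiples agree
  -- definitionally with those in `𝕜`.
  have hsmul : ∀ (r : ℝ) (x : H), r • x = (r : 𝕜) • x := fun r x => rfl
  have hp0 : 0 < p := by linarith
  refine ⟨fun φ B hB => ?_, fun φ => ⟨fun h => ?_, fun h => ?_⟩⟩
  · obtain ⟨h1, h2⟩ := SimpleAdapted.maximalNorm_estimate hsmul hN hp hnrm hE φ hB
    constructor
    · rw [ENNReal.coe_inv (by positivity), mul_comm, ← div_eq_mul_inv]
      refine ENNReal.div_le_of_le_mul' (h1.trans ?_)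
      gcongr
      exact le_self_add
    · refine h2.trans ?_
      gcongr
      exact le_self_add
  · exact SimpleAdapted.locallyInClosure_of_isLpStochIntegrable hp.le hN hnrm
      (fun φ T B hB => SimpleAdapted.memLp_integral hsmul hN hp.le φ T hB)
      (fun φ ψ T B hB =>
        (SimpleAdapted.eLpNorm_integral_sub_estimate hsmul hN hp0 hnrm hE φ ψ T hB).2) h
  · exact SimpleAdapted.isLpStochIntegrable_of_locallyInClosure hp.le hN hnrm
      (fun φ T B hB => SimpleAdapted.memLp_integral hsmul hN hp.le φ T hB)
      (fun φ ψ T B hB =>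
        (SimpleAdapted.eLpNorm_integral_sub_estimate hsmul hN hp0 hnrm hE φ ψ T hB).1) h

end PoissonSI

theorem mainTheorem3 :
    (∀ p : ℝ, 2 ≤ p → ∃ c C : ℝ≥0, 0 < c ∧ 0 < C ∧
      ∀ (𝕜 : Type uK) [RCLike 𝕜]
        (H : Type uH) [NormedAddCommGroup H] [InnerProductSpace 𝕜 H] [CompleteSpace H]
        (Ω : Type uΩ) [MeasurableSpace Ω] (P : Measure Ω) [IsProbabilityMeasure P]
        (J : Type uJ) [MeasurableSpace J] (ν : Measure J) [SigmaFinite ν]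
        (N : Ω → Measure (ℝ≥0 × J)),
        IsPoissonRandomMeasure P N (timeMeasure.prod ν) →
        (∀ (φ : SimpleAdapted 𝕜 P ν N H) (B : Set J), MeasurableSet B →
          (c : ℝ≥0∞) *
              interNorm P (timeMeasure.prod ν) p (indicatorProcess φ.toFun (univ ×ˢ B))
            ≤ φ.maximalNorm p B ∧
          φ.maximalNorm p B
            ≤ (C : ℝ≥0∞) *
              interNorm P (timeMeasure.prod ν) p (indicatorProcess φ.toFun (univ ×ˢ B))) ∧
        (∀ φ : Ω → ℝ≥0 × J → H,
          IsLpStochIntegrable 𝕜 P ν N p φ ↔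
            LocallyInClosure 𝕜 P ν N (interNorm P (timeMeasure.prod ν) p) φ)) ∧
    (∀ p : ℝ, 1 < p → p < 2 → ∃ c C : ℝ≥0, 0 < c ∧ 0 < C ∧
      ∀ (𝕜 : Type uK) [RCLike 𝕜]
        (H : Type uH) [NormedAddCommGroup H] [InnerProductSpace 𝕜 H] [CompleteSpace H]
        (Ω : Type uΩ) [MeasurableSpace Ω] (P : Measure Ω) [IsProbabilityMeasure P]
        (J : Type uJ) [MeasurableSpace J] (ν : Measure J) [SigmaFinite ν]
        (N : Ω → Measure (ℝ≥0 × J)),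
        IsPoissonRandomMeasure P N (timeMeasure.prod ν) →
        (∀ (φ : SimpleAdapted 𝕜 P ν N H) (B : Set J), MeasurableSet B →
          (c : ℝ≥0∞) *
              sumNorm P (timeMeasure.prod ν) p (indicatorProcess φ.toFun (univ ×ˢ B))
            ≤ φ.maximalNorm p B ∧
          φ.maximalNorm p B
            ≤ (C : ℝ≥0∞) *
              sumNorm P (timeMeasure.prod ν) p (indicatorProcess φ.toFun (univ ×ˢ B))) ∧
        (∀ φ : Ω → ℝ≥0 × J → H,
          IsLpStochIntegrable 𝕜 P ν N p φ ↔
            LocallyInClosure 𝕜 P ν N (sumNorm P (timeMeasure.prod ν) p) φ)) := by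
  refine ⟨fun p hp => ?_, fun p hp1 hp2 => ?_⟩
  · obtain ⟨C, hC⟩ := exists_norm_estimate_of_two_le.{uΩ, uJ, uH} hp
    -- The added ones ensure positivity of both constants, which are chosen before the scalar field,
    -- the spaces and the random measure.
    refine ⟨(C + 1)⁻¹, (2 * (p / (p - 1)) * ((p - 1) / (2 * p)) ^ (1 - p)).toNNReal ^ (1 / p) * C + 1,
      by positivity, by positivity, ?_⟩
    intro 𝕜 _ H _ _ _ Ω _ P _ J _ ν _ N hN
    let _ := InnerProductSpace.rclikeToReal 𝕜 H
    exact maximal_estimate_and_integrability hN (by linarith)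
      (isProcessNorm_interNorm (by linarith)) (fun h => hC hN h)
  · obtain ⟨C, hC⟩ := exists_norm_estimate_of_lt_two.{uΩ, uJ, uH} hp1 hp2
    refine ⟨(C + 1)⁻¹, (2 * (p / (p - 1)) * ((p - 1) / (2 * p)) ^ (1 - p)).toNNReal ^ (1 / p) * C + 1,
      by positivity, by positivity, ?_⟩
    intro 𝕜 _ H _ _ _ Ω _ P _ J _ ν _ N hN
    let _ := InnerProductSpace.rclikeToReal 𝕜 H
    exact maximal_estimate_and_integrability hN hp1
      (isProcessNorm_sumNorm hp1.le) (fun h => hC hN h)
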